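/- Let $\rho>0$, let $(E_i)_{i\ge1}$ be i.i.d. exponential random variables with parameter $1$ and let $(B_j)_{j\ge1}$ be i.i.d. exponential random variables with parameter $\rho$, independent of $(E_i)$. Put $t_0=0$ and $t_n=\sum_{i=1}^n E_i/i$ for $n\ge1$ (these are distributed as the split times of a Yule process started from one individual). The $i$th bin, $i\ge1$, is the interval $(t_{i-1},t_i]$, and the $B_j$ are the locations of the balls, so that, given $(t_n)$, each ball falls into the $i$th bin with probability $P_i=e^{-\rho t_{i-1}}-e^{-\rho t_i}$. For $n\geq 1$ let $$\mathcal N_n=\Big\{\frac{i}{n^{1/(\rho+2)}}: i\ge1,\ \text{none of } B_1,\dots,B_n \text{ lies in the } i\text{th bin}\Big\}$$ be the point process on $\mathbb R_+=[0,\infty)$ of the rescaled indices of the bins that are empty when $n$ balls have been thrown. Theorem. Almost surely $t_n-\log n$ converges to a finite random variable $M_\infty$; put $W_\infty=e^{-M_\infty}$. As $n\to\infty$, the sequence $(\mathcal N_n)$ converges in distribution (as random locally finite measures on $\mathbb R_+$ with the vague topology) to a point process $\mathcal N_\infty$ whose distribution is given by $$\mathbb E\big[e^{-\mathcal N_\infty(g)}\big]=\mathbb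 E\left[\exp\left(-\frac{W_\infty^{-\rho}}{\rho}\int_{\mathbb R_+}\big(1-e^{-g(x)}\big)x^{\rho+1}\,dx\right)\right]$$ for every non-negative continuous function $g$ with compact support on $\mathbb R_+$, where $\mathcal N(g)$ denotes the sum of $g$ over the points of $\mathcal N$. Equivalently, $(\mathcal N_n)$ converges in distribution to the point process $$\Big(W^{\rho/(\rho+2)}\,\tau_i^{1/(\rho+2)}\Big)_{i\ge1},$$ where $W$ has the distribution of $W_\infty$ and $(\tau_i)_{i\ge1}$ are the successive points of a homogeneous Poisson process on $\mathbb R_+$ with rate $\frac1{\rho(\rho+2)}$, independent of $W$. -/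

import Mathlib

open MeasureTheory ProbabilityTheory Filter Topology
open scoped NNReal ENNReal CompactlySupported

namespace YuleBins

noncomputable section

/-! ### Point processes on the half-line `[0, ∞)` and their convergence in distribution -/

/-- Locally finite (Radon) measures on `[0, ∞)`, the state space of point processes. -/
def LocFinMeasure : Type := {μ : Measure ℝ≥0 // IsLocallyFiniteMeasure μ}

/-- The underlying measure. -/
def LocFinMeasure.toMeasure (μ : LocFinMeasure) : Measure ℝ≥0 := μ.1

/-- `μ(g) = ∫ g dμ` for a nonnegative continuous function `g` with compact support. -/
def LocFinMeasure.integral (μ : LocFinMeasure) (g : C_c(ℝ≥0, ℝ≥0)) : ℝ :=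
  ∫ x, (g x : ℝ) ∂μ.toMeasure

/-- The vague topology: the coarsest one making all the maps `μ ↦ μ(g)` continuous. -/
instance : TopologicalSpace LocFinMeasure :=
  ⨅ g : C_c(ℝ≥0, ℝ≥0),
    TopologicalSpace.induced (fun μ : LocFinMeasure => μ.integral g) inferInstance

/-- The Borel sigma-algebra of the vague topology. -/
instance : MeasurableSpace LocFinMeasure := borel LocFinMeasure

instance : BorelSpace LocFinMeasure := ⟨rfl⟩

/-- A point measure: every measurable set has a mass in `{0, 1, 2, …} ∪ {∞}`. -/
def LocFinMeasure.IsPointMeasure (μ : LocFinMeasure) : Prop :=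
  ∀ A : Set ℝ≥0, MeasurableSet A → ∃ k : ℕ∞, μ.toMeasure A = (k : ℝ≥0∞)

open Classical in
/-- A measure seen as an element of `LocFinMeasure`. The value `0` for a measure that is not
locally finite is a convention. -/
def toLocFin (μ : Measure ℝ≥0) : LocFinMeasure :=
  if h : IsLocallyFiniteMeasure μ then ⟨μ, h⟩ else ⟨0, inferInstance⟩

/-! ### The bins and the balls -/

variable {Ω : Type*}

/-- The split times `t_n = ∑_{i=1}^n E_i / i`. The variable `E_{i+1}` is `E i` here. -/
def splitTime (E : ℕ → Ω → ℝ) (n : ℕ) (ω : Ω) : ℝ :=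
  ∑ i ∈ Finset.range n, E i ω / ((i : ℝ) + 1)

/-- `M_n = t_n - log n`. -/
def M (E : ℕ → Ω → ℝ) (n : ℕ) (ω : Ω) : ℝ := splitTime E n ω - Real.log n

/-- `M_∞ = lim M_n`. -/
def Minf (E : ℕ → Ω → ℝ) (ω : Ω) : ℝ := limUnder atTop (fun n : ℕ => M E n ω)

/-- `W_∞ = exp (-M_∞)`. -/
def Winf (E : ℕ → Ω → ℝ) (ω : Ω) : ℝ := Real.exp (-Minf E ω)

/-- When the `n` balls `B 0, …, B (n - 1)` are thrown, the bin of index `i + 1`, that is the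
interval `(t_i, t_{i+1}]`, contains none of them. -/
def BinEmpty (E B : ℕ → Ω → ℝ) (n : ℕ) (ω : Ω) (i : ℕ) : Prop :=
  ∀ j < n, B j ω ∉ Set.Ioc (splitTime E i ω) (splitTime E (i + 1) ω)

/-- The sum of the Dirac masses at `i / n^{1/(ρ+2)}` over the indices `i ≥ 1` of the empty bins
(the index is `i + 1` for `i : ℕ`). -/
def emptyBinsMeasure (ρ : ℝ) (E B : ℕ → Ω → ℝ) (n : ℕ) (ω : Ω) : Measure ℝ≥0 :=
  Measure.sum fun i : {i : ℕ // BinEmpty E B n ω i} =>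
    Measure.dirac (((i.1 : ℝ≥0) + 1) / (n : ℝ≥0) ^ (1 / (ρ + 2)))

/-- For `n ≥ 1`, the measure `emptyBinsMeasure` is locally finite. -/
theorem isLocallyFiniteMeasure_emptyBinsMeasure (ρ : ℝ) (E B : ℕ → Ω → ℝ) {n : ℕ} (hn : n ≠ 0)
    (ω : Ω) : IsLocallyFiniteMeasure (emptyBinsMeasure ρ E B n ω) := by
  refine ⟨fun x => ⟨Set.Iio (x + 1), Iio_mem_nhds (by simp), ?_⟩⟩
  have hc : 0 < (n : ℝ≥0) ^ (1 / (ρ + 2)) :=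
    NNReal.rpow_pos (by exact_mod_cast Nat.pos_of_ne_zero hn)
  set c := (n : ℝ≥0) ^ (1 / (ρ + 2)) with hcdef
  rw [emptyBinsMeasure, Measure.sum_apply _ measurableSet_Iio]
  obtain ⟨K, hK⟩ := exists_nat_gt ((x + 1) * c)
  have hfin : {i : {i : ℕ // BinEmpty E B n ω i} | i.1 < K}.Finite :=
    Set.Finite.preimage (f := Subtype.val) Subtype.val_injective.injOn (Set.finite_Iio K)
  rw [tsum_eq_sum (s := hfin.toFinset)]
  · exact ENNReal.sum_lt_top.2 fun i _ => measure_lt_top _ _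
  · intro i hi
    have hi' : K ≤ i.1 := by simpa using hi
    rw [Measure.dirac_apply' _ measurableSet_Iio]
    refine Set.indicator_of_notMem ?_ _
    rw [Set.mem_Iio, not_lt, le_div_iff₀ hc]
    have h1 : (K : ℝ≥0) ≤ (i.1 : ℝ≥0) := by exact_mod_cast hi'
    exact hK.le.trans (h1.trans (by simp))

/-- The point process `𝒩_n` of the rescaled indices of the empty bins. -/
def emptyBins (ρ : ℝ) (E B : ℕ → Ω → ℝ) (n : ℕ) (ω : Ω) : LocFinMeasure :=
  toLocFin (emptyBinsMeasure ρ E B n ω)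

/-! ### The limit -/

/-- The gaps `τ_1, τ_2 - τ_1, …` of a sequence of points. The point `τ_{i+1}` is `τ i` here. -/
def gap (τ : ℕ → Ω → ℝ) : ℕ → Ω → ℝ
  | 0, ω => τ 0 ω
  | i + 1, ω => τ (i + 1) ω - τ i ω

/-- `τ 0, τ 1, …` are the successive points of a homogeneous Poisson process on `[0, ∞)` with
rate `r`: the gaps are i.i.d. exponential variables with parameter `r`. -/
structure IsPoissonPoints [MeasurableSpace Ω] (r : ℝ) (τ : ℕ → Ω → ℝ) (P : Measure Ω) :
    Prop where
  measurable : ∀ i, Measurable (τ i)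
  indep : iIndepFun (gap τ) P
  law : ∀ i, HasLaw (gap τ i) (expMeasure r) P

/-- The sum of the Dirac masses at the points `w^{ρ/(ρ+2)} s_i^{1/(ρ+2)}`. -/
def scaledPoints (ρ w : ℝ) (s : ℕ → ℝ) : Measure ℝ≥0 :=
  Measure.sum fun i : ℕ =>
    Measure.dirac (Real.toNNReal (w ^ (ρ / (ρ + 2)) * s i ^ (1 / (ρ + 2))))

end

end YuleBins

namespace YuleBins

noncomputable section

/-! ### The vague topology -/

/-! Write t_i = log i + M_i. The bin (t_i, t_{i+1}] has mass e^{-ρ M_i} i^{-ρ} (1 - e^{-ρ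
E_i/(i+1)}), with `E i` written E_i; this is about W_∞^ρ ρ E_i i^{-ρ-1}. Given the split times, n
balls miss it with probability about e^{-n·mass}, and averaging over the exponential variable E_i
gives about i^{ρ+1}/(n ρ W_∞^ρ). For n = a^{ρ+2} and i near xa this equals a^{-1} x^{ρ+1}
W_∞^{-ρ}/ρ. Each empty bin at this scale is thus a rare event, and sums of these probabilities are
Riemann sums. Given W_∞ the events are nearly independent, whence a mixed Poisson limit with
intensity W_∞^{-ρ} x^{ρ+1}/ρ.

The proof works with Laplace functionals, that is with the mean of ∏ (1 - h_i 1{bin i empty}) for h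
= 1 - e^{-g}. Two dependences have to be removed.

The balls: n balls do not fill the bins independently, but a Poisson number of them does. The
product increases with the number of balls, so the fixed number n lies between Poisson numbers of
mean κn with κ on either side of 1, up to a Chernoff error (`poisson_average_le`,
`le_poisson_average`).

The split times: M_i depends on the earlier E_j. It is frozen at a time K; the martingale argument
of `ae_tendsto_M` makes the later oscillation exceed δ with small probability only. The variables
E_i with i ≥ K are independent of M_K, so the product can be averaged factor by factor
(`integral_indepProd`), and `tendsto_prod_meanEmpty` gives its limit. The first K bins are nonempty
with high probability. Taking κ = e^{±ρδ} makes the error from the balls a shift of M by δ as well,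
and n, then K, then δ go to their limits in `tendsto_integral_emptyProd`.

The limit law is constructed directly as that of the rescaled Poisson points. Its Laplace functional
comes from `integral_exp_neg_tsum_arrival` and a change of variables. Convergence of Laplace
functionals is enough because the vague topology is induced by countably many test functions: this
embeds the problem in the Hilbert cube, where Stone–Weierstrass applies
(`tendsto_of_tendsto_laplace`). -/

instance (μ : LocFinMeasure) : IsLocallyFiniteMeasure μ.toMeasure := μ.2

namespace LocFinMeasure

lemma integrable_coe (μ : LocFinMeasure) (g : C_c(ℝ≥0, ℝ≥0)) :
    Integrable (fun x => (g x : ℝ)) μ.toMeasure := by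
  refine Continuous.integrable_of_hasCompactSupport (by fun_prop) ?_
  exact g.hasCompactSupport.comp_left (g := fun y : ℝ≥0 => (y : ℝ)) rfl

lemma integral_nonneg (μ : LocFinMeasure) (g : C_c(ℝ≥0, ℝ≥0)) : 0 ≤ μ.integral g :=
  MeasureTheory.integral_nonneg fun _ => NNReal.coe_nonneg _

lemma integral_add (μ : LocFinMeasure) (f g : C_c(ℝ≥0, ℝ≥0)) :
    μ.integral (f + g) = μ.integral f + μ.integral g := by
  simp only [integral]
  rw [← MeasureTheory.integral_add (μ.integrable_coe f) (μ.integrable_coe g)]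
  simp

lemma integral_zero (μ : LocFinMeasure) : μ.integral 0 = 0 := by
  simp [integral]

lemma continuous_integral (g : C_c(ℝ≥0, ℝ≥0)) :
    Continuous fun μ : LocFinMeasure => μ.integral g :=
  continuous_iff_le_induced.2 (iInf_le _ g)

lemma measurable_integral (g : C_c(ℝ≥0, ℝ≥0)) :
    Measurable fun μ : LocFinMeasure => μ.integral g :=
  (continuous_integral g).measurable

end LocFinMeasure

/-- The function equal to `1` on `[0, a]`, to `0` on `[a + 1/k, ∞)` and affine in between. -/
def plateau (a k : ℝ≥0) : C_c(ℝ≥0, ℝ≥0) where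
  toFun x := min 1 (k * (a - x))
  continuous_toFun := by fun_prop
  hasCompactSupport' := by
    refine HasCompactSupport.intro (isCompact_Icc (a := 0) (b := a)) fun x hx => ?_
    have : a ≤ x := by
      by_contra h
      exact hx ⟨zero_le, (not_le.1 h).le⟩
    simp [tsub_eq_zero_of_le this]

lemma plateau_apply (a k x : ℝ≥0) : plateau a k x = min 1 (k * (a - x)) := rfl

/-- The functions vanishing beyond m are separable for the uniform distance. If d approximates g
within ε there, then |μ(g) - μ(d)| ≤ ε μ(h), where h = `plateau (m + 1) 1` equals 1 on [0, m] and
vanishes from m + 1 on. Adding these functions h to the countable family keeps μ(h) bounded near a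
given measure, so μ(g) is continuous for the topology of the family. -/
lemma exists_isInducing_integral :
    ∃ G : ℕ → C_c(ℝ≥0, ℝ≥0),
      IsInducing fun (μ : LocFinMeasure) (k : ℕ) => μ.integral (G k) := by
  have key : ∀ m : ℕ, ∃ D : Set C_c(ℝ≥0, ℝ≥0), D.Countable ∧
      ∀ g : C_c(ℝ≥0, ℝ≥0), (∀ x, (m : ℝ≥0) < x → g x = 0) → ∀ ε > 0, ∃ d ∈ D,
        ∀ x, |(g x : ℝ) - d x| ≤ ε * plateau (m + 1) 1 x := by
    intro m
    let S : Type := {g : C_c(ℝ≥0, ℝ≥0) // ∀ x, (m : ℝ≥0) < x → g x = 0}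
    let ι : S → C(Set.Icc (0 : ℝ≥0) m, ℝ≥0) := fun g => g.1.toContinuousMap.restrict _
    let _ : TopologicalSpace S := TopologicalSpace.induced ι inferInstance
    have : SecondCountableTopology S :=
      TopologicalSpace.secondCountableTopology_induced _ _ ι
    obtain ⟨s, hs, hd⟩ := TopologicalSpace.exists_countable_dense S
    refine ⟨Subtype.val '' s, hs.image _, fun g hg ε hε => ?_⟩
    have hc : Continuous ι := continuous_induced_dom
    have hopen : IsOpen {d : S | dist (ι d) (ι ⟨g, hg⟩) < ε} :=
      isOpen_lt (by fun_prop) continuous_const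
    obtain ⟨d, hd2, hd1⟩ := hd.exists_mem_open hopen ⟨⟨g, hg⟩, by simpa using hε⟩
    refine ⟨d.1, ⟨d, hd2, rfl⟩, fun x => ?_⟩
    rcases le_or_gt x m with hx | hx
    · have h1 := (ContinuousMap.dist_apply_le_dist (f := ι d) (g := ι ⟨g, hg⟩)
        ⟨x, zero_le, hx⟩).trans hd1.le
      have h2 : plateau (m + 1) 1 x = 1 := by
        rw [plateau_apply, one_mul, min_eq_left]
        exact le_tsub_of_add_le_left (by gcongr)
      rw [h2, abs_sub_comm]
      simpa [ι, NNReal.dist_eq] using h1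
    · rw [hg x hx, d.2 x hx]
      simp
      positivity
  choose D hD hD' using key
  let T : Set C_c(ℝ≥0, ℝ≥0) := (⋃ m, D m) ∪ Set.range fun m : ℕ => plateau (m + 1) 1
  have hT : T.Countable := (Set.countable_iUnion hD).union (Set.countable_range _)
  obtain ⟨G, hG⟩ := hT.exists_eq_range ⟨plateau ((0 : ℕ) + 1) 1, Or.inr ⟨0, rfl⟩⟩
  refine ⟨G, ⟨le_antisymm ?_ ?_⟩⟩
  · rw [← continuous_iff_le_induced]
    exact continuous_pi fun k => LocFinMeasure.continuous_integral _
  · refine le_iInf fun g => ?_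
    let T' : TopologicalSpace LocFinMeasure :=
      TopologicalSpace.induced (fun (μ : LocFinMeasure) (k : ℕ) => μ.integral (G k)) inferInstance
    have hcont : ∀ d ∈ T, Continuous[T', _] fun μ : LocFinMeasure => μ.integral d := by
      intro d hd
      rw [hG] at hd
      obtain ⟨k, rfl⟩ := hd
      exact (continuous_apply k).comp (f := fun (μ : LocFinMeasure) (k : ℕ) => μ.integral (G k))
        continuous_induced_dom
    have : Continuous[T', _] fun μ : LocFinMeasure => μ.integral g := by
      refine continuous_iff_continuousAt.2 fun μ₀ => ?_
      obtain ⟨m, hm⟩ : ∃ m : ℕ, ∀ x, (m : ℝ≥0) < x → g x = 0 := by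
        obtain ⟨b, hb⟩ := g.hasCompactSupport.isCompact.bddAbove
        obtain ⟨m, hm⟩ := exists_nat_ge b
        refine ⟨m, fun x hx => ?_⟩
        by_contra h
        exact absurd (hb (subset_tsupport _ h)) (not_le.2 (hm.trans_lt hx))
      rw [ContinuousAt, Metric.tendsto_nhds]
      intro ε hε
      set h := plateau (m + 1) 1 with hh
      have hpos : 0 < μ₀.integral h + 1 := by linarith [μ₀.integral_nonneg h]
      -- Near μ₀ one has μ(h) < μ₀(h) + 1, so replacing g by d costs at most ε/4 at μ and at μ₀; the
      -- variation of μ(d) costs another ε/4.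
      obtain ⟨d, hd, hdg⟩ := hD' m g hm (ε / (4 * (μ₀.integral h + 1))) (by positivity)
      have hbound : ∀ μ : LocFinMeasure, |μ.integral g - μ.integral d| ≤
          ε / (4 * (μ₀.integral h + 1)) * μ.integral h := by
        intro μ
        simp only [LocFinMeasure.integral]
        rw [← integral_sub (μ.integrable_coe g) (μ.integrable_coe d), ← integral_const_mul]
        exact norm_integral_le_of_norm_le (f := fun x => (g x : ℝ) - d x)
          ((μ.integrable_coe h).const_mul _) (ae_of_all _ hdg)
      have e1 := (hcont h (Or.inr ⟨m, rfl⟩)).continuousAt.eventually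
        (gt_mem_nhds (show μ₀.integral h < μ₀.integral h + 1 by linarith))
      have e2 := Metric.tendsto_nhds.1
        ((hcont d (Or.inl (Set.mem_iUnion.2 ⟨m, hd⟩))).continuousAt (x := μ₀)) (ε / 4)
        (by positivity)
      filter_upwards [e1, e2] with μ h1 h2
      have b1 := hbound μ
      have b2 := hbound μ₀
      have c : ∀ y ≤ μ₀.integral h + 1, ε / (4 * (μ₀.integral h + 1)) * y ≤ ε / 4 := by
        intro y hy
        calc _ ≤ ε / (4 * (μ₀.integral h + 1)) * (μ₀.integral h + 1) := by gcongr
          _ = ε / 4 := by field_simp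
      have c1 := c _ h1.le
      have c2 := c (μ₀.integral h) (by linarith)
      rw [Real.dist_eq] at h2 ⊢
      have := abs_le.1 b1
      have := abs_le.1 b2
      have := abs_lt.1 h2
      exact abs_lt.2 ⟨by linarith, by linarith⟩
    exact continuous_iff_le_induced.1 this

/-- A vaguely convergence determining sequence of test functions. -/
def testSeq : ℕ → C_c(ℝ≥0, ℝ≥0) := exists_isInducing_integral.choose

lemma isInducing_testSeq :
    IsInducing fun (μ : LocFinMeasure) (k : ℕ) => μ.integral (testSeq k) :=
  exists_isInducing_integral.choose_spec

lemma measurableSpace_eq_comap :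
    (inferInstance : MeasurableSpace LocFinMeasure) = MeasurableSpace.comap
      (fun (μ : LocFinMeasure) (k : ℕ) => μ.integral (testSeq k)) inferInstance := by
  change borel LocFinMeasure = _
  rw [isInducing_testSeq.eq_induced, borel_comap]
  congr 1
  exact (BorelSpace.measurable_eq).symm

lemma measurable_of_integral {α : Type*} [MeasurableSpace α] {f : α → LocFinMeasure}
    (hf : ∀ g, Measurable fun a => (f a).integral g) : Measurable f := by
  have h := measurableSpace_eq_comap
  have : @Measurable α LocFinMeasure _ (MeasurableSpace.comap
      (fun (μ : LocFinMeasure) (k : ℕ) => μ.integral (testSeq k)) inferInstance) f :=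
    measurable_comap_iff.2 (measurable_pi_iff.2 fun k => hf _)
  rwa [← h] at this

lemma aemeasurable_of_integral {α : Type*} [MeasurableSpace α] {m : Measure α}
    {f : α → LocFinMeasure} (hf : ∀ g, AEMeasurable (fun a => (f a).integral g) m) :
    AEMeasurable f m := by
  classical
  have h := measurableSpace_eq_comap
  set F := fun (μ : LocFinMeasure) (k : ℕ) => μ.integral (testSeq k) with hF
  have hFf : AEMeasurable (fun a => F (f a)) m := aemeasurable_pi_iff.2 fun k => hf _
  obtain ⟨s, hs, hs', hs0⟩ := exists_measurable_superset_of_null (ae_iff.1 hFf.ae_eq_mk)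
  -- A measurable version of F ∘ f need not take its values in the range of F. Hence f itself is
  -- modified, by the zero measure on a measurable null set outside which F ∘ f agrees with its
  -- version.
  refine ⟨fun a => if a ∈ s then ⟨0, inferInstance⟩ else f a, ?_, ?_⟩
  · have : @Measurable α LocFinMeasure _ (MeasurableSpace.comap F inferInstance)
        (fun a => if a ∈ s then ⟨0, inferInstance⟩ else f a) := by
      refine measurable_comap_iff.2 ?_
      have h0 : Measurable fun a => if a ∈ s then F ⟨0, inferInstance⟩ else hFf.mk _ a :=
        Measurable.ite hs' measurable_const hFf.measurable_mk
      convert! h0 using 1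
      ext1 a
      by_cases ha : a ∈ s
      · simp [ha]
      · have := fun h => ha (hs (Set.mem_ofPred.2 h))
        simp [ha, not_not.1 this]
    rwa [← h] at this
  · have : ∀ᵐ a ∂m, a ∉ s := measure_eq_zero_iff_ae_notMem.1 hs0
    filter_upwards [this] with a ha
    simp [ha]

/-- The embedding of the space of locally finite measures into the Hilbert cube. -/
def toCube (μ : LocFinMeasure) (k : ℕ) : Set.Icc (0 : ℝ) 1 :=
  ⟨Real.exp (-μ.integral (testSeq k)), (Real.exp_pos _).le,
    Real.exp_le_one_iff.2 (neg_nonpos.2 (μ.integral_nonneg _))⟩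

lemma isInducing_toCube : IsInducing toCube := by
  have h1 : IsInducing fun (v : ℕ → Set.Icc (0 : ℝ) 1) (k : ℕ) => (v k : ℝ) :=
    IsInducing.piMap fun _ => IsInducing.subtypeVal
  rw [← h1.of_comp_iff]
  have h2 : IsInducing fun x : ℝ => Real.exp (-x) :=
    Real.isOpenEmbedding_exp.isInducing.comp (Homeomorph.neg ℝ).isInducing
  exact (IsInducing.piMap fun _ : ℕ => h2).comp isInducing_testSeq

/-- A monomial in the coordinates of the cube is again of the form exp(-μ(g)), since test functions
add. The hypothesis therefore covers the algebra generated by the coordinates. This algebra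
separates points, so it is uniformly dense by Stone–Weierstrass. -/
lemma tendsto_integral_toCube {Q : ℕ → ProbabilityMeasure LocFinMeasure}
    {R : ProbabilityMeasure LocFinMeasure}
    (h : ∀ g : C_c(ℝ≥0, ℝ≥0),
      Tendsto (fun n => ∫ μ, Real.exp (-μ.integral g) ∂(Q n : Measure LocFinMeasure)) atTop
        (𝓝 (∫ μ, Real.exp (-μ.integral g) ∂(R : Measure LocFinMeasure))))
    (f : C(ℕ → Set.Icc (0 : ℝ) 1, ℝ)) :
    Tendsto (fun n => ∫ μ, f (toCube μ) ∂(Q n : Measure LocFinMeasure)) atTop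
      (𝓝 (∫ μ, f (toCube μ) ∂(R : Measure LocFinMeasure))) := by
  have hint : ∀ (f : C(ℕ → Set.Icc (0 : ℝ) 1, ℝ)) (S : ProbabilityMeasure LocFinMeasure),
      Integrable (fun μ => f (toCube μ)) (S : Measure LocFinMeasure) := by
    intro f S
    refine Integrable.of_bound
      (f.continuous.comp isInducing_toCube.continuous).measurable.aestronglyMeasurable ‖f‖ ?_
    exact ae_of_all _ fun μ => f.norm_coe_le_norm _
  let π : ℕ → C(ℕ → Set.Icc (0 : ℝ) 1, ℝ) := fun k => ⟨fun v => v k, by fun_prop⟩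
  let A := Algebra.adjoin ℝ (Set.range π)
  have hmon : ∀ s ∈ Submonoid.closure (Set.range π), ∃ g : C_c(ℝ≥0, ℝ≥0),
      ∀ μ, s (toCube μ) = Real.exp (-μ.integral g) := by
    intro s hs
    induction hs using Submonoid.closure_induction with
    | mem x hx =>
      obtain ⟨k, rfl⟩ := hx
      exact ⟨testSeq k, fun μ => rfl⟩
    | one => exact ⟨0, fun μ => by simp [LocFinMeasure.integral_zero]⟩
    | mul x y _ _ hx hy =>
      obtain ⟨g, hg⟩ := hx
      obtain ⟨g', hg'⟩ := hy
      refine ⟨g + g', fun μ => ?_⟩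
      rw [LocFinMeasure.integral_add, neg_add, Real.exp_add, ← hg, ← hg']
      rfl
  have hA : ∀ s ∈ A, Tendsto (fun n => ∫ μ, s (toCube μ) ∂(Q n : Measure LocFinMeasure)) atTop
      (𝓝 (∫ μ, s (toCube μ) ∂(R : Measure LocFinMeasure))) := by
    intro s hs
    rw [← Subalgebra.mem_toSubmodule, Algebra.adjoin_eq_span] at hs
    induction hs using Submodule.span_induction with
    | mem x hx =>
      obtain ⟨g, hg⟩ := hmon x hx
      simpa only [hg] using h g
    | zero => simp
    | add x y _ _ hx hy =>
      simp only [ContinuousMap.add_apply]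
      simp_rw [integral_add (hint x _) (hint y _)]
      exact hx.add hy
    | smul c x _ hx =>
      simp only [ContinuousMap.coe_smul, Pi.smul_apply, integral_smul]
      exact hx.const_smul c
  have hsep : A.SeparatesPoints := by
    intro v w hvw
    obtain ⟨k, hk⟩ := Function.ne_iff.1 hvw
    exact ⟨π k, ⟨π k, Algebra.subset_adjoin ⟨k, rfl⟩, rfl⟩, fun h => hk (Subtype.ext h)⟩
  rw [Metric.tendsto_atTop]
  intro ε hε
  obtain ⟨⟨s, hsA⟩, hs⟩ :=
    ContinuousMap.exists_mem_subalgebra_near_continuousMap_of_separatesPoints A hsep f (ε / 3)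
      (by positivity)
  have hclose : ∀ S : ProbabilityMeasure LocFinMeasure,
      |∫ μ, f (toCube μ) ∂(S : Measure LocFinMeasure) -
        ∫ μ, s (toCube μ) ∂(S : Measure LocFinMeasure)| ≤ ε / 3 := by
    intro S
    rw [← integral_sub (hint f S) (hint s S)]
    have h1 : ε / 3 * (S : Measure LocFinMeasure).real Set.univ = ε / 3 := by simp
    have h2 := norm_integral_le_of_norm_le_const (μ := (S : Measure LocFinMeasure))
      (f := fun μ => f (toCube μ) - s (toCube μ)) (C := ε / 3) (ae_of_all _ fun μ => by
        rw [norm_sub_rev]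
        exact ((s - f).norm_coe_le_norm (toCube μ)).trans hs.le)
    rwa [h1] at h2
  obtain ⟨N, hN⟩ := Metric.tendsto_atTop.1 (hA s hsA) (ε / 3) (by positivity)
  refine ⟨N, fun n hn => ?_⟩
  have a1 := abs_le.1 (hclose (Q n))
  have a2 := abs_le.1 (hclose R)
  have a3 := hN n hn
  rw [Real.dist_eq] at a3 ⊢
  have a3 := abs_lt.1 a3
  exact abs_lt.2 ⟨by linarith, by linarith⟩

/-- Convergence of the Laplace functionals implies convergence in distribution. -/
theorem tendsto_of_tendsto_laplace {Q : ℕ → ProbabilityMeasure LocFinMeasure}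
    {R : ProbabilityMeasure LocFinMeasure}
    (h : ∀ g : C_c(ℝ≥0, ℝ≥0),
      Tendsto (fun n => ∫ μ, Real.exp (-μ.integral g) ∂(Q n : Measure LocFinMeasure)) atTop
        (𝓝 (∫ μ, Real.exp (-μ.integral g) ∂(R : Measure LocFinMeasure)))) :
    Tendsto Q atTop (𝓝 R) := by
  have hm : Measurable toCube := isInducing_toCube.continuous.measurable
  have hmap : Tendsto (fun n => (Q n).map hm.aemeasurable) atTop (𝓝 (R.map hm.aemeasurable)) := by
    rw [ProbabilityMeasure.tendsto_iff_forall_integral_tendsto]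
    intro f
    have hf : ∀ S : ProbabilityMeasure LocFinMeasure,
        ∫ v, f v ∂((S.map hm.aemeasurable : ProbabilityMeasure _) : Measure _) =
          ∫ μ, f (toCube μ) ∂(S : Measure LocFinMeasure) := fun S =>
      integral_map hm.aemeasurable f.continuous.measurable.aestronglyMeasurable
    simp_rw [hf]
    exact tendsto_integral_toCube h f.toContinuousMap
  -- The open sets are the preimages of open sets of the cube, so the portmanteau inequality pulls
  -- back along `toCube`; neither injectivity nor a closed range is needed.
  refine tendsto_of_forall_isOpen_le_liminf' fun U hU => ?_
  obtain ⟨V, hV, rfl⟩ := isInducing_toCube.isOpen_iff.1 hU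
  have := ProbabilityMeasure.le_liminf_measure_open_of_tendsto hmap hV
  simpa [Measure.map_apply hm hV.measurableSet] using this

/-! ### Point measures -/

lemma exists_enat_tsum {ι : Type*} (a : ι → ℝ≥0∞) (ha : ∀ i, ∃ k : ℕ∞, a i = k) :
    ∃ k : ℕ∞, ∑' i, a i = k := by
  have hc : IsClosed (Set.range ENat.toENNReal) := ENat.isClosedEmbedding_toENNReal.isClosed_range
  have : ∑' i, a i ∈ Set.range ENat.toENNReal := by
    refine hc.mem_of_tendsto ENNReal.summable.hasSum (Eventually.of_forall fun s => ?_)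
    induction s using Finset.cons_induction with
    | empty => exact ⟨0, by simp⟩
    | cons i s hi ih =>
      obtain ⟨k, hk⟩ := ha i
      obtain ⟨l, hl⟩ := ih
      exact ⟨k + l, by rw [Finset.sum_cons, ENat.toENNReal_add, hk, hl]⟩
  obtain ⟨k, hk⟩ := this
  exact ⟨k, hk.symm⟩

lemma exists_enat_sum_dirac {ι : Type*} (x : ι → ℝ≥0) {A : Set ℝ≥0} (hA : MeasurableSet A) :
    ∃ k : ℕ∞, Measure.sum (fun i => Measure.dirac (x i)) A = k := by
  rw [Measure.sum_apply _ hA]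
  refine exists_enat_tsum _ fun i => ?_
  rw [Measure.dirac_apply' _ hA]
  by_cases h : x i ∈ A
  · exact ⟨1, by simp [h]⟩
  · exact ⟨0, by simp [h]⟩

/-- This reduces an uncountable family of conditions to a countable one, hence to a measurable
event. The extended naturals are closed in [0, ∞], so integrality passes from rational to real end
points by continuity from below. A π-λ argument inside each [0, N) and a limit in N then give all
measurable sets. -/
lemma isPointMeasure_of_Iio (μ : LocFinMeasure)
    (h : ∀ q : ℚ, ∃ k : ℕ∞, μ.toMeasure (Set.Iio (q : ℝ).toNNReal) = k) :
    μ.IsPointMeasure := by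
  have hc : IsClosed (Set.range ENat.toENNReal) := ENat.isClosedEmbedding_toENNReal.isClosed_range
  have hfin : ∀ x, μ.toMeasure (Set.Iio x) ≠ ∞ := fun x =>
    ((measure_mono (t := Set.Icc 0 x) (fun y hy => ⟨zero_le, le_of_lt hy⟩)).trans_lt
      (isCompact_Icc (a := (0 : ℝ≥0)) (b := x)).measure_lt_top).ne
  have hIio : ∀ x : ℝ≥0, ∃ k : ℕ∞, μ.toMeasure (Set.Iio x) = k := by
    intro x
    have hu : Set.Iio x = ⋃ q : {q : ℚ // (q : ℝ).toNNReal ≤ x}, Set.Iio ((q : ℚ) : ℝ).toNNReal := by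
      ext y
      simp only [Set.mem_Iio, Set.mem_iUnion]
      constructor
      · intro hy
        obtain ⟨q, h1, h2⟩ := exists_rat_btwn (NNReal.coe_lt_coe.2 hy)
        exact ⟨⟨q, Real.toNNReal_le_iff_le_coe.2 h2.le⟩, Real.lt_toNNReal_iff_coe_lt.2 h1⟩
      · rintro ⟨q, hq⟩
        exact hq.trans_le q.2
    have hdir : Directed (· ⊆ ·)
        fun q : {q : ℚ // (q : ℝ).toNNReal ≤ x} => Set.Iio ((q : ℚ) : ℝ).toNNReal := by
      intro p q
      rcases le_total p.1 q.1 with hpq | hpq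
      · exact ⟨q, Set.Iio_subset_Iio (Real.toNNReal_le_toNNReal (by exact_mod_cast hpq)), le_rfl⟩
      · exact ⟨p, le_rfl, Set.Iio_subset_Iio (Real.toNNReal_le_toNNReal (by exact_mod_cast hpq))⟩
    have : Nonempty {q : ℚ // (q : ℝ).toNNReal ≤ x} := ⟨⟨0, by simp⟩⟩
    rw [hu, hdir.measure_iUnion]
    have hmem : (⨆ q : {q : ℚ // (q : ℝ).toNNReal ≤ x},
        μ.toMeasure (Set.Iio ((q : ℚ) : ℝ).toNNReal)) ∈ Set.range ENat.toENNReal := by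
      refine hc.closure_subset_iff.2 ?_ (sSup_mem_closure (Set.range_nonempty _))
      rintro _ ⟨q, rfl⟩
      obtain ⟨k, hk⟩ := h q
      exact ⟨k, hk.symm⟩
    obtain ⟨k, hk⟩ := hmem
    exact ⟨k, hk.symm⟩
  have hfinpart : ∀ N : ℝ≥0, ∀ A, MeasurableSet A →
      ∃ k : ℕ∞, μ.toMeasure (A ∩ Set.Iio N) = k := by
    intro N A hA
    have hgen : (inferInstance : MeasurableSpace ℝ≥0) =
        MeasurableSpace.generateFrom (Set.range Set.Iio) := by
      rw [← borel_eq_generateFrom_Iio]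
      exact BorelSpace.measurable_eq
    induction A, hA using MeasurableSpace.induction_on_inter hgen with
    | h_inter => exact isPiSystem_Iio
    | empty => exact ⟨0, by simp⟩
    | basic t ht =>
      obtain ⟨x, rfl⟩ := ht
      rw [Set.Iio_inter_Iio]
      exact hIio _
    | compl t ht ih =>
      obtain ⟨k, hk⟩ := ih
      obtain ⟨l, hl⟩ := hIio N
      -- The mass of [0, N) is finite, which makes the mass of the complement a genuine difference.
      refine ⟨l - k, ?_⟩
      rw [ENat.toENNReal_sub, ← hk, ← hl]
      have hsum := measure_inter_add_sdiff (μ := μ.toMeasure) (Set.Iio N) ht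
      rw [Set.inter_comm (Set.Iio N) t] at hsum
      rw [← hsum, ENNReal.add_sub_cancel_left
        (measure_ne_top_of_subset Set.inter_subset_right (hfin N))]
      congr 1
      ext y
      simp [and_comm]
    | iUnion f hd hf ih =>
      rw [Set.iUnion_inter, measure_iUnion]
      · exact exists_enat_tsum _ ih
      · exact fun i j hij => (hd hij).mono Set.inter_subset_left Set.inter_subset_left
      · exact fun i => (hf i).inter measurableSet_Iio
  intro A hA
  have hu : A = ⋃ n : ℕ, A ∩ Set.Iio (n : ℝ≥0) := by
    ext y
    simp only [Set.mem_iUnion, Set.mem_inter_iff, Set.mem_Iio]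
    exact ⟨fun hy => (exists_nat_gt y).imp fun n hn => ⟨hy, hn⟩, fun ⟨n, hy, _⟩ => hy⟩
  have hmono : Monotone fun n : ℕ => A ∩ Set.Iio (n : ℝ≥0) := fun m n hmn =>
    Set.inter_subset_inter_right _ (Set.Iio_subset_Iio (by exact_mod_cast hmn))
  have hlim := tendsto_measure_iUnion_atTop (μ := μ.toMeasure) hmono
  rw [← hu] at hlim
  obtain ⟨k, hk⟩ := hc.mem_of_tendsto hlim (Eventually.of_forall fun n => by
    obtain ⟨k, hk⟩ := hfinpart n A hA
    exact ⟨k, hk.symm⟩)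
  exact ⟨k, hk.symm⟩

/-- The functions `plateau x k` increase to the indicator of [0, x) as k grows, so the mass is a
countable supremum of vaguely continuous maps. -/
lemma measurable_measure_Iio (x : ℝ≥0) :
    Measurable fun μ : LocFinMeasure => μ.toMeasure (Set.Iio x) := by
  have h : ∀ μ : LocFinMeasure, μ.toMeasure (Set.Iio x) =
      ⨆ k : ℕ, ENNReal.ofReal (μ.integral (plateau x k)) := by
    intro μ
    have h1 : ∀ k : ℕ, ENNReal.ofReal (μ.integral (plateau x k)) =
        ∫⁻ y, (plateau x k y : ℝ≥0∞) ∂μ.toMeasure := by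
      intro k
      rw [LocFinMeasure.integral, ofReal_integral_eq_lintegral_ofReal (μ.integrable_coe _)
        (ae_of_all _ fun _ => NNReal.coe_nonneg _)]
      simp
    simp_rw [h1]
    rw [← lintegral_iSup (fun k => by fun_prop), ← lintegral_indicator_one measurableSet_Iio]
    · congr 1
      ext1 y
      refine le_antisymm ?_ (iSup_le fun k => ?_)
      · by_cases hy : y < x
        · obtain ⟨k, hk⟩ := exists_nat_ge (x - y)⁻¹
          refine le_iSup_of_le k ?_
          have hpos : 0 < x - y := tsub_pos_of_lt hy
          rw [plateau_apply, min_eq_left]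
          · simp [hy]
          · calc (1 : ℝ≥0) = (x - y)⁻¹ * (x - y) := (inv_mul_cancel₀ hpos.ne').symm
              _ ≤ k * (x - y) := by gcongr
        · simp [hy]
      · by_cases hy : y < x
        · simp [hy, plateau_apply]
        · simp [hy, plateau_apply, tsub_eq_zero_of_le (not_lt.1 hy)]
    · intro k l hkl y
      simp only [plateau_apply, ENNReal.coe_le_coe]
      gcongr
  simp_rw [h]
  exact Measurable.iSup fun k => (LocFinMeasure.measurable_integral _).ennreal_ofReal

lemma ae_isPointMeasure_map {α : Type*} [MeasurableSpace α] {m : Measure α}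
    {f : α → LocFinMeasure} (hf : AEMeasurable f m)
    (h : ∀ᵐ a ∂m, (f a).IsPointMeasure) : ∀ᵐ μ ∂(m.map f), μ.IsPointMeasure := by
  have hS : MeasurableSet {μ : LocFinMeasure |
      ∀ q : ℚ, ∃ k : ℕ∞, μ.toMeasure (Set.Iio (q : ℝ).toNNReal) = k} := by
    simp only [Set.ofPred_forall]
    refine MeasurableSet.iInter fun q => ?_
    have : MeasurableSet (Set.range ENat.toENNReal) :=
      ENat.isClosedEmbedding_toENNReal.isClosed_range.measurableSet
    convert! measurable_measure_Iio (q : ℝ).toNNReal this using 1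
    ext μ
    simp [eq_comm]
  have h2 := (ae_map_iff hf hS).2 (h.mono fun a ha q => ha _ measurableSet_Iio)
  exact h2.mono fun μ hμ => isPointMeasure_of_Iio μ hμ

/-! ### Exponential variables -/

lemma integral_expMeasure {r : ℝ} (hr : 0 < r) (f : ℝ → ℝ) :
    ∫ x, f x ∂expMeasure r = ∫ x in Set.Ioi 0, r * Real.exp (-(r * x)) * f x := by
  have h1 : ∫ x, f x ∂expMeasure r = ∫ x, (exponentialPDF r x).toReal • f x :=
    integral_withDensity_eq_integral_toReal_smul
      (measurable_exponentialPDFReal r).ennreal_ofReal (ae_of_all _ fun _ => ENNReal.ofReal_lt_top) f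
  rw [h1, ← integral_Ici_eq_integral_Ioi, ← integral_indicator measurableSet_Ici]
  congr 1
  ext1 x
  by_cases hx : 0 ≤ x
  · rw [exponentialPDF_of_nonneg hx, ENNReal.toReal_ofReal (by positivity),
      Set.indicator_of_mem (Set.mem_Ici.2 hx), smul_eq_mul]
  · rw [exponentialPDF_of_neg (not_le.1 hx), Set.indicator_of_notMem (by simpa using hx)]
    simp

lemma ae_pos_expMeasure (r : ℝ) : ∀ᵐ x ∂expMeasure r, 0 < x := by
  have h : expMeasure r (Set.Iic 0) = 0 := by
    have : expMeasure r = volume.withDensity (exponentialPDF r) := rfl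
    rw [this, withDensity_apply _ measurableSet_Iic, ← setLIntegral_congr Iio_ae_eq_Iic]
    exact lintegral_exponentialPDF_of_nonpos le_rfl
  simpa using measure_eq_zero_iff_ae_notMem.1 h

lemma integral_exp_neg_mul_expMeasure {r a : ℝ} (hr : 0 < r) (ha : 0 ≤ a) :
    ∫ x, Real.exp (-(a * x)) ∂expMeasure r = r / (r + a) := by
  rw [integral_expMeasure hr]
  have h : ∀ x, r * Real.exp (-(r * x)) * Real.exp (-(a * x)) = r * Real.exp (-(r + a) * x) := by
    intro x
    rw [mul_assoc, ← Real.exp_add]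
    ring_nf
  simp_rw [h]
  rw [integral_const_mul, integral_exp_mul_Ioi (by linarith), mul_zero, Real.exp_zero,
    neg_div_neg_eq]
  field_simp

lemma integral_comp_of_indepFun {Ω α β : Type*} [MeasurableSpace Ω] [MeasurableSpace α]
    [MeasurableSpace β] {P : Measure Ω} [IsProbabilityMeasure P] {ν : Measure β}
    [IsProbabilityMeasure ν] {Z : Ω → α} {X : Ω → β} (hZ : AEMeasurable Z P) (hX : HasLaw X ν P)
    (h : IndepFun Z X P) {Φ : α × β → ℝ} (hΦ : Measurable Φ) {C : ℝ} (hC : ∀ p, |Φ p| ≤ C) :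
    ∫ ω, Φ (Z ω, X ω) ∂P = ∫ ω, ∫ u, Φ (Z ω, u) ∂ν ∂P := by
  have hlaw := (indepFun_iff_map_prod_eq_prod_map_map hZ hX.aemeasurable).1 h
  rw [hX.map_eq] at hlaw
  have := Measure.isProbabilityMeasure_map hZ
  have h1 : ∫ ω, Φ (Z ω, X ω) ∂P = ∫ p, Φ p ∂(P.map fun ω => (Z ω, X ω)) :=
    (integral_map (hZ.prodMk hX.aemeasurable) hΦ.aestronglyMeasurable).symm
  rw [h1, hlaw, integral_prod]
  · rw [integral_map hZ]
    exact (hΦ.stronglyMeasurable.integral_prod_right' (ν := ν)).aestronglyMeasurable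
  · exact Integrable.of_bound hΦ.aestronglyMeasurable C (ae_of_all _ hC)

/-! ### The Laplace functional of a Poisson process -/

/-- The transition operator of the arrival times of a Poisson process of rate `r`, with weight `q`
at the arrivals. -/
def arrivalStep (r : ℝ) (q v : ℝ → ℝ) (s : ℝ) : ℝ := ∫ u, q (s + u) * v (s + u) ∂expMeasure r

/-- Measurable functions with values in `[0, 1]`. -/
structure IsWeight (v : ℝ → ℝ) : Prop where
  measurable : Measurable v
  nonneg : ∀ x, 0 ≤ v x
  le_one : ∀ x, v x ≤ 1

lemma IsWeight.one : IsWeight fun _ => 1 := ⟨measurable_const, fun _ => zero_le_one, fun _ => le_rfl⟩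

lemma IsWeight.mul {q v : ℝ → ℝ} (hq : IsWeight q) (hv : IsWeight v) :
    IsWeight fun x => q x * v x :=
  ⟨hq.measurable.mul hv.measurable, fun x => mul_nonneg (hq.nonneg x) (hv.nonneg x),
    fun x => mul_le_one₀ (hq.le_one x) (hv.nonneg x) (hv.le_one x)⟩

lemma IsWeight.integrable {v : ℝ → ℝ} (hv : IsWeight v) {α : Type*} [MeasurableSpace α]
    {m : Measure α} [IsFiniteMeasure m] {X : α → ℝ} (hX : AEMeasurable X m) :
    Integrable (fun a => v (X a)) m :=
  Integrable.of_bound (hv.measurable.comp_aemeasurable hX).aestronglyMeasurable 1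
    (ae_of_all _ fun a => by rw [Real.norm_of_nonneg (hv.nonneg _)]; exact hv.le_one _)

lemma IsWeight.arrivalStep {r : ℝ} (hr : 0 < r) {q v : ℝ → ℝ} (hq : IsWeight q)
    (hv : IsWeight v) : IsWeight (arrivalStep r q v) := by
  have := isProbabilityMeasure_expMeasure hr
  have hqv := hq.mul hv
  refine ⟨?_, fun x => integral_nonneg fun u => hqv.nonneg _, fun x => ?_⟩
  · have h : Measurable fun p : ℝ × ℝ => q (p.1 + p.2) * v (p.1 + p.2) :=
      hqv.measurable.comp (measurable_fst.add measurable_snd)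
    exact (h.stronglyMeasurable.integral_prod_right' (ν := expMeasure r)).measurable
  · calc YuleBins.arrivalStep r q v x ≤ ∫ _, (1 : ℝ) ∂expMeasure r :=
        integral_mono (hqv.integrable (by fun_prop)) (integrable_const _) fun u => hqv.le_one _
      _ = 1 := by simp

lemma IsWeight.iterate {r : ℝ} (hr : 0 < r) {q v : ℝ → ℝ} (hq : IsWeight q)
    (hv : IsWeight v) (k : ℕ) : IsWeight ((YuleBins.arrivalStep r q)^[k] v) := by
  induction k with
  | zero => exact hv
  | succ k ih =>
    rw [Function.iterate_succ_apply']
    exact hq.arrivalStep hr ih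

/-- With S_k the partial sums, the mean of e^{-S_k} is c^k for c = r/(r + 1) < 1. Hence ∑ e^{-S_k}
has finite mean, and its terms tend to 0 almost surely. -/
lemma ae_tendsto_sum_atTop {Ω : Type*} [MeasurableSpace Ω] {P : Measure Ω} {r : ℝ} (hr : 0 < r) {X : ℕ → Ω → ℝ} (hXm : ∀ i, Measurable (X i))
    (hXi : iIndepFun X P) (hX : ∀ i, HasLaw (X i) (expMeasure r) P) :
    ∀ᵐ ω ∂P, Tendsto (fun k => ∑ i ∈ Finset.range k, X i ω) atTop atTop := by
  have := isProbabilityMeasure_expMeasure hr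
  set c : ℝ := r / (r + 1) with hc
  have hc0 : 0 ≤ c := by positivity
  have hc1 : c < 1 := by rw [hc, div_lt_one (by positivity)]; linarith
  have hmgf : ∀ k, ∫ ω, Real.exp (-∑ i ∈ Finset.range k, X i ω) ∂P = c ^ k := by
    intro k
    have h := hXi.mgf_sum (t := -1) hXm (Finset.range k)
    have h1 : ∀ i, mgf (X i) P (-1) = c := by
      intro i
      have := (hX i).integral_comp (f := fun x => Real.exp (-1 * x))
        (by fun_prop : Measurable fun x : ℝ => Real.exp (-1 * x)).aestronglyMeasurable
      rw [mgf, hc, ← integral_exp_neg_mul_expMeasure hr zero_le_one]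
      simpa [Function.comp_def] using this
    simp only [h1, Finset.prod_const, Finset.card_range] at h
    rw [← h, mgf]
    simp
  have hint : ∀ k, ∫⁻ ω, ENNReal.ofReal (Real.exp (-∑ i ∈ Finset.range k, X i ω)) ∂P =
      ENNReal.ofReal c ^ k := by
    intro k
    rw [← ENNReal.ofReal_pow hc0, ← hmgf k, ofReal_integral_eq_lintegral_ofReal]
    -- A non-integrable function would have integral 0 by convention, against c^k > 0.
    · by_contra hni
      have h0 := hmgf k
      rw [integral_undef hni] at h0
      exact (pow_pos (by positivity : 0 < c) k).ne h0
    · exact ae_of_all _ fun ω => (Real.exp_pos _).le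
  have hsum : ∫⁻ ω, ∑' k, ENNReal.ofReal (Real.exp (-∑ i ∈ Finset.range k, X i ω)) ∂P ≠ ∞ := by
    rw [lintegral_tsum fun k => by fun_prop]
    simp_rw [hint]
    rw [ENNReal.tsum_geometric]
    simpa [tsub_eq_zero_iff_le] using hc1
  filter_upwards [ae_lt_top' (by fun_prop) hsum] with ω hω
  have h1 := ENNReal.tendsto_atTop_zero_of_tsum_ne_top hω.ne
  have h2 : Tendsto (fun k => Real.exp (-∑ i ∈ Finset.range k, X i ω)) atTop (𝓝 0) := by
    have := (ENNReal.tendsto_toReal ENNReal.zero_ne_top).comp h1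
    simpa [Function.comp_def, ENNReal.toReal_ofReal (Real.exp_pos _).le] using this
  have h3 := (Real.tendsto_exp_comp_nhds_zero).1 h2
  simpa [Function.comp_def] using tendsto_neg_atBot_atTop.comp h3

section

variable {Ω : Type*} [MeasurableSpace Ω] {P : Measure Ω} [IsProbabilityMeasure P]

/-- This is the Markov property of the arrival times: averaging over the last gap, independent of
the earlier ones, replaces v by `arrivalStep r q v`. The induction therefore runs over all weights
v. -/
lemma integral_prod_arrival {r : ℝ} (hr : 0 < r) {X : ℕ → Ω → ℝ} (hXm : ∀ i, Measurable (X i))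
    (hXi : iIndepFun X P) (hX : ∀ i, HasLaw (X i) (expMeasure r) P) {q : ℝ → ℝ}
    (hq : IsWeight q) (k : ℕ) (v : ℝ → ℝ) (hv : IsWeight v) :
    ∫ ω, (∏ i ∈ Finset.range k, q (∑ j ∈ Finset.range (i + 1), X j ω)) *
      v (∑ j ∈ Finset.range k, X j ω) ∂P = (arrivalStep r q)^[k] v 0 := by
  have := isProbabilityMeasure_expMeasure hr
  induction k generalizing v with
  | zero => simp
  | succ k ih =>
    rw [Function.iterate_succ_apply, ← ih _ (hq.arrivalStep hr hv)]
    let Z : Ω → ℝ × ℝ := fun ω => (∏ i ∈ Finset.range k, q (∑ j ∈ Finset.range (i + 1), X j ω),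
      ∑ j ∈ Finset.range k, X j ω)
    have hqm := hq.measurable
    have hZ : Measurable Z := by fun_prop
    let ψ : (Finset.range k → ℝ) → ℝ × ℝ := fun x =>
      (∏ i : Finset.range k, q (∑ j with j.1 < i.1 + 1, x j), ∑ j, x j)
    have hψ : Measurable ψ := by fun_prop
    have hZψ : Z = ψ ∘ fun ω (i : Finset.range k) => X i ω := by
      ext1 ω
      simp only [Z, ψ, Function.comp_apply, Prod.mk.injEq]
      constructor
      · rw [← Finset.prod_coe_sort (Finset.range k)]
        refine Finset.prod_congr rfl fun i _ => ?_
        congr 1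
        rw [Finset.sum_filter,
          Finset.sum_coe_sort (Finset.range k) (fun j => if j < i.1 + 1 then X j ω else 0),
          ← Finset.sum_filter]
        congr 1
        ext j
        have := Finset.mem_range.1 i.2
        simp
        omega
      · exact (Finset.sum_coe_sort (Finset.range k) fun j => X j ω).symm
    have hind : IndepFun Z (X k) P := by
      have h := hXi.indepFun_finset (Finset.range k) {k} (by simp) hXm
      rw [hZψ]
      exact h.comp hψ (measurable_pi_apply (⟨k, by simp⟩ : ({k} : Finset ℕ)))
    -- truncation of the first coordinate makes the integrand bounded
    let Φ : (ℝ × ℝ) × ℝ → ℝ := fun p =>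
      max 0 (min 1 p.1.1) * (q (p.1.2 + p.2) * v (p.1.2 + p.2))
    have hvm := hv.measurable
    have hΦ : Measurable Φ := by fun_prop
    have hΦ1 : ∀ p, |Φ p| ≤ 1 := by
      intro p
      have h := hq.mul hv
      rw [abs_of_nonneg (mul_nonneg (le_max_left _ _) (h.nonneg _))]
      exact mul_le_one₀ (max_le zero_le_one (min_le_left _ _)) (h.nonneg _) (h.le_one _)
    have hkey := integral_comp_of_indepFun hZ.aemeasurable (hX k) hind hΦ hΦ1
    have hZ1 : ∀ ω, max 0 (min 1 (Z ω).1) = (Z ω).1 := by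
      intro ω
      rw [min_eq_right (Finset.prod_le_one (fun _ _ => hq.nonneg _) fun _ _ => hq.le_one _),
        max_eq_right (Finset.prod_nonneg fun _ _ => hq.nonneg _)]
    simp only [Φ, hZ1, integral_const_mul] at hkey
    refine Eq.trans (integral_congr_ae (ae_of_all _ fun ω => ?_)) hkey
    simp only [Finset.prod_range_succ, Z, Finset.sum_range_succ]
    ring

/-- The function l(s) = exp(-r ∫_s^S (1 - q)) satisfies l' = r (1 - q) l. Consequently -e^{-ru} l(s
+ u) is a primitive in u of the integrand r e^{-ru} q(s + u) l(s + u); it tends to 0 at infinity and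
equals -l(s) at 0. -/
lemma arrivalStep_fixed {r : ℝ} (hr : 0 < r) {q : ℝ → ℝ} (hqc : Continuous q) (hq : IsWeight q)
    {S : ℝ} (hS : ∀ x, S ≤ x → q x = 1) (s : ℝ) :
    arrivalStep r q (fun s => Real.exp (-(r * ∫ t in s..S, (1 - q t)))) s =
      Real.exp (-(r * ∫ t in s..S, (1 - q t))) := by
  set l : ℝ → ℝ := fun s => Real.exp (-(r * ∫ t in s..S, (1 - q t))) with hl
  have hder : ∀ x, HasDerivAt l (r * (1 - q x) * l x) x := by
    intro x
    have h1 := intervalIntegral.integral_hasDerivAt_left (f := fun t => 1 - q t) (a := x) (b := S)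
      (Continuous.intervalIntegrable (by fun_prop) _ _)
      ((by fun_prop : Continuous fun t => 1 - q t).stronglyMeasurableAtFilter _ _) (by fun_prop)
    have h2 := (h1.const_mul r).neg.exp
    have h3 : HasDerivAt l (l x * -(r * -(1 - q x))) x := h2
    convert h3 using 1
    ring
  have hlS : ∀ x, S ≤ x → l x = 1 := by
    intro x hx
    have : ∫ t in x..S, (1 - q t) = 0 := by
      rw [intervalIntegral.integral_symm, intervalIntegral.integral_congr (g := fun _ => 0)]
      · simp
      · intro t ht
        rw [Set.uIcc_of_le hx] at ht
        simp [hS t ht.1]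
    simp [hl, this]
  rw [arrivalStep, integral_expMeasure hr]
  have h := integral_Ioi_of_hasDerivAt_of_nonneg' (a := 0) (l := 0)
    (g := fun u => -(Real.exp (-(r * u)) * l (s + u)))
    (g' := fun u => r * Real.exp (-(r * u)) * (q (s + u) * l (s + u)))
    (fun u _ => by
      have h1 : HasDerivAt (fun u => Real.exp (-(r * u))) (Real.exp (-(r * u)) * (-r)) u := by
        simpa using ((hasDerivAt_id u).const_mul r).neg.exp
      have h2 : HasDerivAt (fun u => l (s + u)) (r * (1 - q (s + u)) * l (s + u)) u :=
        (hder (s + u)).comp_const_add s u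
      exact (h1.mul h2).neg.congr_deriv (by ring))
    (fun u _ => mul_nonneg (by positivity) (mul_nonneg (hq.nonneg _) (Real.exp_pos _).le))
    (by
      have h1 : Tendsto (fun u : ℝ => -Real.exp (-(r * u))) atTop (𝓝 0) := by
        have := Real.tendsto_exp_atBot.comp
          (tendsto_neg_atTop_atBot.comp (tendsto_id.const_mul_atTop hr))
        simpa using this.neg
      refine h1.congr' ?_
      filter_upwards [eventually_ge_atTop (S - s)] with u hu
      rw [hlS (s + u) (by linarith), mul_one])
  rw [h]
  simp [hl]

/-- The iterates of 1 and the fixed point l all equal 1 beyond S, so a gap longer than S erases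
their difference. On [0, ∞) each step therefore contracts it by the probability θ < 1 that a gap is
at most S. -/
lemma tendsto_iterate_arrivalStep {r : ℝ} (hr : 0 < r) {q : ℝ → ℝ} (hqc : Continuous q)
    (hq : IsWeight q) {S : ℝ} (hS0 : 0 ≤ S) (hS : ∀ x, S ≤ x → q x = 1) :
    Tendsto (fun k => (arrivalStep r q)^[k] (fun _ => 1) 0) atTop
      (𝓝 (Real.exp (-(r * ∫ t in (0 : ℝ)..S, (1 - q t))))) := by
  have := isProbabilityMeasure_expMeasure hr
  set l : ℝ → ℝ := fun s => Real.exp (-(r * ∫ t in s..S, (1 - q t))) with hl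
  have hlS : ∀ x, S ≤ x → l x = 1 := by
    intro x hx
    have : ∫ t in x..S, (1 - q t) = 0 := by
      rw [intervalIntegral.integral_symm, intervalIntegral.integral_congr (g := fun _ => 0)]
      · simp
      · intro t ht
        rw [Set.uIcc_of_le hx] at ht
        simp [hS t ht.1]
    simp [hl, this]
  have hlw : IsWeight l := by
    have hcont : Continuous l := by
      have : Continuous fun s => ∫ t in s..S, (1 - q t) := by
        have h := intervalIntegral.continuous_primitive (f := fun t => 1 - q t) (μ := volume)
          (fun a b => Continuous.intervalIntegrable (by fun_prop) _ _) S
        exact h.neg.congr fun s => (intervalIntegral.integral_symm S s).symm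
      fun_prop
    refine ⟨hcont.measurable, fun x => (Real.exp_pos _).le, fun x => ?_⟩
    rcases le_total S x with hx | hx
    · exact (hlS x hx).le
    · rw [hl, Real.exp_le_one_iff, neg_nonpos]
      exact mul_nonneg hr.le (intervalIntegral.integral_nonneg hx fun t _ =>
        sub_nonneg.2 (hq.le_one t))
  set θ : ℝ := (expMeasure r).real (Set.Iic S) with hθ
  have hθ1 : θ < 1 := by
    have h := cdf_expMeasure_eq hr S
    rw [cdf_eq_real, if_pos hS0] at h
    rw [hθ, h]
    linarith [Real.exp_pos (-(r * S))]
  have hθ0 : 0 ≤ θ := measureReal_nonneg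
  have hvS : ∀ k, ∀ s, S ≤ s → (arrivalStep r q)^[k] (fun _ => 1) s = 1 := by
    intro k
    induction k with
    | zero => intro s _; rfl
    | succ k ih =>
      intro s hs
      rw [Function.iterate_succ_apply', arrivalStep]
      rw [integral_congr_ae (g := fun _ => (1 : ℝ))]
      · simp
      · filter_upwards [ae_pos_expMeasure r] with u hu
        rw [ih _ (by linarith), hS _ (by linarith), one_mul]
  have hd : ∀ k, ∀ s, 0 ≤ s → |(arrivalStep r q)^[k] (fun _ => 1) s - l s| ≤ θ ^ k := by
    intro k
    induction k with
    | zero =>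
      intro s _
      have h1 := hlw.nonneg s
      have h2 := hlw.le_one s
      simp only [Function.iterate_zero, id, pow_zero]
      exact abs_le.2 ⟨by linarith, by linarith⟩
    | succ k ih =>
      intro s hs
      have hvw := hq.iterate hr IsWeight.one k
      have hls : l s = arrivalStep r q l s := (arrivalStep_fixed hr hqc hq hS s).symm
      rw [Function.iterate_succ_apply', hls]
      simp only [arrivalStep]
      rw [← integral_sub ((hq.mul hvw).integrable (X := fun u => s + u) (by fun_prop))
        ((hq.mul hlw).integrable (X := fun u => s + u) (by fun_prop))]
      have hb : ∀ᵐ u ∂expMeasure r, ‖q (s + u) * (arrivalStep r q)^[k] (fun _ => 1) (s + u) -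
          q (s + u) * l (s + u)‖ ≤ (Set.Iic S).indicator (fun _ => θ ^ k) u := by
        filter_upwards [ae_pos_expMeasure r] with u hu
        rw [← mul_sub, norm_mul]
        by_cases huS : u ≤ S
        · rw [Set.indicator_of_mem (Set.mem_Iic.2 huS), Real.norm_of_nonneg (hq.nonneg _)]
          exact (mul_le_of_le_one_left (norm_nonneg _) (hq.le_one _)).trans (ih _ (by linarith))
        · rw [Set.indicator_of_notMem (by simpa using huS), hvS k _ (by linarith),
            hlS _ (by linarith)]
          simp
      refine (norm_integral_le_of_norm_le
        ((integrable_const _).indicator measurableSet_Iic) hb).trans_eq ?_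
      rw [integral_indicator_const _ measurableSet_Iic, smul_eq_mul, pow_succ, mul_comm]
  have h0 : Tendsto (fun k => (arrivalStep r q)^[k] (fun _ => 1) 0 - l 0) atTop (𝓝 0) :=
    squeeze_zero_norm (fun k => hd k 0 le_rfl) (tendsto_pow_atTop_nhds_zero_of_lt_one hθ0 hθ1)
  simpa using h0.add_const (l 0)

/-- The Laplace functional of a homogeneous Poisson process. -/
theorem integral_exp_neg_tsum_arrival {r : ℝ} (hr : 0 < r) {X : ℕ → Ω → ℝ}
    (hXm : ∀ i, Measurable (X i)) (hXi : iIndepFun X P)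
    (hX : ∀ i, HasLaw (X i) (expMeasure r) P) {f : ℝ → ℝ} (hf : Continuous f)
    (hf0 : ∀ x, 0 ≤ f x) {S : ℝ} (hS0 : 0 ≤ S) (hS : ∀ x, S ≤ x → f x = 0) :
    ∫ ω, Real.exp (-∑' i, f (∑ j ∈ Finset.range (i + 1), X j ω)) ∂P =
      Real.exp (-(r * ∫ t in (0 : ℝ)..S, (1 - Real.exp (-f t)))) := by
  set q : ℝ → ℝ := fun x => Real.exp (-f x) with hq
  have hqc : Continuous q := by fun_prop
  have hqw : IsWeight q := ⟨hqc.measurable, fun _ => (Real.exp_pos _).le,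
    fun x => Real.exp_le_one_iff.2 (neg_nonpos.2 (hf0 x))⟩
  have h1 := tendsto_iterate_arrivalStep hr hqc hqw hS0 fun x hx => by simp [hq, hS x hx]
  simp_rw [← integral_prod_arrival hr hXm hXi hX hqw _ _ IsWeight.one] at h1
  refine tendsto_nhds_unique ?_ h1
  have hqm := hqw.measurable
  refine tendsto_integral_of_dominated_convergence (fun _ => 1)
    (fun k => (by fun_prop : Measurable _).aestronglyMeasurable) (integrable_const _)
    (fun k => ae_of_all _ fun ω => ?_) ?_
  · rw [mul_one, Real.norm_of_nonneg (Finset.prod_nonneg fun _ _ => hqw.nonneg _)]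
    exact Finset.prod_le_one (fun _ _ => hqw.nonneg _) fun _ _ => hqw.le_one _
  · filter_upwards [ae_tendsto_sum_atTop hr hXm hXi hX] with ω hω
    obtain ⟨N, hN⟩ := eventually_atTop.1 (hω.eventually_ge_atTop S)
    have hsum : HasSum (fun i => f (∑ j ∈ Finset.range (i + 1), X j ω))
        (∑ i ∈ Finset.range N, f (∑ j ∈ Finset.range (i + 1), X j ω)) :=
      hasSum_sum_of_ne_finset_zero fun i hi => hS _ (hN _ (by
        have : N ≤ i := by simpa using hi
        omega))
    have h2 := hsum.tendsto_sum_nat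
    rw [← hsum.tsum_eq] at h2
    have h3 := (Real.continuous_exp.tendsto _).comp h2.neg
    refine h3.congr fun k => ?_
    simp [hq, ← Real.exp_sum]

end

/-! ### The limit point process -/

lemma toLocFin_toMeasure {μ : Measure ℝ≥0} (h : IsLocallyFiniteMeasure μ) :
    (toLocFin μ).toMeasure = μ := by
  exact congrArg LocFinMeasure.toMeasure (dif_pos h)

lemma integral_toLocFin_sum_dirac {ι : Type*} [Countable ι] (x : ι → ℝ≥0)
    (h : IsLocallyFiniteMeasure (Measure.sum fun i => Measure.dirac (x i)))
    (g : C_c(ℝ≥0, ℝ≥0)) :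
    (toLocFin (Measure.sum fun i => Measure.dirac (x i))).integral g = ∑' i, (g (x i) : ℝ) := by
  have hint := (toLocFin (Measure.sum fun i => Measure.dirac (x i))).integrable_coe g
  rw [LocFinMeasure.integral]
  rw [toLocFin_toMeasure h] at hint ⊢
  rw [integral_sum_measure hint]
  simp

lemma isPointMeasure_toLocFin_sum_dirac {ι : Type*} (x : ι → ℝ≥0) :
    (toLocFin (Measure.sum fun i => Measure.dirac (x i))).IsPointMeasure := by
  intro A hA
  by_cases h : IsLocallyFiniteMeasure (Measure.sum fun i => Measure.dirac (x i))
  · rw [toLocFin_toMeasure h]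
    exact exists_enat_sum_dirac x hA
  · have h0 : (toLocFin (Measure.sum fun i => Measure.dirac (x i))).toMeasure = 0 :=
      congrArg LocFinMeasure.toMeasure (dif_neg h)
    exact ⟨0, by simp [h0]⟩

lemma exists_forall_ge_eq_zero (g : C_c(ℝ≥0, ℝ≥0)) :
    ∃ A : ℝ≥0, 0 < A ∧ ∀ x, A ≤ x → g x = 0 := by
  obtain ⟨b, hb⟩ := g.hasCompactSupport.isCompact.bddAbove
  refine ⟨b + 1, by positivity, fun x hx => ?_⟩
  by_contra h
  exact absurd (hb (subset_tsupport _ h)) (not_le.2 ((lt_add_one b).trans_le hx))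

lemma isLocallyFiniteMeasure_scaledPoints {ρ : ℝ} (hρ : 0 < ρ) {w : ℝ} (hw : 0 < w) {s : ℕ → ℝ}
    (hs : Tendsto s atTop atTop) : IsLocallyFiniteMeasure (scaledPoints ρ w s) := by
  refine ⟨fun x => ⟨Set.Iio (x + 1), Iio_mem_nhds (by simp), ?_⟩⟩
  have hc : 0 < w ^ (ρ / (ρ + 2)) := Real.rpow_pos_of_pos hw _
  have ht : Tendsto (fun i => w ^ (ρ / (ρ + 2)) * s i ^ (1 / (ρ + 2))) atTop atTop :=
    ((tendsto_rpow_atTop (by positivity)).comp hs).const_mul_atTop hc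
  obtain ⟨N, hN⟩ := eventually_atTop.1 (ht.eventually_ge_atTop ((x : ℝ) + 1))
  rw [scaledPoints, Measure.sum_apply _ measurableSet_Iio, tsum_eq_sum (s := Finset.range N)]
  · exact ENNReal.sum_lt_top.2 fun i _ => measure_lt_top _ _
  · intro i hi
    have hi' : N ≤ i := by simpa using hi
    rw [Measure.dirac_apply' _ measurableSet_Iio]
    refine Set.indicator_of_notMem ?_ _
    rw [Set.mem_Iio, not_lt]
    exact NNReal.le_toNNReal_of_coe_le (by simpa using hN i hi')

/-- The limit point process as a function of `w` and of the gaps of the Poisson process. -/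
def limitProcess (ρ : ℝ) (p : ℝ × (ℕ → ℝ)) : LocFinMeasure :=
  toLocFin (scaledPoints ρ p.1 fun i => ∑ j ∈ Finset.range (i + 1), p.2 j)

/-- The law of i.i.d. exponential variables. -/
def expSeqMeasure (r : ℝ) : Measure (ℕ → ℝ) := Measure.infinitePi fun _ => expMeasure r

lemma isProbabilityMeasure_expSeqMeasure {r : ℝ} (hr : 0 < r) :
    IsProbabilityMeasure (expSeqMeasure r) := by
  have := isProbabilityMeasure_expMeasure hr
  rw [expSeqMeasure]
  infer_instance

lemma iIndepFun_expSeqMeasure {r : ℝ} (hr : 0 < r) :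
    iIndepFun (fun (i : ℕ) (γ : ℕ → ℝ) => γ i) (expSeqMeasure r) := by
  have := isProbabilityMeasure_expMeasure hr
  exact iIndepFun_infinitePi (X := fun _ x => x) fun _ => measurable_id

lemma hasLaw_expSeqMeasure {r : ℝ} (hr : 0 < r) (i : ℕ) :
    HasLaw (fun γ : ℕ → ℝ => γ i) (expMeasure r) (expSeqMeasure r) := by
  have := isProbabilityMeasure_expMeasure hr
  exact (measurePreserving_eval_infinitePi (fun _ : ℕ => expMeasure r) i).hasLaw

lemma ae_tendsto_expSeqMeasure {r : ℝ} (hr : 0 < r) :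
    ∀ᵐ γ ∂expSeqMeasure r,
      Tendsto (fun i => ∑ j ∈ Finset.range (i + 1), (γ : ℕ → ℝ) j) atTop atTop := by
  filter_upwards [ae_tendsto_sum_atTop hr (fun i => measurable_pi_apply i)
    (iIndepFun_expSeqMeasure hr) (hasLaw_expSeqMeasure hr)] with γ hγ
  exact hγ.comp (tendsto_add_atTop_nat 1)

lemma integral_limitProcess {ρ : ℝ} (hρ : 0 < ρ) {p : ℝ × (ℕ → ℝ)} (hw : 0 < p.1)
    (hs : Tendsto (fun i => ∑ j ∈ Finset.range (i + 1), p.2 j) atTop atTop)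
    (g : C_c(ℝ≥0, ℝ≥0)) :
    (limitProcess ρ p).integral g = ∑' i, (g (Real.toNNReal (p.1 ^ (ρ / (ρ + 2)) *
      (∑ j ∈ Finset.range (i + 1), p.2 j) ^ (1 / (ρ + 2)))) : ℝ) :=
  integral_toLocFin_sum_dirac _ (isLocallyFiniteMeasure_scaledPoints hρ hw hs) g

lemma ae_good_prod {r : ℝ} (hr : 0 < r) {L : Measure ℝ} [IsProbabilityMeasure L]
    (hL : ∀ᵐ w ∂L, 0 < w) :
    ∀ᵐ p ∂(L.prod (expSeqMeasure r)), 0 < p.1 ∧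
      Tendsto (fun i => ∑ j ∈ Finset.range (i + 1), p.2 j) atTop atTop := by
  have := isProbabilityMeasure_expSeqMeasure hr
  exact (Measure.quasiMeasurePreserving_fst.ae hL).and
    (Measure.quasiMeasurePreserving_snd.ae (ae_tendsto_expSeqMeasure hr))

lemma aemeasurable_limitProcess {ρ r : ℝ} (hρ : 0 < ρ) (hr : 0 < r) {L : Measure ℝ}
    [IsProbabilityMeasure L] (hL : ∀ᵐ w ∂L, 0 < w) :
    AEMeasurable (limitProcess ρ) (L.prod (expSeqMeasure r)) := by
  refine aemeasurable_of_integral fun g => ?_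
  -- When the points do not tend to infinity, `toLocFin` may take its default value, so this series
  -- represents the integral only almost everywhere.
  refine ⟨fun p => ((∑' i, g (Real.toNNReal (p.1 ^ (ρ / (ρ + 2)) *
      (∑ j ∈ Finset.range (i + 1), p.2 j) ^ (1 / (ρ + 2)))) : ℝ≥0) : ℝ), ?_, ?_⟩
  · have hg : Measurable g := (map_continuous g).measurable
    exact (Measurable.tsum fun i => by fun_prop).coe_nnreal_real
  · filter_upwards [ae_good_prod hr hL] with p hp
    rw [integral_limitProcess hρ hp.1 hp.2, NNReal.coe_tsum]

/-- Substitute t = x^{ρ+2}, then rescale by c = w^{ρ/(ρ+2)}, for which c^{-(ρ+2)} = w^{-ρ}. The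
factor ρ + 2 cancels against the rate 1/(ρ(ρ+2)) of the Poisson process, which leaves the intensity
w^{-ρ} x^{ρ+1}/ρ. -/
lemma integral_rpow_change_var {ρ w : ℝ} (hρ : 0 < ρ) (hw : 0 < w) (F : ℝ → ℝ) :
    ∫ t in Set.Ioi (0 : ℝ), F (w ^ (ρ / (ρ + 2)) * t ^ (1 / (ρ + 2))) =
      (ρ + 2) * w ^ (-ρ) * ∫ x in Set.Ioi (0 : ℝ), F x * x ^ (ρ + 1) := by
  have hp : 0 < ρ + 2 := by linarith
  set c := w ^ (ρ / (ρ + 2)) with hc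
  have hc0 : 0 < c := Real.rpow_pos_of_pos hw _
  rw [← integral_comp_rpow_Ioi_of_pos (g := fun t => F (c * t ^ (1 / (ρ + 2)))) hp]
  have h1 : ∀ x ∈ Set.Ioi (0 : ℝ), ((ρ + 2) * x ^ (ρ + 2 - 1)) •
      F (c * (x ^ (ρ + 2)) ^ (1 / (ρ + 2))) =
      ((ρ + 2) * c ^ (-(ρ + 1))) * (F (c * x) * (c * x) ^ (ρ + 1)) := by
    intro x hx
    rw [Set.mem_Ioi] at hx
    rw [← Real.rpow_mul hx.le, mul_one_div_cancel hp.ne', Real.rpow_one, smul_eq_mul,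
      Real.mul_rpow hc0.le hx.le, Real.rpow_neg hc0.le, show ρ + 2 - 1 = ρ + 1 by ring]
    have := (Real.rpow_pos_of_pos hc0 (ρ + 1)).ne'
    field_simp
  rw [setIntegral_congr_fun measurableSet_Ioi h1, integral_const_mul,
    integral_comp_mul_left_Ioi (fun y => F y * y ^ (ρ + 1)) 0 hc0, mul_zero, smul_eq_mul,
    ← mul_assoc, mul_assoc (ρ + 2), ← Real.rpow_neg_one, ← Real.rpow_add hc0, hc,
    ← Real.rpow_mul hw.le]
  congr 3
  field_simp
  ring

lemma integral_laplace_expSeqMeasure {ρ w : ℝ} (hρ : 0 < ρ) (hw : 0 < w) (g : C_c(ℝ≥0, ℝ≥0)) :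
    ∫ γ, Real.exp (-(limitProcess ρ (w, γ)).integral g) ∂expSeqMeasure (1 / (ρ * (ρ + 2))) =
      Real.exp (-(w ^ (-ρ) / ρ) * ∫ x in Set.Ici (0 : ℝ),
        (1 - Real.exp (-(g x.toNNReal : ℝ))) * x ^ (ρ + 1)) := by
  have hr : 0 < 1 / (ρ * (ρ + 2)) := by positivity
  have := isProbabilityMeasure_expSeqMeasure hr
  set f : ℝ → ℝ := fun t => g (Real.toNNReal (w ^ (ρ / (ρ + 2)) * t ^ (1 / (ρ + 2)))) with hf
  have hb : 0 < 1 / (ρ + 2) := by positivity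
  have hfc : Continuous f := by
    have : Continuous fun t : ℝ => t ^ (1 / (ρ + 2)) := Real.continuous_rpow_const hb.le
    fun_prop
  have hc : 0 < w ^ (ρ / (ρ + 2)) := Real.rpow_pos_of_pos hw _
  obtain ⟨A, hA0, hA⟩ := exists_forall_ge_eq_zero g
  have ht : Tendsto (fun t => w ^ (ρ / (ρ + 2)) * t ^ (1 / (ρ + 2))) atTop atTop :=
    (tendsto_rpow_atTop hb).const_mul_atTop hc
  obtain ⟨S, hS0, hS⟩ : ∃ S, 0 ≤ S ∧ ∀ t, S ≤ t → f t = 0 := by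
    obtain ⟨S, hS⟩ := eventually_atTop.1 (ht.eventually_ge_atTop (A : ℝ))
    refine ⟨max S 0, le_max_right _ _, fun t h => ?_⟩
    simp only [hf]
    rw [hA _ (NNReal.le_toNNReal_of_coe_le (hS t ((le_max_left _ _).trans h)))]
    rfl
  have h1 := integral_exp_neg_tsum_arrival hr (fun i => measurable_pi_apply i)
    (iIndepFun_expSeqMeasure hr) (hasLaw_expSeqMeasure hr) hfc (fun _ => NNReal.coe_nonneg _)
    hS0 hS
  have h2 : ∫ γ, Real.exp (-(limitProcess ρ (w, γ)).integral g)
      ∂expSeqMeasure (1 / (ρ * (ρ + 2))) =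
      ∫ γ, Real.exp (-∑' i, f (∑ j ∈ Finset.range (i + 1), (γ : ℕ → ℝ) j))
        ∂expSeqMeasure (1 / (ρ * (ρ + 2))) := by
    refine integral_congr_ae ?_
    filter_upwards [ae_tendsto_expSeqMeasure hr] with γ hγ
    rw [integral_limitProcess hρ (p := (w, γ)) hw hγ]
  rw [h2, h1]
  have h3 : ∫ t in (0 : ℝ)..S, (1 - Real.exp (-f t)) =
      ∫ t in Set.Ioi (0 : ℝ), (1 - Real.exp (-f t)) := by
    rw [intervalIntegral.integral_of_le hS0]
    refine (setIntegral_eq_of_subset_of_forall_sdiff_eq_zero measurableSet_Ioi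
      Set.Ioc_subset_Ioi_self fun t ht => by
    have : S ≤ t := by
      by_contra h
      exact ht.2 ⟨ht.1, (not_le.1 h).le⟩
    simp [hS t this]).symm
  rw [h3, integral_Ici_eq_integral_Ioi]
  have h4 := integral_rpow_change_var hρ hw fun x => 1 - Real.exp (-(g x.toNNReal : ℝ))
  simp only [hf]
  rw [h4]
  congr 1
  field_simp

/-- The law of the limit point process, when `w` has law `L`. -/
def limitLaw (ρ : ℝ) (L : Measure ℝ) : Measure LocFinMeasure :=
  (L.prod (expSeqMeasure (1 / (ρ * (ρ + 2))))).map (limitProcess ρ)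

lemma isProbabilityMeasure_limitLaw {ρ : ℝ} (hρ : 0 < ρ) {L : Measure ℝ} [IsProbabilityMeasure L]
    (hL : ∀ᵐ w ∂L, 0 < w) :
    IsProbabilityMeasure (limitLaw ρ L) := by
  have hr : 0 < 1 / (ρ * (ρ + 2)) := by positivity
  have := isProbabilityMeasure_expSeqMeasure hr
  exact Measure.isProbabilityMeasure_map (aemeasurable_limitProcess hρ hr hL)

lemma ae_isPointMeasure_limitLaw {ρ : ℝ} (hρ : 0 < ρ) {L : Measure ℝ} [IsProbabilityMeasure L]
    (hL : ∀ᵐ w ∂L, 0 < w) :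
    ∀ᵐ μ ∂limitLaw ρ L, μ.IsPointMeasure :=
  ae_isPointMeasure_map (aemeasurable_limitProcess hρ (by positivity) hL)
    (ae_of_all _ fun _ => isPointMeasure_toLocFin_sum_dirac _)

lemma integral_laplace_limitLaw {ρ : ℝ} (hρ : 0 < ρ) {L : Measure ℝ} [IsProbabilityMeasure L]
    (hL : ∀ᵐ w ∂L, 0 < w) (g : C_c(ℝ≥0, ℝ≥0)) :
    ∫ μ, Real.exp (-μ.integral g) ∂limitLaw ρ L =
      ∫ w, Real.exp (-(w ^ (-ρ) / ρ) * ∫ x in Set.Ici (0 : ℝ),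
        (1 - Real.exp (-(g x.toNNReal : ℝ))) * x ^ (ρ + 1)) ∂L := by
  have hr : 0 < 1 / (ρ * (ρ + 2)) := by positivity
  have := isProbabilityMeasure_expSeqMeasure hr
  have hm := aemeasurable_limitProcess hρ hr hL
  have hg : Measurable fun μ : LocFinMeasure => Real.exp (-μ.integral g) :=
    (LocFinMeasure.measurable_integral g).neg.exp
  rw [limitLaw, integral_map hm hg.aestronglyMeasurable, integral_prod]
  · refine integral_congr_ae ?_
    filter_upwards [hL] with w hw
    exact integral_laplace_expSeqMeasure hρ hw g
  · refine Integrable.of_bound (hg.comp_aemeasurable hm).aestronglyMeasurable 1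
      (ae_of_all _ fun p => ?_)
    rw [Real.norm_of_nonneg (Real.exp_pos _).le, Real.exp_le_one_iff, neg_nonpos]
    exact LocFinMeasure.integral_nonneg _ _

/-- The gaps are a measurable function of the points, hence independent of W, and their partial sums
give the points back. So (W, gaps) has the product law from which `limitLaw` is built. -/
lemma hasLaw_scaledPoints {ρ : ℝ} (hρ : 0 < ρ) {L : Measure ℝ} [IsProbabilityMeasure L]
    (hL : ∀ᵐ w ∂L, 0 < w)
    {Ω' : Type*} [MeasurableSpace Ω'] {P' : Measure Ω'}
    [IsProbabilityMeasure P'] {W : Ω' → ℝ} {τ : ℕ → Ω' → ℝ} (hW : HasLaw W L P')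
    (hτ : IsPoissonPoints (1 / (ρ * (ρ + 2))) τ P')
    (hind : IndepFun W (fun ω' i => τ i ω') P') :
    (∀ᵐ ω' ∂P', IsLocallyFiniteMeasure (scaledPoints ρ (W ω') fun i => τ i ω')) ∧
      HasLaw (fun ω' => toLocFin (scaledPoints ρ (W ω') fun i => τ i ω')) (limitLaw ρ L) P' := by
  have hr : 0 < 1 / (ρ * (ρ + 2)) := by positivity
  have := isProbabilityMeasure_expSeqMeasure hr
  let φ : (ℕ → ℝ) → ℕ → ℝ := fun x i => Nat.casesOn i (x 0) fun k => x (k + 1) - x k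
  have hφ : Measurable φ := by
    refine measurable_pi_iff.2 fun i => ?_
    cases i with
    | zero => exact measurable_pi_apply 0
    | succ k => exact (measurable_pi_apply (k + 1)).sub (measurable_pi_apply k)
  have hgap : (fun ω' i => gap τ i ω') = φ ∘ fun ω' i => τ i ω' := by
    ext ω' i
    cases i <;> rfl
  have hsum : ∀ ω' i, ∑ j ∈ Finset.range (i + 1), gap τ j ω' = τ i ω' := by
    intro ω' i
    induction i with
    | zero => simp [gap]
    | succ i ih =>
      rw [Finset.sum_range_succ, ih]
      simp [gap]
  have hgm : Measurable fun ω' i => gap τ i ω' := by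
    rw [hgap]
    exact hφ.comp (measurable_pi_iff.2 hτ.measurable)
  have hglaw : HasLaw (fun ω' i => gap τ i ω') (expSeqMeasure (1 / (ρ * (ρ + 2)))) P' :=
    hτ.indep.hasLaw_infinitePi hτ.law hgm.aemeasurable
  have hgind : IndepFun W (fun ω' i => gap τ i ω') P' := by
    rw [hgap]
    exact hind.comp measurable_id hφ
  have hpair := (indepFun_iff_hasLaw_prodMk_prod hW hglaw).1 hgind
  have heq : ∀ ω', limitProcess ρ (W ω', fun i => gap τ i ω') =
      toLocFin (scaledPoints ρ (W ω') fun i => τ i ω') := by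
    intro ω'
    simp only [limitProcess, hsum]
  constructor
  · have h := ae_good_prod hr hL
    rw [← hpair.map_eq] at h
    filter_upwards [ae_of_ae_map hpair.aemeasurable h] with ω' hω'
    simp only [hsum] at hω'
    exact isLocallyFiniteMeasure_scaledPoints hρ hω'.1 hω'.2
  · have hl : HasLaw (limitProcess ρ) (limitLaw ρ L)
        (L.prod (expSeqMeasure (1 / (ρ * (ρ + 2))))) :=
      ⟨aemeasurable_limitProcess hρ hr hL, rfl⟩
    have := hl.comp hpair
    simpa only [Function.comp_def, heq] using this

/-! ### Almost sure convergence of `t_n - log n` -/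

lemma integral_id_expMeasure_one : ∫ x, x ∂expMeasure 1 = 1 := by
  have h := Real.Gamma_eq_integral (s := 2) (by norm_num)
  rw [Real.Gamma_two] at h
  rw [integral_expMeasure one_pos]
  refine Eq.trans ?_ h.symm
  refine setIntegral_congr_fun measurableSet_Ioi fun x _ => ?_
  norm_num

/-- Otherwise the integral would be 0 by convention, whereas it equals Γ(3) = 2. -/
lemma integrable_sq_expMeasure_one : Integrable (fun x : ℝ => x ^ 2) (expMeasure 1) := by
  by_contra hni
  have h0 := integral_undef hni
  have h := Real.Gamma_eq_integral (s := 3) (by norm_num)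
  have h3 : Real.Gamma 3 = 2 := by
    rw [show (3 : ℝ) = ((2 : ℕ) : ℝ) + 1 by norm_num, Real.Gamma_nat_eq_factorial]
    norm_num [Nat.factorial]
  rw [integral_expMeasure one_pos] at h0
  have : ∫ x in Set.Ioi (0 : ℝ), 1 * Real.exp (-(1 * x)) * x ^ 2 =
      ∫ x in Set.Ioi (0 : ℝ), Real.exp (-x) * x ^ ((3 : ℝ) - 1) := by
    refine setIntegral_congr_fun measurableSet_Ioi fun x _ => ?_
    norm_num
  rw [this, ← h, h3] at h0
  norm_num at h0

lemma memLp_two_expMeasure_one : MemLp (fun x : ℝ => x) 2 (expMeasure 1) :=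
  (memLp_two_iff_integrable_sq aestronglyMeasurable_id).2 integrable_sq_expMeasure_one

section

variable {Ω : Type*} [MeasurableSpace Ω] {P : Measure Ω} [IsProbabilityMeasure P]

/-- With H_n the harmonic numbers, t_n - H_n = ∑ (E_i - 1)/i is a martingale bounded in L², because
∑ 1/i² converges. It converges almost surely, and H_n - log n tends to the Euler–Mascheroni
constant. -/
theorem ae_tendsto_M {E : ℕ → Ω → ℝ} (hE : ∀ i, Measurable (E i))
    (hElaw : ∀ i, HasLaw (E i) (expMeasure 1) P) (hEind : iIndepFun E P) :
    ∀ᵐ ω ∂P, Tendsto (fun n => M E n ω) atTop (𝓝 (Minf E ω)) := by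
  have hν := isProbabilityMeasure_expMeasure one_pos
  set u : ℕ → ℝ → ℝ := fun i x => (1 / ((i : ℝ) + 1)) * (x - 1) with hu
  have hum : ∀ i, Measurable (u i) := fun i => by fun_prop
  set X : ℕ → Ω → ℝ := fun i ω => u i (E i ω) with hX
  have hXm : ∀ i, Measurable (X i) := fun i => (hum i).comp (hE i)
  have hXind : iIndepFun X P := hEind.comp u hum
  have huL : ∀ i, MemLp (u i) 2 (expMeasure 1) := fun i =>
    (memLp_two_expMeasure_one.sub (memLp_const 1)).const_mul _
  have hXL : ∀ i, MemLp (X i) 2 P := by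
    intro i
    have h := huL i
    rw [← (hElaw i).map_eq] at h
    exact (memLp_map_measure_iff (hum i).aestronglyMeasurable (hE i).aemeasurable).1 h
  have hX0 : ∀ i, ∫ ω, X i ω ∂P = 0 := by
    intro i
    have h := (hElaw i).integral_comp (hum i).aestronglyMeasurable
    refine h.trans ?_
    simp only [hu]
    rw [integral_const_mul, integral_sub (memLp_two_expMeasure_one.integrable one_le_two)
      (integrable_const _), integral_id_expMeasure_one]
    simp
  set V : ℝ := ∫ x, (x - 1) ^ 2 ∂expMeasure 1 with hV
  have hX2 : ∀ i, Var[X i; P] = (1 / ((i : ℝ) + 1)) ^ 2 * V := by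
    intro i
    rw [variance_of_integral_eq_zero (hXm i).aemeasurable (hX0 i)]
    have h := (hElaw i).integral_comp (f := fun x => u i x ^ 2)
      ((hum i).pow_const 2).aestronglyMeasurable
    refine h.trans ?_
    simp only [hu, mul_pow]
    rw [integral_const_mul]
  have hsm : ∀ i, StronglyMeasurable (X i) := fun i => (hXm i).stronglyMeasurable
  let ℱ := Filtration.natural X hsm
  -- The sum runs up to the index n included, since the natural filtration at time n contains X_n;
  -- this is the source of the shifts by one below.
  let f : ℕ → Ω → ℝ := fun n => ∑ i ∈ Finset.range (n + 1), X i
  have hfL : ∀ n, MemLp (f n) 2 P := fun n => memLp_finsetSum' _ fun i _ => hXL i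
  have hmart : Martingale f ℱ P := by
    refine martingale_of_condExp_sub_eq_zero_nat ?_ (fun n => (hfL n).integrable one_le_two) ?_
    · intro n
      refine Finset.stronglyMeasurable_sum _ fun i hi => ?_
      exact (Filtration.stronglyAdapted_natural hsm i).mono
        (ℱ.mono (Nat.lt_succ_iff.1 (Finset.mem_range.1 hi)))
    · intro n
      have : f (n + 1) - f n = X (n + 1) := by
        simp only [f, Finset.sum_range_succ _ (n + 1), add_sub_cancel_left]
      rw [this]
      have h := hXind.condExp_natural_ae_eq_of_lt hsm (Nat.lt_succ_self n)
      rw [hX0] at h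
      exact h
  have hsummable : Summable fun i : ℕ => (1 / ((i : ℝ) + 1)) ^ 2 := by
    have := (summable_nat_add_iff 1).2 (Real.summable_one_div_nat_pow.2 one_lt_two)
    simpa [div_pow] using this
  have hV0 : 0 ≤ V := integral_nonneg fun x => sq_nonneg _
  have hbound : ∀ n, ∫ ω, f n ω ^ 2 ∂P ≤ (∑' i : ℕ, (1 / ((i : ℝ) + 1)) ^ 2) * V := by
    intro n
    have h0 : ∫ ω, f n ω ∂P = 0 := by
      simp only [f, Finset.sum_apply]
      rw [integral_finsetSum _ fun i _ => (hXL i).integrable one_le_two]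
      simp [hX0]
    rw [← variance_of_integral_eq_zero (hfL n).aestronglyMeasurable.aemeasurable h0]
    rw [IndepFun.variance_sum (fun i _ => hXL i) fun i _ j _ hij => hXind.indepFun hij]
    simp_rw [hX2]
    rw [← Finset.sum_mul]
    exact mul_le_mul_of_nonneg_right (hsummable.sum_le_tsum _ fun i _ => sq_nonneg _) hV0
  set R : ℝ := 1 + (∑' i : ℕ, (1 / ((i : ℝ) + 1)) ^ 2) * V with hR
  have hL1 : ∀ n, eLpNorm (f n) 1 P ≤ (R.toNNReal : ℝ≥0∞) := by
    intro n
    have hi : Integrable (fun ω => f n ω ^ 2) P := (hfL n).integrable_sq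
    rw [eLpNorm_one_eq_lintegral_enorm, ← ofReal_integral_norm_eq_lintegral_enorm
      ((hfL n).integrable one_le_two)]
    refine ENNReal.ofReal_le_ofReal ?_
    calc ∫ ω, ‖f n ω‖ ∂P ≤ ∫ ω, (1 + f n ω ^ 2) ∂P := by
          refine integral_mono ((hfL n).integrable one_le_two).norm
            ((integrable_const _).add hi) fun ω => ?_
          change |f n ω| ≤ _
          nlinarith [sq_abs (f n ω), sq_nonneg (|f n ω| - 1)]
      _ = 1 + ∫ ω, f n ω ^ 2 ∂P := by
          rw [integral_add (integrable_const _) hi]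
          simp
      _ ≤ R := by linarith [hbound n]
  filter_upwards [hmart.submartingale.ae_tendsto_limitProcess hL1] with ω hω
  refine tendsto_nhds_limUnder ⟨Filtration.limitProcess f ℱ P ω + Real.eulerMascheroniConstant, ?_⟩
  rw [← tendsto_add_atTop_iff_nat 1]
  have h2 := (tendsto_add_atTop_iff_nat 1).2 Real.tendsto_harmonic_sub_log
  refine (hω.add h2).congr fun n => ?_
  have h3 : splitTime E (n + 1) ω = f n ω + (harmonic (n + 1) : ℝ) := by
    simp only [splitTime, f, Finset.sum_apply, harmonic]
    push_cast
    rw [← Finset.sum_add_distrib]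
    refine Finset.sum_congr rfl fun i _ => ?_
    simp only [hX, hu]
    ring
  rw [M, h3]
  ring

end

/-! ### Balls in bins and Poissonization -/

section Depoissonization

variable {ι : Type*} {s : Finset ι} {a x : ι → ℝ} {c : ℕ → ℝ}

/-- This is the Poisson generating function: the mean of x^m for m Poisson of parameter l is
e^{-l(1-x)}. Inclusion–exclusion will put the occupancy functionals in the form required of c. -/
lemma hasSum_poisson_average (hc : ∀ m, c m = ∑ i ∈ s, a i * x i ^ m) (l : ℝ) :
    HasSum (fun m : ℕ => Real.exp (-l) * (l ^ m / m.factorial) * c m)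
      (∑ i ∈ s, a i * Real.exp (-(l * (1 - x i)))) := by
  have h : ∀ i ∈ s, HasSum (fun m : ℕ => Real.exp (-l) * (l ^ m / m.factorial) * (a i * x i ^ m))
      (a i * Real.exp (-(l * (1 - x i)))) := by
    intro i _
    have h1 := NormedSpace.expSeries_div_hasSum_exp (l * x i)
    rw [← Real.exp_eq_exp_ℝ] at h1
    have h2 := h1.mul_left (a i * Real.exp (-l))
    rw [mul_assoc, ← Real.exp_add] at h2
    rw [show -(l * (1 - x i)) = -l + l * x i by ring]
    have h3 : (fun m : ℕ => Real.exp (-l) * (l ^ m / m.factorial) * (a i * x i ^ m)) =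
        fun m : ℕ => a i * Real.exp (-l) * ((l * x i) ^ m / m.factorial) := by
      ext m
      rw [mul_pow]
      ring
    rwa [h3]
  simp_rw [hc, Finset.mul_sum]
  exact hasSum_sum h

/-- Chernoff bound. The weight κ^{n-m} is at least 1 for m ≥ n when κ < 1, and for m ≤ n when κ > 1,
so it dominates the indicator of the atypical side; its mean is exponentially small in n. -/
lemma poisson_average_tail (n : ℕ) {κ : ℝ} (hκ : 0 < κ) :
    HasSum (fun m : ℕ => Real.exp (-(κ * n)) * ((κ * n) ^ m / m.factorial) *
      ((1 / κ) ^ m * κ ^ n)) (Real.exp (-(n * (κ - 1 - Real.log κ)))) := by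
  have h := hasSum_poisson_average (s := {()}) (a := fun _ => κ ^ n) (x := fun _ => 1 / κ)
    (c := fun m => (1 / κ) ^ m * κ ^ n) (fun m => by simp [mul_comm]) (κ * n)
  convert h using 1
  rw [Finset.sum_singleton, ← Real.rpow_natCast, Real.rpow_def_of_pos hκ, ← Real.exp_add]
  congr 1
  field_simp
  ring

lemma poisson_weight_nonneg {l : ℝ} (hl : 0 ≤ l) (m : ℕ) :
    0 ≤ Real.exp (-l) * (l ^ m / m.factorial) := by positivity

lemma hasSum_poisson_weight (l C : ℝ) :
    HasSum (fun m : ℕ => Real.exp (-l) * (l ^ m / m.factorial) * C) C := by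
  simpa using hasSum_poisson_average (s := {()}) (a := fun _ => C) (x := fun _ => 1)
    (c := fun _ => C) (fun m => by simp) l

/-- For κ < 1 a Poisson variable of mean κn is typically below n, where c is at most c n; elsewhere
c ≤ 1 is absorbed by the Chernoff weight. The companion `le_poisson_average` uses κ > 1 in the same
way. -/
lemma poisson_average_le (hc : ∀ m, c m = ∑ i ∈ s, a i * x i ^ m) (hmono : Monotone c)
    (h0 : ∀ m, 0 ≤ c m) (h1 : ∀ m, c m ≤ 1) {κ : ℝ} (hκ : 0 < κ) (hκ1 : κ < 1) (n : ℕ) :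
    ∑ i ∈ s, a i * Real.exp (-(κ * n * (1 - x i))) ≤
      c n + Real.exp (-(n * (κ - 1 - Real.log κ))) := by
  refine hasSum_le (fun m => ?_) (hasSum_poisson_average hc (κ * n))
    ((hasSum_poisson_weight (κ * n) (c n)).add (poisson_average_tail n hκ))
  rw [← mul_add]
  refine mul_le_mul_of_nonneg_left ?_ (poisson_weight_nonneg (by positivity) m)
  rcases le_total m n with hmn | hmn
  · exact (hmono hmn).trans (le_add_of_nonneg_right (by positivity))
  · have h2 : (1 : ℝ) ≤ (1 / κ) ^ m * κ ^ n := by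
      have h3 : (1 / κ) ^ n ≤ (1 / κ) ^ m :=
        pow_le_pow_right₀ ((one_le_div hκ).2 hκ1.le) hmn
      calc (1 : ℝ) = (1 / κ) ^ n * κ ^ n := by rw [← mul_pow]; field_simp; simp
        _ ≤ _ := by gcongr
    linarith [h0 n, h1 m]

lemma le_poisson_average (hc : ∀ m, c m = ∑ i ∈ s, a i * x i ^ m) (hmono : Monotone c)
    (h0 : ∀ m, 0 ≤ c m) (h1 : ∀ m, c m ≤ 1) {κ : ℝ} (hκ1 : 1 < κ) (n : ℕ) :
    c n ≤ ∑ i ∈ s, a i * Real.exp (-(κ * n * (1 - x i))) +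
      Real.exp (-(n * (κ - 1 - Real.log κ))) := by
  have hκ : 0 < κ := by linarith
  refine hasSum_le (fun m => ?_) (hasSum_poisson_weight (κ * n) (c n))
    ((hasSum_poisson_average hc (κ * n)).add (poisson_average_tail n hκ))
  rw [← mul_add]
  refine mul_le_mul_of_nonneg_left ?_ (poisson_weight_nonneg (by positivity) m)
  rcases le_total n m with hmn | hmn
  · exact (hmono hmn).trans (le_add_of_nonneg_right (by positivity))
  · have h2 : (1 : ℝ) ≤ (1 / κ) ^ m * κ ^ n := by
      have h3 : κ ^ m ≤ κ ^ n := pow_le_pow_right₀ hκ1.le hmn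
      calc (1 : ℝ) = (1 / κ) ^ m * κ ^ m := by rw [← mul_pow]; field_simp; simp
        _ ≤ _ := by gcongr
    linarith [h1 n, h0 m]

end Depoissonization

/-! ### Occupancy of the bins and inclusion–exclusion -/

section Occupancy

open Classical in
/-- The indicator of the event that no ball among `b 0, …, b (m - 1)` falls into the bin
`(t i, t (i + 1)]`. -/
def emptyInd (t b : ℕ → ℝ) (m i : ℕ) : ℝ :=
  if ∀ j < m, b j ∉ Set.Ioc (t i) (t (i + 1)) then 1 else 0

lemma emptyInd_nonneg (t b : ℕ → ℝ) (m i : ℕ) : 0 ≤ emptyInd t b m i := by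
  unfold emptyInd; split_ifs <;> norm_num

lemma emptyInd_le_one (t b : ℕ → ℝ) (m i : ℕ) : emptyInd t b m i ≤ 1 := by
  unfold emptyInd; split_ifs <;> norm_num

lemma emptyInd_antitone (t b : ℕ → ℝ) (i : ℕ) : Antitone fun m => emptyInd t b m i := by
  intro m m' hmm
  simp only [emptyInd]
  split_ifs with h1 h2
  · exact le_rfl
  · exact absurd (fun j hj => h1 j (hj.trans_le hmm)) h2
  · norm_num
  · norm_num

lemma measurable_emptyInd (m i : ℕ) :
    Measurable fun p : (ℕ → ℝ) × (ℕ → ℝ) => emptyInd p.1 p.2 m i := by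
  unfold emptyInd
  refine Measurable.ite ?_ measurable_const measurable_const
  change MeasurableSet {p : (ℕ → ℝ) × (ℕ → ℝ) | ∀ j < m, p.2 j ∉ Set.Ioc (p.1 i) (p.1 (i + 1))}
  have : {p : (ℕ → ℝ) × (ℕ → ℝ) | ∀ j < m, p.2 j ∉ Set.Ioc (p.1 i) (p.1 (i + 1))} =
      ⋂ j ∈ Finset.range m, ({p | p.1 i < p.2 j} ∩ {p | p.2 j ≤ p.1 (i + 1)})ᶜ := by
    ext p
    simp
  rw [this]
  exact Finset.measurableSet_biInter _ fun j _ => ((measurableSet_lt (by fun_prop)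
    (by fun_prop)).inter (measurableSet_le (by fun_prop) (by fun_prop))).compl

/-- The product of the factors `1 - h i` over the empty bins of index `i < N`. -/
def emptyProd (h : ℕ → ℝ) (N : ℕ) (t b : ℕ → ℝ) (m : ℕ) : ℝ :=
  ∏ i ∈ Finset.range N, (1 - h i * emptyInd t b m i)

variable {h : ℕ → ℝ} (N : ℕ)

lemma factor_mem {u v : ℝ} (hu0 : 0 ≤ u) (hu1 : u ≤ 1) (hv0 : 0 ≤ v) (hv1 : v ≤ 1) :
    0 ≤ 1 - u * v ∧ 1 - u * v ≤ 1 :=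
  ⟨by linarith [mul_le_one₀ hu1 hv0 hv1], by linarith [mul_nonneg hu0 hv0]⟩

lemma emptyProd_nonneg (h0 : ∀ i, 0 ≤ h i) (h1 : ∀ i, h i ≤ 1) (t b : ℕ → ℝ) (m : ℕ) :
    0 ≤ emptyProd h N t b m :=
  Finset.prod_nonneg fun i _ =>
    (factor_mem (h0 i) (h1 i) (emptyInd_nonneg _ _ _ _) (emptyInd_le_one _ _ _ _)).1

lemma emptyProd_le_one (h0 : ∀ i, 0 ≤ h i) (h1 : ∀ i, h i ≤ 1) (t b : ℕ → ℝ) (m : ℕ) :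
    emptyProd h N t b m ≤ 1 :=
  Finset.prod_le_one
    (fun i _ => (factor_mem (h0 i) (h1 i) (emptyInd_nonneg _ _ _ _) (emptyInd_le_one _ _ _ _)).1)
    fun i _ => (factor_mem (h0 i) (h1 i) (emptyInd_nonneg _ _ _ _) (emptyInd_le_one _ _ _ _)).2

lemma abs_emptyProd_le (h0 : ∀ i, 0 ≤ h i) (h1 : ∀ i, h i ≤ 1) (t b : ℕ → ℝ) (m : ℕ) :
    |emptyProd h N t b m| ≤ 1 := by
  rw [abs_of_nonneg (emptyProd_nonneg N h0 h1 t b m)]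
  exact emptyProd_le_one N h0 h1 t b m

/-- Additional balls can only fill empty bins. This monotonicity is what allows a Poisson number of
balls to be replaced by a fixed one. -/
lemma emptyProd_mono (h0 : ∀ i, 0 ≤ h i) (h1 : ∀ i, h i ≤ 1) (t b : ℕ → ℝ) :
    Monotone (emptyProd h N t b) := by
  intro m m' hmm
  refine Finset.prod_le_prod (fun i _ =>
    (factor_mem (h0 i) (h1 i) (emptyInd_nonneg _ _ _ _) (emptyInd_le_one _ _ _ _)).1) fun i _ => ?_
  exact sub_le_sub_left (mul_le_mul_of_nonneg_left (emptyInd_antitone t b i hmm) (h0 i)) 1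

lemma measurable_emptyProd (h : ℕ → ℝ) (N m : ℕ) :
    Measurable fun p : (ℕ → ℝ) × (ℕ → ℝ) => emptyProd h N p.1 p.2 m := by
  have := measurable_emptyInd m
  unfold emptyProd
  fun_prop

lemma prod_emptyInd (t b : ℕ → ℝ) (m : ℕ) (S : Finset ℕ) :
    ∏ i ∈ S, emptyInd t b m i = Set.indicator
      (Set.pi (Finset.range m) fun _ => (⋃ i ∈ S, Set.Ioc (t i) (t (i + 1)))ᶜ) (fun _ => 1) b := by
  classical
  simp only [emptyInd]
  rw [Finset.prod_ite_zero, Set.indicator_apply]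
  simp only [Finset.prod_const_one]
  refine if_congr ?_ rfl rfl
  simp only [Set.mem_pi, Finset.coe_range, Set.mem_Iio, Set.mem_compl_iff, Set.mem_iUnion,
    not_exists]
  exact ⟨fun H j hj i hi => H i hi j hj, fun H i hi j hj => H j hj i hi⟩

/-- Expand the product over sets S of bins. All bins of S are empty when each of the m balls avoids
their disjoint union, which gives an m-th power: the expectation is a finite combination of powers,
as `hasSum_poisson_average` requires. -/
lemma integral_emptyProd {r : ℝ} (hr : 0 < r) {t : ℕ → ℝ} (ht : Monotone t) (m : ℕ) :
    ∫ b, emptyProd h N t b m ∂expSeqMeasure r = ∑ S ∈ (Finset.range N).powerset,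
      (∏ i ∈ S, -h i) * (1 - ∑ i ∈ S, (expMeasure r).real (Set.Ioc (t i) (t (i + 1)))) ^ m := by
  have := isProbabilityMeasure_expMeasure hr
  have := isProbabilityMeasure_expSeqMeasure hr
  have hexp : ∀ b, emptyProd h N t b m = ∑ S ∈ (Finset.range N).powerset,
      (∏ i ∈ S, -h i) * Set.indicator
      (Set.pi (Finset.range m) fun _ => (⋃ i ∈ S, Set.Ioc (t i) (t (i + 1)))ᶜ) (fun _ => 1) b := by
    intro b
    simp only [emptyProd, sub_eq_add_neg, ← neg_mul]
    rw [Finset.prod_one_add]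
    simp_rw [Finset.prod_mul_distrib, prod_emptyInd]
  have hU : ∀ S : Finset ℕ, MeasurableSet (⋃ i ∈ S, Set.Ioc (t i) (t (i + 1))) := fun S =>
    S.measurableSet_biUnion fun _ _ => measurableSet_Ioc
  have hpi : ∀ S : Finset ℕ, MeasurableSet (Set.pi (Finset.range m : Set ℕ)
      fun _ => (⋃ i ∈ S, Set.Ioc (t i) (t (i + 1)))ᶜ) := fun S =>
    MeasurableSet.pi (Finset.countable_toSet _) fun _ _ => (hU S).compl
  simp_rw [hexp]
  rw [integral_finsetSum _ fun S _ =>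
    Integrable.const_mul ((integrable_const (μ := expSeqMeasure r) (1 : ℝ)).indicator (hpi S)) _]
  refine Finset.sum_congr rfl fun S _ => ?_
  rw [integral_const_mul, integral_indicator_const _ (hpi S), smul_eq_mul, mul_one]
  congr 1
  rw [measureReal_def, expSeqMeasure, Measure.infinitePi_pi _ fun _ _ => (hU S).compl,
    Finset.prod_const, Finset.card_range, ENNReal.toReal_pow, ← measureReal_def,
    probReal_compl_eq_one_sub (hU S), measureReal_biUnion_finset]
  · exact ht.pairwise_disjoint_on_Ioc_succ.set_pairwise _
  · exact fun _ _ => measurableSet_Ioc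

lemma measureReal_Ioc_expMeasure {r : ℝ} (hr : 0 < r) {a b : ℝ} (ha : 0 ≤ a) (hab : a ≤ b) :
    (expMeasure r).real (Set.Ioc a b) = Real.exp (-(r * a)) - Real.exp (-(r * b)) := by
  have := isProbabilityMeasure_expMeasure hr
  have h1 := cdf_expMeasure_eq hr a
  have h2 := cdf_expMeasure_eq hr b
  rw [cdf_eq_real, if_pos ha] at h1
  rw [cdf_eq_real, if_pos (ha.trans hab)] at h2
  rw [← Set.Iic_sdiff_Iic, measureReal_sdiff (Set.Iic_subset_Iic.2 hab) measurableSet_Iic, h1, h2]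
  ring

/-- The Poissonized version of `emptyProd`: the numbers of balls in the bins are independent
Poisson variables, with a total mean of `l`. -/
def poissonProd (ρ : ℝ) (h : ℕ → ℝ) (N : ℕ) (t : ℕ → ℝ) (l : ℝ) : ℝ :=
  ∏ i ∈ Finset.range N,
    (1 - h i * Real.exp (-(l * (Real.exp (-(ρ * t i)) - Real.exp (-(ρ * t (i + 1)))))))

/-- Expanding over the same sets of bins matches the Poisson average of `integral_emptyProd` term by
term; the form 1 - (1 - ∑) is the 1 - x of `hasSum_poisson_average`. -/
lemma poissonProd_eq {ρ : ℝ} (hρ : 0 < ρ) {t : ℕ → ℝ} (ht0 : 0 ≤ t 0) (ht : Monotone t) (l : ℝ) :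
    poissonProd ρ h N t l = ∑ S ∈ (Finset.range N).powerset, (∏ i ∈ S, -h i) * Real.exp (-(l *
      (1 - (1 - ∑ i ∈ S, (expMeasure ρ).real (Set.Ioc (t i) (t (i + 1))))))) := by
  simp only [poissonProd, sub_eq_add_neg, ← neg_mul]
  rw [Finset.prod_one_add]
  refine Finset.sum_congr rfl fun S _ => ?_
  rw [Finset.prod_mul_distrib, ← Real.exp_sum]
  congr 2
  rw [← Finset.mul_sum, neg_mul, neg_mul]
  congr 2
  rw [neg_add, neg_neg, add_neg_cancel_left]
  refine Finset.sum_congr rfl fun i _ => ?_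
  rw [measureReal_Ioc_expMeasure hρ (ht0.trans (ht (Nat.zero_le i))) (ht i.le_succ)]
  simp [sub_eq_add_neg]

lemma poissonProd_le_integral (h0 : ∀ i, 0 ≤ h i) (h1 : ∀ i, h i ≤ 1) {ρ : ℝ} (hρ : 0 < ρ)
    {t : ℕ → ℝ} (ht0 : 0 ≤ t 0) (ht : Monotone t) {κ : ℝ} (hκ : 0 < κ) (hκ1 : κ < 1) (n : ℕ) :
    poissonProd ρ h N t (κ * n) ≤ ∫ b, emptyProd h N t b n ∂expSeqMeasure ρ +
      Real.exp (-(n * (κ - 1 - Real.log κ))) := by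
  have := isProbabilityMeasure_expSeqMeasure hρ
  have hint : ∀ m, Integrable (fun b => emptyProd h N t b m) (expSeqMeasure ρ) := fun m =>
    Integrable.of_bound ((measurable_emptyProd h N m).comp
      (measurable_const.prodMk measurable_id)).aestronglyMeasurable 1
      (ae_of_all _ fun b => abs_emptyProd_le N h0 h1 t b m)
  rw [poissonProd_eq N hρ ht0 ht]
  refine poisson_average_le (c := fun m => ∫ b, emptyProd h N t b m ∂expSeqMeasure ρ)
    (integral_emptyProd N hρ ht) ?_ ?_ ?_ hκ hκ1 n
  · exact fun m m' hmm => integral_mono (hint m) (hint m') fun b => emptyProd_mono N h0 h1 t b hmm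
  · exact fun m => integral_nonneg fun b => emptyProd_nonneg N h0 h1 t b m
  · intro m
    refine (integral_mono (hint m) (integrable_const 1) fun b =>
      emptyProd_le_one N h0 h1 t b m).trans_eq ?_
    simp

lemma integral_le_poissonProd (h0 : ∀ i, 0 ≤ h i) (h1 : ∀ i, h i ≤ 1) {ρ : ℝ} (hρ : 0 < ρ)
    {t : ℕ → ℝ} (ht0 : 0 ≤ t 0) (ht : Monotone t) {κ : ℝ} (hκ1 : 1 < κ) (n : ℕ) :
    ∫ b, emptyProd h N t b n ∂expSeqMeasure ρ ≤ poissonProd ρ h N t (κ * n) +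
      Real.exp (-(n * (κ - 1 - Real.log κ))) := by
  have := isProbabilityMeasure_expSeqMeasure hρ
  have hint : ∀ m, Integrable (fun b => emptyProd h N t b m) (expSeqMeasure ρ) := fun m =>
    Integrable.of_bound ((measurable_emptyProd h N m).comp
      (measurable_const.prodMk measurable_id)).aestronglyMeasurable 1
      (ae_of_all _ fun b => abs_emptyProd_le N h0 h1 t b m)
  rw [poissonProd_eq N hρ ht0 ht]
  refine le_poisson_average (c := fun m => ∫ b, emptyProd h N t b m ∂expSeqMeasure ρ)
    (integral_emptyProd N hρ ht) ?_ ?_ ?_ hκ1 n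
  · exact fun m m' hmm => integral_mono (hint m) (hint m') fun b => emptyProd_mono N h0 h1 t b hmm
  · exact fun m => integral_nonneg fun b => emptyProd_nonneg N h0 h1 t b m
  · intro m
    refine (integral_mono (hint m) (integrable_const 1) fun b =>
      emptyProd_le_one N h0 h1 t b m).trans_eq ?_
    simp

end Occupancy

/-! ### Asymptotics of the products -/

/-- The mean of the probability that the bin of index `i + 1` is empty, when the number of balls is
Poisson and the left end point of the bin is `log i`, up to a constant absorbed by `l`. -/
def meanEmpty (ρ l : ℝ) (i : ℕ) : ℝ :=
  ∫ u, Real.exp (-(l * (i : ℝ) ^ (-ρ) * (1 - Real.exp (-(ρ * u / (i + 1)))))) ∂expMeasure 1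

section MeanEmpty

variable {ρ l : ℝ} {i : ℕ}

lemma integrable_meanEmpty (hρ : 0 < ρ) (hl : 0 ≤ l) (i : ℕ) :
    Integrable (fun u => Real.exp (-(l * (i : ℝ) ^ (-ρ) * (1 - Real.exp (-(ρ * u / (i + 1)))))))
      (expMeasure 1) := by
  have := isProbabilityMeasure_expMeasure one_pos
  refine Integrable.of_bound (by fun_prop) 1 ?_
  filter_upwards [ae_pos_expMeasure 1] with u hu
  rw [Real.norm_of_nonneg (Real.exp_pos _).le, Real.exp_le_one_iff, neg_nonpos]
  refine mul_nonneg (by positivity) (sub_nonneg.2 (Real.exp_le_one_iff.2 (neg_nonpos.2 ?_)))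
  positivity

lemma integrable_exp_neg_mul {y : ℝ} (hy : 0 ≤ y) :
    Integrable (fun u => Real.exp (-(y * u))) (expMeasure 1) := by
  have := isProbabilityMeasure_expMeasure one_pos
  refine Integrable.of_bound (by fun_prop) 1 ?_
  filter_upwards [ae_pos_expMeasure 1] with u hu
  rw [Real.norm_of_nonneg (Real.exp_pos _).le, Real.exp_le_one_iff, neg_nonpos]
  positivity

lemma meanEmpty_nonneg (ρ l : ℝ) (i : ℕ) : 0 ≤ meanEmpty ρ l i :=
  integral_nonneg fun _ => (Real.exp_pos _).le

/-- Since 1 - e^{-z} ≤ z, the integrand dominates an exponential in u, whose mean is explicit. -/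
lemma le_meanEmpty (hρ : 0 < ρ) (hl : 0 ≤ l) (i : ℕ) :
    1 / (1 + l * (i : ℝ) ^ (-ρ) * (ρ / (i + 1))) ≤ meanEmpty ρ l i := by
  have hy : 0 ≤ l * (i : ℝ) ^ (-ρ) * (ρ / (i + 1)) := by positivity
  rw [← integral_exp_neg_mul_expMeasure one_pos hy, meanEmpty]
  refine integral_mono (integrable_exp_neg_mul hy) (integrable_meanEmpty hρ hl i) fun u => ?_
  refine Real.exp_le_exp.2 (neg_le_neg ?_)
  rw [mul_assoc _ (ρ / ((i : ℝ) + 1)) u]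
  refine mul_le_mul_of_nonneg_left ?_ (by positivity)
  have := Real.add_one_le_exp (-(ρ * u / (i + 1)))
  rw [div_mul_eq_mul_div]
  linarith

/-- Split according to z = ρu/(i+1) against η, using x e^{-x} ≤ 1 - e^{-x}. For z ≤ η this gives 1 -
e^{-z} ≥ z e^{-η}, an exponential integral again; for z ≥ η the exponent is bounded by its value at
η. -/
lemma meanEmpty_le (hρ : 0 < ρ) (hl : 0 < l) (hi : 1 ≤ i) (η : ℝ) :
    meanEmpty ρ l i ≤ Real.exp η / (l * (i : ℝ) ^ (-ρ) * (ρ / (i + 1))) +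
      Real.exp (-(l * (i : ℝ) ^ (-ρ) * (η * Real.exp (-η)))) := by
  have := isProbabilityMeasure_expMeasure one_pos
  have hi0 : (0 : ℝ) < i := by exact_mod_cast hi
  set b : ℝ := l * (i : ℝ) ^ (-ρ) with hb
  have hb0 : 0 < b := by positivity
  set y : ℝ := b * (ρ / (i + 1)) with hy
  have hy0 : 0 < y := by positivity
  have hye : 0 ≤ y * Real.exp (-η) := by positivity
  calc meanEmpty ρ l i ≤ ∫ u, (Real.exp (-(y * Real.exp (-η) * u)) +
        Real.exp (-(b * (η * Real.exp (-η))))) ∂expMeasure 1 := by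
        refine integral_mono_ae (integrable_meanEmpty hρ hl.le i)
          ((integrable_exp_neg_mul hye).add (integrable_const _)) ?_
        filter_upwards [ae_pos_expMeasure 1] with u hu
        set z : ℝ := ρ * u / (i + 1) with hz
        have hz0 : 0 ≤ z := by positivity
        have key : ∀ x : ℝ, x * Real.exp (-x) ≤ 1 - Real.exp (-x) := by
          intro x
          have h1 := Real.add_one_le_exp x
          have h2 : Real.exp x * Real.exp (-x) = 1 := by rw [← Real.exp_add]; simp
          nlinarith [Real.exp_pos (-x)]
        rcases le_total z η with h | h
        · refine le_add_of_le_of_nonneg (Real.exp_le_exp.2 (neg_le_neg ?_)) (Real.exp_pos _).le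
          have h1 : z * Real.exp (-η) ≤ 1 - Real.exp (-z) := by
            refine le_trans ?_ (key z)
            gcongr
          calc y * Real.exp (-η) * u = b * (z * Real.exp (-η)) := by rw [hy, hz]; ring
            _ ≤ _ := by gcongr
        · refine le_add_of_nonneg_of_le (Real.exp_pos _).le (Real.exp_le_exp.2 (neg_le_neg ?_))
          refine mul_le_mul_of_nonneg_left ((key η).trans ?_) hb0.le
          gcongr
    _ = 1 / (1 + y * Real.exp (-η)) + Real.exp (-(b * (η * Real.exp (-η)))) := by
        rw [integral_add (integrable_exp_neg_mul hye) (integrable_const _),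
          integral_exp_neg_mul_expMeasure one_pos hye]
        simp
    _ ≤ _ := by
        refine add_le_add_left ?_ _
        rw [div_le_div_iff₀ (by positivity) hy0]
        have : Real.exp η * Real.exp (-η) = 1 := by rw [← Real.exp_add]; simp
        nlinarith [Real.exp_pos η]

end MeanEmpty

lemma prod_one_sub_le {ι : Type*} (s : Finset ι) {p : ι → ℝ} (hp1 : ∀ i ∈ s, p i ≤ 1) :
    ∏ i ∈ s, (1 - p i) ≤ Real.exp (-∑ i ∈ s, p i) := by
  rw [← Finset.sum_neg_distrib, Real.exp_sum]
  refine Finset.prod_le_prod (fun i hi => sub_nonneg.2 (hp1 i hi)) fun i _ => ?_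
  linarith [Real.add_one_le_exp (-p i)]

/-- Each factor satisfies 1/(1 - p) = 1 + p/(1 - p) ≤ e^{p/(1-p)}. -/
lemma le_prod_one_sub {ι : Type*} (s : Finset ι) {p : ι → ℝ} {ε : ℝ} (hε : ε < 1)
    (hp0 : ∀ i ∈ s, 0 ≤ p i) (hp1 : ∀ i ∈ s, p i ≤ ε) :
    Real.exp (-((∑ i ∈ s, p i) / (1 - ε))) ≤ ∏ i ∈ s, (1 - p i) := by
  rw [Finset.sum_div, ← Finset.sum_neg_distrib, Real.exp_sum]
  refine Finset.prod_le_prod (fun i _ => (Real.exp_pos _).le) fun i hi => ?_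
  have h1 : 0 < 1 - p i := by linarith [hp1 i hi]
  have h2 : p i / (1 - p i) ≤ p i / (1 - ε) := by
    have := hp0 i hi
    have := hp1 i hi
    gcongr
  have h3 := Real.add_one_le_exp (p i / (1 - p i))
  have h4 : p i / (1 - p i) + 1 = (1 - p i)⁻¹ := by field_simp; ring
  calc Real.exp (-(p i / (1 - ε))) ≤ Real.exp (-(p i / (1 - p i))) := by gcongr
    _ = (Real.exp (p i / (1 - p i)))⁻¹ := Real.exp_neg _
    _ ≤ ((1 - p i)⁻¹)⁻¹ := by
        rw [← h4]
        exact inv_anti₀ (by rw [h4]; positivity) h3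
    _ = 1 - p i := inv_inv _

/-! ### Riemann sums -/

lemma setIntegral_floor (f : ℕ → ℝ) {N : ℕ} (hf : ∀ i, N ≤ i → f i = 0) {a : ℝ} (ha : 0 < a) :
    ∫ x in Set.Ioi (0 : ℝ), f ⌊a * x⌋₊ = a⁻¹ * ∑ i ∈ Finset.range N, f i := by
  have h := integral_comp_mul_left_Ioi (fun y => f ⌊y⌋₊) 0 ha
  rw [h, mul_zero, smul_eq_mul, ← integral_Ici_eq_integral_Ioi]
  congr 1
  have h1 : ∀ y ∈ Set.Ici (0 : ℝ), f ⌊y⌋₊ =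
      ∑ i ∈ Finset.range N, (Set.Ico (i : ℝ) (i + 1)).indicator (fun _ => f i) y := by
    intro y hy
    have h2 : ∀ i : ℕ, (Set.Ico (i : ℝ) (i + 1)).indicator (fun _ => f i) y =
        if ⌊y⌋₊ = i then f i else 0 := by
      intro i
      rw [Set.indicator_apply]
      exact if_congr (Nat.floor_eq_iff hy).symm rfl rfl
    simp_rw [h2]
    rw [Finset.sum_ite_eq]
    split_ifs with h3
    · rfl
    · exact hf _ (by simpa using h3)
  rw [setIntegral_congr_fun measurableSet_Ici h1, integral_finsetSum]
  · refine Finset.sum_congr rfl fun i _ => ?_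
    rw [integral_indicator_const _ measurableSet_Ico, measureReal_restrict_apply measurableSet_Ico,
      Set.inter_eq_left.2 (show Set.Ico (i : ℝ) (i + 1) ⊆ Set.Ici 0 from
        fun y hy => (Nat.cast_nonneg i).trans hy.1)]
    simp
  · intro i _
    refine IntegrableOn.integrable_indicator ?_ measurableSet_Ico
    rw [IntegrableOn, Measure.restrict_restrict measurableSet_Ico]
    exact (integrableOn_const (by simp : volume (Set.Ico (i : ℝ) (i + 1)) ≠ ∞)).mono_set
      Set.inter_subset_left

/-- By `setIntegral_floor` the sum is the integral of a step function, so dominated convergence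
applies. The starting index K is irrelevant: for fixed x > 0, ⌊ax⌋ exceeds it eventually. -/
lemma tendsto_riemann_sum {ρ : ℝ} (hρ : 0 < ρ) {G : ℝ → ℝ} (hG : Continuous G)
    (hG0 : ∀ x, 0 ≤ G x) (hG1 : ∀ x, G x ≤ 1) {A : ℝ} (hA : 0 < A) (hGA : ∀ x, A ≤ x → G x = 0)
    (K : ℕ) :
    Tendsto (fun a : ℝ => a⁻¹ * ∑ i ∈ Finset.Ico K ⌈A * a⌉₊,
        G ((i + 1) / a) * ((i / a) ^ ρ * ((i + 1) / a))) atTop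
      (𝓝 (∫ x in Set.Ici (0 : ℝ), G x * x ^ (ρ + 1))) := by
  let f : ℝ → ℕ → ℝ := fun a i =>
    if K ≤ i then G ((i + 1) / a) * ((i / a) ^ ρ * ((i + 1) / a)) else 0
  have hfA : ∀ a, 0 < a → ∀ i : ℕ, A * a ≤ i + 1 → f a i = 0 := by
    intro a ha i hi
    have : A ≤ ((i : ℝ) + 1) / a := by rwa [le_div_iff₀ ha]
    simp [f, hGA _ this]
  have hsum : ∀ᶠ a : ℝ in atTop, ∫ x in Set.Ioi (0 : ℝ), f a ⌊a * x⌋₊ =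
      a⁻¹ * ∑ i ∈ Finset.Ico K ⌈A * a⌉₊, G ((i + 1) / a) * ((i / a) ^ ρ * ((i + 1) / a)) := by
    filter_upwards [eventually_gt_atTop 0] with a ha
    rw [setIntegral_floor (f a) (N := ⌈A * a⌉₊) (fun i hi => hfA a ha i ?_) ha]
    · congr 1
      rw [← Finset.sum_filter]
      congr 1
      ext i
      simp [and_comm]
    · exact (Nat.ceil_le.1 hi).trans (by linarith)
  refine Tendsto.congr' hsum ?_
  rw [integral_Ici_eq_integral_Ioi]
  refine tendsto_integral_filter_of_dominated_convergence
    ((Set.Ioc 0 A).indicator fun _ => A ^ ρ * (A + 1)) ?_ ?_ ?_ ?_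
  · refine Eventually.of_forall fun a => Measurable.aestronglyMeasurable ?_
    exact (measurable_from_nat (f := f a)).comp
      (Nat.measurable_floor.comp (measurable_const.mul measurable_id))
  · filter_upwards [eventually_ge_atTop 1] with a ha
    refine (ae_restrict_iff' measurableSet_Ioi).2 (ae_of_all _ fun x hx => ?_)
    have hx0 : (0 : ℝ) < x := hx
    have ha0 : 0 < a := by linarith
    by_cases hxA : x ≤ A
    · rw [Set.indicator_of_mem (Set.mem_Ioc.2 ⟨hx0, hxA⟩)]
      have h1 : (⌊a * x⌋₊ : ℝ) / a ≤ A := by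
        rw [div_le_iff₀ ha0]
        exact (Nat.floor_le (by positivity)).trans (by nlinarith)
      have h2 : ((⌊a * x⌋₊ : ℝ) + 1) / a ≤ A + 1 := by
        rw [add_div]
        exact add_le_add h1 ((div_le_one ha0).2 ha)
      simp only [f]
      split_ifs
      · rw [Real.norm_of_nonneg (mul_nonneg (hG0 _) (by positivity))]
        refine (mul_le_of_le_one_left (by positivity) (hG1 _)).trans ?_
        gcongr
      · simp
        positivity
    · rw [hfA a ha0, norm_zero]
      · exact Set.indicator_nonneg (fun _ _ => by positivity) _
      · have := (Nat.lt_floor_add_one (a * x)).le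
        nlinarith [not_le.1 hxA]
  · exact (integrableOn_const (by simp : volume (Set.Ioc 0 A) ≠ ∞)).integrable_indicator
      measurableSet_Ioc |>.mono_measure Measure.restrict_le_self
  · refine (ae_restrict_iff' measurableSet_Ioi).2 (ae_of_all _ fun x hx => ?_)
    have hx0 : (0 : ℝ) < x := hx
    have h1 : Tendsto (fun a : ℝ => (⌊a * x⌋₊ : ℝ) / a) atTop (𝓝 x) := by
      have := tendsto_nat_floor_mul_div_atTop (R := ℝ) hx0.le
      simpa [mul_comm] using this
    have h2 : Tendsto (fun a : ℝ => ((⌊a * x⌋₊ : ℝ) + 1) / a) atTop (𝓝 x) := by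
      have := h1.add tendsto_inv_atTop_zero
      simpa [add_div, one_div] using this
    have h3 : Tendsto (fun a : ℝ => G (((⌊a * x⌋₊ : ℝ) + 1) / a) *
        (((⌊a * x⌋₊ : ℝ) / a) ^ ρ * (((⌊a * x⌋₊ : ℝ) + 1) / a))) atTop
        (𝓝 (G x * (x ^ ρ * x))) :=
      ((hG.tendsto x).comp h2).mul
        ((h1.rpow_const (Or.inl hx0.ne')).mul h2)
    rw [Real.rpow_add_one hx0.ne']
    refine h3.congr' ?_
    have h4 : Tendsto (fun a : ℝ => a * x) atTop atTop := tendsto_id.atTop_mul_const hx0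
    filter_upwards [h4.eventually_ge_atTop (K : ℝ)] with a ha
    simp [f, Nat.le_floor ha]

/-- Uniformly over the range, `meanEmpty` is close to the inverse y of the linear coefficient in its
exponent, and y is a^{-1}/(βρ) times the weight of the Riemann sum. The factors are within O(1/a) of
1, so the product behaves like the exponential of minus the sum. -/
theorem tendsto_prod_meanEmpty {ρ : ℝ} (hρ : 0 < ρ) {G : ℝ → ℝ} (hG : Continuous G)
    (hG0 : ∀ x, 0 ≤ G x) (hG1 : ∀ x, G x ≤ 1) {A : ℝ} (hA : 0 < A) (hGA : ∀ x, A ≤ x → G x = 0)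
    {K : ℕ} (hK : 1 ≤ K) {β : ℝ} (hβ : 0 < β) :
    Tendsto (fun a : ℝ => ∏ i ∈ Finset.Ico K ⌈A * a⌉₊,
        (1 - G ((i + 1) / a) * meanEmpty ρ (a ^ (ρ + 2) * β) i)) atTop
      (𝓝 (Real.exp (-((∫ x in Set.Ici (0 : ℝ), G x * x ^ (ρ + 1)) / (β * ρ))))) := by
  set I := ∫ x in Set.Ici (0 : ℝ), G x * x ^ (ρ + 1) with hI
  set R : ℝ → ℝ := fun a => a⁻¹ * ∑ i ∈ Finset.Ico K ⌈A * a⌉₊,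
        G ((i + 1) / a) * ((i / a) ^ ρ * ((i + 1) / a)) with hR
  have hRlim : Tendsto R atTop (𝓝 I) := tendsto_riemann_sum hρ hG hG0 hG1 hA hGA K
  -- For i < Aa and a ≥ 1, Z/a bounds y, and the exponent of the error term in `meanEmpty_le` with η
  -- = 1/a is at least ca.
  set Z : ℝ := A ^ ρ * (A + 1) / (β * ρ) with hZ
  have hZ0 : 0 < Z := by positivity
  set c : ℝ := β * A ^ (-ρ) * Real.exp (-1) with hc
  have hc0 : 0 < c := by positivity
  set p : ℝ → ℕ → ℝ := fun a i => G ((i + 1) / a) * meanEmpty ρ (a ^ (ρ + 2) * β) i with hp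
  have hp0 : ∀ a i, 0 ≤ p a i := fun a i => mul_nonneg (hG0 _) (meanEmpty_nonneg _ _ _)
  -- the inverse of the linear coefficient
  set y : ℝ → ℕ → ℝ := fun a i => (i / a) ^ ρ * ((i + 1) / a) / (β * ρ) * a⁻¹ with hy
  have hyeq : ∀ a, 0 < a → ∀ i : ℕ, 1 ≤ i →
      (a ^ (ρ + 2) * β * (i : ℝ) ^ (-ρ) * (ρ / (i + 1)))⁻¹ = y a i := by
    intro a ha i hi
    have hi0 : (0 : ℝ) < i := by exact_mod_cast hi
    rw [hy]
    simp only
    rw [Real.div_rpow hi0.le ha.le, Real.rpow_neg hi0.le, Real.rpow_add ha, Real.rpow_two]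
    have h1 : 0 < (i : ℝ) ^ ρ := by positivity
    have h2 : 0 < a ^ ρ := by positivity
    field_simp
  have hy0 : ∀ a, 0 < a → ∀ i : ℕ, 0 ≤ y a i := fun a ha i => by positivity
  have hyZ : ∀ a, 1 ≤ a → ∀ i ∈ Finset.Ico K ⌈A * a⌉₊, y a i ≤ Z * a⁻¹ := by
    intro a ha i hi
    have ha0 : 0 < a := by linarith
    have hiA : (i : ℝ) < A * a := Nat.lt_ceil.1 (Finset.mem_Ico.1 hi).2
    have h1 : (i : ℝ) / a ≤ A := by rw [div_le_iff₀ ha0]; exact hiA.le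
    have h2 : ((i : ℝ) + 1) / a ≤ A + 1 := by
      rw [add_div]
      exact add_le_add h1 ((div_le_one ha0).2 ha)
    simp only [hy, hZ]
    gcongr
  have hsumy : ∀ a, ∑ i ∈ Finset.Ico K ⌈A * a⌉₊, G ((i + 1) / a) * y a i = R a / (β * ρ) := by
    intro a
    simp only [hR, hy, Finset.mul_sum, Finset.sum_div]
    exact Finset.sum_congr rfl fun i _ => by ring
  have hlow : ∀ a, 1 ≤ a → (1 - Z * a⁻¹) * (R a / (β * ρ)) ≤
      ∑ i ∈ Finset.Ico K ⌈A * a⌉₊, p a i := by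
    intro a ha
    have ha0 : 0 < a := by linarith
    rw [← hsumy, Finset.mul_sum]
    refine Finset.sum_le_sum fun i hi => ?_
    have h1 : 1 ≤ i := hK.trans (Finset.mem_Ico.1 hi).1
    have hi0 : (0 : ℝ) < i := by exact_mod_cast h1
    have h2 := le_meanEmpty hρ (by positivity : 0 ≤ a ^ (ρ + 2) * β) i
    have h3 := hyeq a ha0 i h1
    have h4 := hyZ a ha i hi
    set x := a ^ (ρ + 2) * β * (i : ℝ) ^ (-ρ) * (ρ / (i + 1)) with hx
    have hx0 : 0 < x := by positivity
    rw [← h3] at h4 ⊢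
    have h5 : (1 - x⁻¹) * x⁻¹ ≤ 1 / (1 + x) := by
      rw [le_div_iff₀ (by positivity)]
      have : (1 - x⁻¹) * x⁻¹ * (1 + x) = 1 - x⁻¹ ^ 2 := by field_simp; ring
      rw [this]
      linarith [sq_nonneg x⁻¹]
    have h6 : (1 - Z * a⁻¹) * x⁻¹ ≤ (1 - x⁻¹) * x⁻¹ := by gcongr
    calc (1 - Z * a⁻¹) * (G ((i + 1) / a) * x⁻¹) = G ((i + 1) / a) * ((1 - Z * a⁻¹) * x⁻¹) := by ring
      _ ≤ _ := mul_le_mul_of_nonneg_left (h6.trans (h5.trans h2)) (hG0 _)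
  have hup : ∀ a, 1 ≤ a → ∀ i ∈ Finset.Ico K ⌈A * a⌉₊,
      p a i ≤ Real.exp a⁻¹ * (G ((i + 1) / a) * y a i) + Real.exp (-(c * a)) := by
    intro a ha i hi
    have ha0 : 0 < a := by linarith
    have h1 : 1 ≤ i := hK.trans (Finset.mem_Ico.1 hi).1
    have hi0 : (0 : ℝ) < i := by exact_mod_cast h1
    have hiA : (i : ℝ) < A * a := Nat.lt_ceil.1 (Finset.mem_Ico.1 hi).2
    -- The choice η = 1/a makes e^η tend to 1 while the error exponent, of order a^{ρ+2} i^{-ρ} η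
    -- with i at most of order a, still grows at least like a.
    have h2 := meanEmpty_le hρ (by positivity : 0 < a ^ (ρ + 2) * β) h1 a⁻¹
    rw [div_eq_mul_inv (Real.exp a⁻¹), hyeq a ha0 i h1] at h2
    have h3 : c * a ≤ a ^ (ρ + 2) * β * (i : ℝ) ^ (-ρ) * (a⁻¹ * Real.exp (-a⁻¹)) := by
      have h4 : (A * a) ^ (-ρ) ≤ (i : ℝ) ^ (-ρ) :=
        Real.rpow_le_rpow_of_nonpos hi0 hiA.le (by linarith)
      have h5 : Real.exp (-1) ≤ Real.exp (-a⁻¹) :=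
        Real.exp_le_exp.2 (neg_le_neg (inv_le_one_of_one_le₀ ha))
      calc c * a = a ^ (ρ + 2) * β * (A * a) ^ (-ρ) * (a⁻¹ * Real.exp (-1)) := by
            rw [hc, Real.mul_rpow hA.le ha0.le, Real.rpow_add ha0, Real.rpow_neg ha0.le,
              Real.rpow_two]
            have h2 : 0 < a ^ ρ := by positivity
            field_simp
        _ ≤ _ := by gcongr
    calc p a i ≤ G ((i + 1) / a) * (Real.exp a⁻¹ * y a i + Real.exp (-(c * a))) := by
          refine mul_le_mul_of_nonneg_left (h2.trans ?_) (hG0 _)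
          gcongr
      _ ≤ _ := by
          rw [mul_add]
          refine add_le_add (le_of_eq (by ring)) (mul_le_of_le_one_left (Real.exp_pos _).le (hG1 _))
  have hupsum : ∀ a, 1 ≤ a → ∑ i ∈ Finset.Ico K ⌈A * a⌉₊, p a i ≤
      Real.exp a⁻¹ * (R a / (β * ρ)) + (A * a + 1) * Real.exp (-(c * a)) := by
    intro a ha
    have ha0 : 0 < a := by linarith
    refine (Finset.sum_le_sum (hup a ha)).trans ?_
    rw [Finset.sum_add_distrib, ← Finset.mul_sum, hsumy, Finset.sum_const, nsmul_eq_mul]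
    gcongr
    have h1 : ((Finset.Ico K ⌈A * a⌉₊).card : ℝ) ≤ ⌈A * a⌉₊ := by
      rw [Nat.card_Ico]
      exact_mod_cast Nat.sub_le _ _
    exact h1.trans (Nat.ceil_lt_add_one (by positivity)).le
  have hexp : Tendsto (fun a : ℝ => (A * a + 1) * Real.exp (-(c * a))) atTop (𝓝 0) := by
    have h1 := Real.tendsto_pow_mul_exp_neg_atTop_nhds_zero 1
    have h2 : Tendsto (fun a : ℝ => c * a) atTop atTop := tendsto_id.const_mul_atTop hc0
    have h3 := (h1.comp h2).const_mul (A / c)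
    have h4 := Real.tendsto_exp_neg_atTop_nhds_zero.comp h2
    have h5 := h3.add h4
    simp only [mul_zero, add_zero] at h5
    refine h5.congr fun a => ?_
    simp only [Function.comp_apply]
    field_simp
  have hexp' : Tendsto (fun a : ℝ => Real.exp (-(c * a))) atTop (𝓝 0) :=
    Real.tendsto_exp_neg_atTop_nhds_zero.comp (tendsto_id.const_mul_atTop hc0)
  have hinv : Tendsto (fun a : ℝ => Z * a⁻¹) atTop (𝓝 0) := by
    simpa using (tendsto_inv_atTop_zero (𝕜 := ℝ)).const_mul Z
  have hRlim' : Tendsto (fun a => R a / (β * ρ)) atTop (𝓝 (I / (β * ρ))) := hRlim.div_const _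
  have hsum : Tendsto (fun a => ∑ i ∈ Finset.Ico K ⌈A * a⌉₊, p a i) atTop
      (𝓝 (I / (β * ρ))) := by
    refine tendsto_of_tendsto_of_tendsto_of_le_of_le' (g := fun a => (1 - Z * a⁻¹) * (R a / (β * ρ)))
      (h := fun a => Real.exp a⁻¹ * (R a / (β * ρ)) + (A * a + 1) * Real.exp (-(c * a))) ?_ ?_
      ((eventually_ge_atTop 1).mono hlow) ((eventually_ge_atTop 1).mono hupsum)
    · simpa using (hinv.const_sub 1).mul hRlim'
    · have h1 : Tendsto (fun a : ℝ => Real.exp a⁻¹) atTop (𝓝 1) := by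
        simpa [Function.comp_def] using
          (Real.continuous_exp.tendsto 0).comp (tendsto_inv_atTop_zero (𝕜 := ℝ))
      simpa using (h1.mul hRlim').add hexp
  set ε : ℝ → ℝ := fun a => Real.exp 1 * (Z * a⁻¹) + Real.exp (-(c * a)) with hε
  have hεlim : Tendsto ε atTop (𝓝 0) := by
    simpa using (hinv.const_mul (Real.exp 1)).add hexp'
  have hpε : ∀ a, 1 ≤ a → ∀ i ∈ Finset.Ico K ⌈A * a⌉₊, p a i ≤ ε a := by
    intro a ha i hi
    have ha0 : 0 < a := by linarith
    refine (hup a ha i hi).trans ?_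
    simp only [hε]
    have h1 := hyZ a ha i hi
    have h2 : G ((i + 1) / a) * y a i ≤ Z * a⁻¹ :=
      (mul_le_of_le_one_left (hy0 a ha0 i) (hG1 _)).trans h1
    have h3 : a⁻¹ ≤ 1 := inv_le_one_of_one_le₀ ha
    have h4 : 0 ≤ G ((i + 1) / a) * y a i := mul_nonneg (hG0 _) (hy0 a ha0 i)
    gcongr
  refine tendsto_of_tendsto_of_tendsto_of_le_of_le'
    (g := fun a => Real.exp (-((∑ i ∈ Finset.Ico K ⌈A * a⌉₊, p a i) / (1 - ε a))))
    (h := fun a => Real.exp (-∑ i ∈ Finset.Ico K ⌈A * a⌉₊, p a i)) ?_ ?_ ?_ ?_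
  · refine (Real.continuous_exp.tendsto _).comp ?_
    have := hsum.div (hεlim.const_sub 1) (by norm_num)
    simpa using this.neg
  · exact (Real.continuous_exp.tendsto _).comp hsum.neg
  · filter_upwards [eventually_ge_atTop 1, hεlim.eventually_lt_const one_pos] with a ha h1
    exact le_prod_one_sub _ h1 (fun i _ => hp0 a i) (hpε a ha)
  · filter_upwards [eventually_ge_atTop 1, hεlim.eventually_lt_const one_pos] with a ha h1
    exact prod_one_sub_le _ fun i hi => (hpε a ha i hi).trans h1.le

/-! ### Comparison with independent bins -/

lemma one_sub_sum_le_prod {ι : Type*} (s : Finset ι) {p : ι → ℝ} (h0 : ∀ i ∈ s, 0 ≤ p i)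
    (h1 : ∀ i ∈ s, p i ≤ 1) : 1 - ∑ i ∈ s, p i ≤ ∏ i ∈ s, (1 - p i) := by
  induction s using Finset.cons_induction with
  | empty => simp
  | cons i s hi ih =>
    rw [Finset.sum_cons, Finset.prod_cons]
    have h2 := ih (fun j hj => h0 j (Finset.mem_cons_of_mem hj))
      fun j hj => h1 j (Finset.mem_cons_of_mem hj)
    have h3 : ∏ j ∈ s, (1 - p j) ≤ 1 := Finset.prod_le_one
      (fun j hj => by linarith [h1 j (Finset.mem_cons_of_mem hj)])
      fun j hj => by linarith [h0 j (Finset.mem_cons_of_mem hj)]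
    nlinarith [h0 i (Finset.mem_cons_self i s)]

lemma measurable_meanEmpty (ρ : ℝ) (i : ℕ) : Measurable fun l => meanEmpty ρ l i := by
  have := isProbabilityMeasure_expMeasure one_pos
  have h : Measurable fun p : ℝ × ℝ =>
      Real.exp (-(p.1 * (i : ℝ) ^ (-ρ) * (1 - Real.exp (-(ρ * p.2 / (i + 1)))))) := by fun_prop
  exact (h.stronglyMeasurable.integral_prod_right' (ν := expMeasure 1)).measurable

/-- The product over the bins of index in `[K, N)` when the split times are replaced by
`log i + z`. -/
def indepProd (ρ : ℝ) (h : ℕ → ℝ) (K N : ℕ) (l z : ℝ) (e : ℕ → ℝ) : ℝ :=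
  ∏ i ∈ Finset.Ico K N, (1 - h i * Real.exp (-(l * Real.exp (-(ρ * z)) * (i : ℝ) ^ (-ρ) *
    (1 - Real.exp (-(ρ * e i / (i + 1)))))))

section

variable {ρ : ℝ} {h : ℕ → ℝ}

lemma exp_factor_mem (hρ : 0 < ρ) {l : ℝ} (hl : 0 ≤ l) {e : ℝ} (he : 0 ≤ e) (i : ℕ) :
    Real.exp (-(l * (i : ℝ) ^ (-ρ) * (1 - Real.exp (-(ρ * e / (i + 1)))))) ≤ 1 := by
  rw [Real.exp_le_one_iff, neg_nonpos]
  refine mul_nonneg (by positivity) (sub_nonneg.2 (Real.exp_le_one_iff.2 (neg_nonpos.2 ?_)))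
  positivity

lemma indepProd_mem (hρ : 0 < ρ) (h0 : ∀ i, 0 ≤ h i) (h1 : ∀ i, h i ≤ 1) (K N : ℕ) {l : ℝ}
    (hl : 0 ≤ l) (z : ℝ) {e : ℕ → ℝ} (he : ∀ i, 0 < e i) :
    0 ≤ indepProd ρ h K N l z e ∧ indepProd ρ h K N l z e ≤ 1 := by
  have hf : ∀ i : ℕ, Real.exp (-(l * Real.exp (-(ρ * z)) * (i : ℝ) ^ (-ρ) *
    (1 - Real.exp (-(ρ * e i / (i + 1)))))) ≤ 1 := fun i =>
    exp_factor_mem hρ (by positivity) (he i).le i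
  exact ⟨Finset.prod_nonneg fun i _ => (factor_mem (h0 i) (h1 i) (Real.exp_pos _).le (hf i)).1,
    Finset.prod_le_one (fun i _ => (factor_mem (h0 i) (h1 i) (Real.exp_pos _).le (hf i)).1)
      fun i _ => (factor_mem (h0 i) (h1 i) (Real.exp_pos _).le (hf i)).2⟩

end

lemma ae_forall_pos {Ω : Type*} [MeasurableSpace Ω] {P : Measure Ω} {E : ℕ → Ω → ℝ} {r : ℝ} (hElaw : ∀ i, HasLaw (E i) (expMeasure r) P) :
    ∀ᵐ ω ∂P, ∀ i, 0 < E i ω := by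
  refine ae_all_iff.2 fun i => ?_
  have h := ae_pos_expMeasure r
  rw [← (hElaw i).map_eq] at h
  exact ae_of_ae_map (hElaw i).aemeasurable h

section Pointwise

variable {Ω : Type*} {E : ℕ → Ω → ℝ} {ω : Ω}

lemma splitTime_mono (hω : ∀ i, 0 < E i ω) : Monotone fun i => splitTime E i ω := by
  refine monotone_nat_of_le_succ fun i => ?_
  simp only [splitTime, Finset.sum_range_succ]
  have := hω i
  exact le_add_of_nonneg_right (by positivity)

lemma splitTime_lt (hω : ∀ i, 0 < E i ω) (i : ℕ) :
    splitTime E i ω < splitTime E (i + 1) ω := by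
  simp only [splitTime, Finset.sum_range_succ]
  have := hω i
  exact lt_add_of_pos_right _ (by positivity)

/-- The mass of a bin splits into a factor depending on the past through M_i and a factor depending
on `E i` alone. Once M_i is frozen, the bins become independent. -/
lemma exp_splitTime_sub (ρ : ℝ) {i : ℕ} (hi : 1 ≤ i) :
    Real.exp (-(ρ * splitTime E i ω)) - Real.exp (-(ρ * splitTime E (i + 1) ω)) =
      Real.exp (-(ρ * M E i ω)) * (i : ℝ) ^ (-ρ) * (1 - Real.exp (-(ρ * E i ω / (i + 1)))) := by
  have hi0 : (0 : ℝ) < i := by exact_mod_cast hi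
  have h1 : splitTime E i ω = M E i ω + Real.log i := by simp [M]
  have h2 : splitTime E (i + 1) ω = splitTime E i ω + E i ω / (i + 1) := by
    simp [splitTime, Finset.sum_range_succ]
  rw [h2, h1, Real.rpow_def_of_pos hi0, mul_sub, mul_one, ← Real.exp_add, ← Real.exp_add]
  congr 2 <;> ring

/-- The event that `M` moves by more than `δ` after time `K`. -/
def oscEvent (E : ℕ → Ω → ℝ) (δ : ℝ) (K : ℕ) : Set Ω :=
  ⋃ i ∈ Set.Ici K, {ω | δ < |M E i ω - M E K ω|}

lemma poissonProd_mem {ρ : ℝ} (hρ : 0 < ρ) {h : ℕ → ℝ} (h0 : ∀ i, 0 ≤ h i) (h1 : ∀ i, h i ≤ 1)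
    (N : ℕ) {t : ℕ → ℝ} (ht : Monotone t) {l : ℝ} (hl : 0 ≤ l) :
    0 ≤ poissonProd ρ h N t l ∧ poissonProd ρ h N t l ≤ 1 := by
  have hf : ∀ i, Real.exp (-(l * (Real.exp (-(ρ * t i)) - Real.exp (-(ρ * t (i + 1)))))) ≤ 1 := by
    intro i
    rw [Real.exp_le_one_iff, neg_nonpos]
    refine mul_nonneg hl (sub_nonneg.2 (Real.exp_le_exp.2 (neg_le_neg ?_)))
    exact mul_le_mul_of_nonneg_left (ht i.le_succ) hρ.le
  exact ⟨Finset.prod_nonneg fun i _ => (factor_mem (h0 i) (h1 i) (Real.exp_pos _).le (hf i)).1,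
    Finset.prod_le_one (fun i _ => (factor_mem (h0 i) (h1 i) (Real.exp_pos _).le (hf i)).1)
      fun i _ => (factor_mem (h0 i) (h1 i) (Real.exp_pos _).le (hf i)).2⟩

variable {ρ : ℝ} {h : ℕ → ℝ} {K N : ℕ} {l δ : ℝ}

/-- Without oscillation M_i ≥ M_K - δ, so lowering M_i to that value enlarges the bin masses and
makes emptiness less likely. The first K factors are at most 1 and are dropped. -/
lemma poissonProd_le_indepProd (hρ : 0 < ρ) (h0 : ∀ i, 0 ≤ h i) (h1 : ∀ i, h i ≤ 1)
    (hK : 1 ≤ K) (hKN : K ≤ N) (hl : 0 ≤ l) (hω : ∀ i, 0 < E i ω) (hosc : ω ∉ oscEvent E δ K) :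
    poissonProd ρ h N (fun i => splitTime E i ω) l ≤
      indepProd ρ h K N l (M E K ω - δ) fun i => E i ω := by
  have hmem := fun N => poissonProd_mem hρ h0 h1 N (splitTime_mono hω) hl
  have hsplit := Finset.prod_range_mul_prod_Ico (fun i => 1 - h i *
    Real.exp (-(l * (Real.exp (-(ρ * splitTime E i ω)) -
      Real.exp (-(ρ * splitTime E (i + 1) ω)))))) hKN
  have hle : ∀ i ∈ Finset.Ico K N, 1 - h i *
    Real.exp (-(l * (Real.exp (-(ρ * splitTime E i ω)) -
      Real.exp (-(ρ * splitTime E (i + 1) ω))))) ≤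
      1 - h i * Real.exp (-(l * Real.exp (-(ρ * (M E K ω - δ))) * (i : ℝ) ^ (-ρ) *
    (1 - Real.exp (-(ρ * E i ω / (i + 1)))))) := by
    intro i hi
    have hKi := (Finset.mem_Ico.1 hi).1
    have hM : |M E i ω - M E K ω| ≤ δ := by
      by_contra hlt
      exact hosc (Set.mem_biUnion (Set.mem_Ici.2 hKi) (not_le.1 hlt))
    have hE0 := hω i
    have hz : 0 ≤ 1 - Real.exp (-(ρ * E i ω / (i + 1))) :=
      sub_nonneg.2 (Real.exp_le_one_iff.2 (neg_nonpos.2 (by positivity)))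
    refine sub_le_sub_left (mul_le_mul_of_nonneg_left (Real.exp_le_exp.2 (neg_le_neg ?_)) (h0 i)) 1
    rw [exp_splitTime_sub ρ (hK.trans hKi), mul_assoc l, mul_assoc l]
    refine mul_le_mul_of_nonneg_left ?_ hl
    gcongr
    linarith [(abs_le.1 hM).1]
  have hpos : ∀ i, 0 ≤ 1 - h i *
    Real.exp (-(l * (Real.exp (-(ρ * splitTime E i ω)) -
      Real.exp (-(ρ * splitTime E (i + 1) ω))))) := by
    intro i
    have hlt := (splitTime_lt hω i).le
    refine (factor_mem (h0 i) (h1 i) (Real.exp_pos _).le ?_).1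
    rw [Real.exp_le_one_iff, neg_nonpos]
    refine mul_nonneg hl (sub_nonneg.2 (Real.exp_le_exp.2 (neg_le_neg ?_)))
    exact mul_le_mul_of_nonneg_left hlt hρ.le
  calc poissonProd ρ h N (fun i => splitTime E i ω) l
      = poissonProd ρ h K (fun i => splitTime E i ω) l * _ := hsplit.symm
    _ ≤ 1 * indepProd ρ h K N l (M E K ω - δ) fun i => E i ω :=
        mul_le_mul (hmem K).2 (Finset.prod_le_prod (fun i _ => hpos i) hle)
          (Finset.prod_nonneg fun i _ => hpos i) zero_le_one
    _ = _ := one_mul _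

/-- Here M_i ≤ M_K + δ gives the opposite comparison. The first K factors can no longer be dropped;
their product is at least 1 minus the sum of the emptiness probabilities, which is the additional
term. -/
lemma indepProd_le_poissonProd (hρ : 0 < ρ) (h0 : ∀ i, 0 ≤ h i) (h1 : ∀ i, h i ≤ 1)
    (hK : 1 ≤ K) (hKN : K ≤ N) (hl : 0 ≤ l) (hω : ∀ i, 0 < E i ω) (hosc : ω ∉ oscEvent E δ K) :
    indepProd ρ h K N l (M E K ω + δ) (fun i => E i ω) ≤
      poissonProd ρ h N (fun i => splitTime E i ω) l + ∑ i ∈ Finset.range K,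
        Real.exp (-(l * (Real.exp (-(ρ * splitTime E i ω)) -
          Real.exp (-(ρ * splitTime E (i + 1) ω))))) := by
  set q : ℕ → ℝ := fun i => Real.exp (-(l * (Real.exp (-(ρ * splitTime E i ω)) -
          Real.exp (-(ρ * splitTime E (i + 1) ω))))) with hq
  have hq0 : ∀ i, 0 ≤ q i := fun i => (Real.exp_pos _).le
  have hq1 : ∀ i, q i ≤ 1 := by
    intro i
    have hlt := (splitTime_lt hω i).le
    rw [hq, Real.exp_le_one_iff, neg_nonpos]
    refine mul_nonneg hl (sub_nonneg.2 (Real.exp_le_exp.2 (neg_le_neg ?_)))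
    exact mul_le_mul_of_nonneg_left hlt hρ.le
  have hsplit := Finset.prod_range_mul_prod_Ico (fun i => 1 - h i * q i) hKN
  have hle : ∀ i ∈ Finset.Ico K N,
      1 - h i * Real.exp (-(l * Real.exp (-(ρ * (M E K ω + δ))) * (i : ℝ) ^ (-ρ) *
    (1 - Real.exp (-(ρ * E i ω / (i + 1)))))) ≤ 1 - h i * q i := by
    intro i hi
    have hKi := (Finset.mem_Ico.1 hi).1
    have hM : |M E i ω - M E K ω| ≤ δ := by
      by_contra hlt
      exact hosc (Set.mem_biUnion (Set.mem_Ici.2 hKi) (not_le.1 hlt))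
    have hE0 := hω i
    have hz : 0 ≤ 1 - Real.exp (-(ρ * E i ω / (i + 1))) :=
      sub_nonneg.2 (Real.exp_le_one_iff.2 (neg_nonpos.2 (by positivity)))
    refine sub_le_sub_left (mul_le_mul_of_nonneg_left (Real.exp_le_exp.2 (neg_le_neg ?_)) (h0 i)) 1
    rw [exp_splitTime_sub ρ (hK.trans hKi), mul_assoc l, mul_assoc l]
    refine mul_le_mul_of_nonneg_left ?_ hl
    gcongr
    linarith [(abs_le.1 hM).2]
  have hmem := indepProd_mem hρ h0 h1 K N hl (M E K ω + δ) hω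
  have hle' : indepProd ρ h K N l (M E K ω + δ) (fun i => E i ω) ≤
      ∏ i ∈ Finset.Ico K N, (1 - h i * q i) := by
    refine Finset.prod_le_prod (fun i _ => ?_) hle
    exact (factor_mem (h0 i) (h1 i) (Real.exp_pos _).le
      (exp_factor_mem hρ (by positivity) (hω i).le i)).1
  have hfirst : 1 - ∑ i ∈ Finset.range K, q i ≤ ∏ i ∈ Finset.range K, (1 - h i * q i) := by
    refine le_trans ?_ (one_sub_sum_le_prod _ (fun i _ => mul_nonneg (h0 i) (hq0 i))
      fun i _ => mul_le_one₀ (h1 i) (hq0 i) (hq1 i))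
    exact sub_le_sub_left (Finset.sum_le_sum fun i _ => mul_le_of_le_one_left (hq0 i) (h1 i)) 1
  have hle1 : ∏ i ∈ Finset.Ico K N, (1 - h i * q i) ≤ 1 :=
    Finset.prod_le_one (fun i _ => (factor_mem (h0 i) (h1 i) (hq0 i) (hq1 i)).1)
      fun i _ => (factor_mem (h0 i) (h1 i) (hq0 i) (hq1 i)).2
  have hge0 : 0 ≤ ∏ i ∈ Finset.Ico K N, (1 - h i * q i) :=
    Finset.prod_nonneg fun i _ => (factor_mem (h0 i) (h1 i) (hq0 i) (hq1 i)).1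
  have hsum0 : 0 ≤ ∑ i ∈ Finset.range K, q i := Finset.sum_nonneg fun i _ => hq0 i
  have hdef : poissonProd ρ h N (fun i => splitTime E i ω) l =
      ∏ i ∈ Finset.range N, (1 - h i * q i) := rfl
  rw [hdef, ← hsplit]
  nlinarith

end Pointwise

/-! ### Averaging over the split times -/

section Yule

variable {Ω : Type*} [MeasurableSpace Ω] {P : Measure Ω} [IsProbabilityMeasure P]
  {E : ℕ → Ω → ℝ}

lemma measurable_splitTime (hE : ∀ i, Measurable (E i)) (i : ℕ) : Measurable (splitTime E i) := by
  unfold splitTime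
  fun_prop

lemma measurable_M (hE : ∀ i, Measurable (E i)) (i : ℕ) : Measurable (M E i) :=
  (measurable_splitTime hE i).sub_const _

/-- Conditionally on the first K variables, ψ is a constant and the later variables are still
i.i.d., so the mean of the product factorizes. -/
lemma integral_prod_Ico_of_iIndepFun {ν : Measure ℝ} [IsProbabilityMeasure ν]
    (hE : ∀ i, Measurable (E i)) (hElaw : ∀ i, HasLaw (E i) ν P) (hEind : iIndepFun E P)
    {K N : ℕ} {ψ : (Finset.range K → ℝ) → ℝ} (hψ : Measurable ψ) {w : ℕ → ℝ × ℝ → ℝ}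
    (hw : ∀ i, Measurable (w i)) (hw0 : ∀ i p, 0 ≤ w i p) (hw1 : ∀ i p, w i p ≤ 1) :
    ∫ ω, ∏ i ∈ Finset.Ico K N, w i (ψ (fun j => E j ω), E i ω) ∂P =
      ∫ ω, ∏ i ∈ Finset.Ico K N, ∫ u, w i (ψ (fun j => E j ω), u) ∂ν ∂P := by
  let Z : Ω → ℝ := fun ω => ψ fun j => E j ω
  let X : Ω → Finset.Ico K N → ℝ := fun ω i => E i ω
  have hZ : Measurable Z := hψ.comp (measurable_pi_iff.2 fun j => hE j)
  have hX : HasLaw X (Measure.pi fun _ => ν) P :=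
    iIndepFun.hasLaw_pi (fun i => hElaw i) (hEind.precomp Subtype.val_injective)
  have hind : IndepFun Z X P :=
    (hEind.indepFun_finset (Finset.range K) (Finset.Ico K N) (by
      rw [Finset.disjoint_left]
      intro i hi hi'
      simp only [Finset.mem_range, Finset.mem_Ico] at hi hi'
      omega) hE).comp hψ measurable_id
  let Φ : ℝ × (Finset.Ico K N → ℝ) → ℝ := fun p => ∏ i : Finset.Ico K N, w i (p.1, p.2 i)
  have hΦ : Measurable Φ := by
    refine Finset.measurable_prod _ fun i _ => (hw i).comp ?_
    fun_prop
  have hΦ1 : ∀ p, |Φ p| ≤ 1 := fun p => by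
    rw [abs_of_nonneg (Finset.prod_nonneg fun _ _ => hw0 _ _)]
    exact Finset.prod_le_one (fun _ _ => hw0 _ _) fun _ _ => hw1 _ _
  have h := integral_comp_of_indepFun hZ.aemeasurable hX hind hΦ hΦ1
  have h1 : ∀ ω, Φ (Z ω, X ω) = ∏ i ∈ Finset.Ico K N, w i (ψ (fun j => E j ω), E i ω) := fun ω =>
    Finset.prod_coe_sort (Finset.Ico K N) fun i => w i (ψ (fun j => E j ω), E i ω)
  have h2 : ∀ ω, ∫ x, Φ (Z ω, x) ∂(Measure.pi fun _ : Finset.Ico K N => ν) =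
      ∏ i ∈ Finset.Ico K N, ∫ u, w i (ψ (fun j => E j ω), u) ∂ν := by
    intro ω
    rw [← Finset.prod_coe_sort (Finset.Ico K N)]
    exact integral_fintype_prod_eq_prod (fun (i : Finset.Ico K N) u => w i (Z ω, u))
  simpa only [h1, h2] using h

lemma integral_indepProd (hE : ∀ i, Measurable (E i))
    (hElaw : ∀ i, HasLaw (E i) (expMeasure 1) P) (hEind : iIndepFun E P) {ρ : ℝ} (hρ : 0 < ρ)
    {h : ℕ → ℝ} (h0 : ∀ i, 0 ≤ h i) (h1 : ∀ i, h i ≤ 1) (K N : ℕ) {l : ℝ} (hl : 0 ≤ l) (d : ℝ) :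
    ∫ ω, indepProd ρ h K N l (M E K ω + d) (fun i => E i ω) ∂P =
      ∫ ω, ∏ i ∈ Finset.Ico K N,
        (1 - h i * meanEmpty ρ (l * Real.exp (-(ρ * (M E K ω + d)))) i) ∂P := by
  have := isProbabilityMeasure_expMeasure one_pos
  let ψ : (Finset.range K → ℝ) → ℝ := fun x => ∑ j : Finset.range K, x j / ((j : ℝ) + 1) - Real.log K
  have hψ : Measurable ψ := by fun_prop
  have hM : ∀ ω, ψ (fun j => E j ω) = M E K ω := fun ω => by
    simp only [ψ, M, splitTime]
    rw [Finset.sum_coe_sort (Finset.range K) fun j => E j ω / ((j : ℝ) + 1)]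
  -- The truncation `max p.2 0` keeps w in [0, 1] everywhere and changes nothing almost surely.
  let w : ℕ → ℝ × ℝ → ℝ := fun i p => 1 - h i * Real.exp (-(l * Real.exp (-(ρ * (p.1 + d))) *
    (i : ℝ) ^ (-ρ) * (1 - Real.exp (-(ρ * max p.2 0 / (i + 1))))))
  have hw : ∀ i, Measurable (w i) := fun i => by fun_prop
  have hmem : ∀ i p, 0 ≤ w i p ∧ w i p ≤ 1 := fun i p =>
    factor_mem (h0 i) (h1 i) (Real.exp_pos _).le
      (exp_factor_mem hρ (by positivity) (le_max_right _ _) i)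
  have key := integral_prod_Ico_of_iIndepFun hE hElaw hEind (K := K) (N := N) hψ hw
    (fun i p => (hmem i p).1) fun i p => (hmem i p).2
  simp only [hM] at key
  refine Eq.trans (integral_congr_ae ?_) (key.trans (integral_congr_ae (ae_of_all _ fun ω => ?_)))
  · filter_upwards [ae_forall_pos hElaw] with ω hω
    refine Finset.prod_congr rfl fun i _ => ?_
    simp only [w, max_eq_left (hω i).le]
  · refine Finset.prod_congr rfl fun i _ => ?_
    have h2 : ∫ u, w i (M E K ω, u) ∂expMeasure 1 = ∫ u, (1 - h i *
        Real.exp (-(l * Real.exp (-(ρ * (M E K ω + d))) * (i : ℝ) ^ (-ρ) *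
          (1 - Real.exp (-(ρ * u / (i + 1))))))) ∂expMeasure 1 := by
      refine integral_congr_ae ?_
      filter_upwards [ae_pos_expMeasure 1] with u hu
      simp only [w, max_eq_left hu.le]
    rw [h2, integral_sub (integrable_const _)
      ((integrable_meanEmpty hρ (by positivity) i).const_mul _), integral_const_mul]
    simp [meanEmpty]

lemma meanEmpty_le_one {ρ l : ℝ} (hρ : 0 < ρ) (hl : 0 ≤ l) (i : ℕ) : meanEmpty ρ l i ≤ 1 := by
  have := isProbabilityMeasure_expMeasure one_pos
  refine (integral_mono_ae (integrable_meanEmpty hρ hl i) (integrable_const 1) ?_).trans_eq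
    (by simp)
  filter_upwards [ae_pos_expMeasure 1] with u hu
  exact exp_factor_mem hρ hl hu.le i

/-- The Laplace functional of the limit, given `M_∞ = m`. -/
def condLaplace (ρ I m : ℝ) : ℝ := Real.exp (-(I / (Real.exp (-(ρ * m)) * ρ)))

lemma continuous_condLaplace {ρ : ℝ} (hρ : 0 < ρ) (I : ℝ) : Continuous (condLaplace ρ I) := by
  unfold condLaplace
  refine Real.continuous_exp.comp (Continuous.neg (continuous_const.div (by fun_prop) fun m => ?_))
  positivity

lemma abs_condLaplace_le {ρ : ℝ} (hρ : 0 < ρ) {I : ℝ} (hI : 0 ≤ I) (m : ℝ) :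
    ‖condLaplace ρ I m‖ ≤ 1 := by
  rw [condLaplace, Real.norm_of_nonneg (Real.exp_pos _).le, Real.exp_le_one_iff, neg_nonpos]
  positivity

/-- With K fixed, M_K does not vary with n: `tendsto_prod_meanEmpty` applies for each ω with β =
e^{-ρ(M_K + d)}, and all products lie in [0, 1]. -/
lemma tendsto_integral_indepProd (hE : ∀ i, Measurable (E i))
    (hElaw : ∀ i, HasLaw (E i) (expMeasure 1) P) (hEind : iIndepFun E P) {ρ : ℝ} (hρ : 0 < ρ)
    {G : ℝ → ℝ} (hG : Continuous G) (hG0 : ∀ x, 0 ≤ G x) (hG1 : ∀ x, G x ≤ 1) {A : ℝ}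
    (hA : 0 < A) (hGA : ∀ x, A ≤ x → G x = 0) {K : ℕ} (hK : 1 ≤ K) (d : ℝ) {a : ℕ → ℝ}
    (ha0 : ∀ n, 0 ≤ a n) (ha : Tendsto a atTop atTop) :
    Tendsto (fun n => ∫ ω, indepProd ρ (fun i => G ((i + 1) / a n)) K ⌈A * a n⌉₊
        (a n ^ (ρ + 2)) (M E K ω + d) (fun i => E i ω) ∂P) atTop
      (𝓝 (∫ ω, condLaplace ρ (∫ x in Set.Ici (0 : ℝ), G x * x ^ (ρ + 1)) (M E K ω + d) ∂P)) := by
  have hl : ∀ n, 0 ≤ a n ^ (ρ + 2) := fun n => Real.rpow_nonneg (ha0 n) _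
  simp_rw [fun n => integral_indepProd hE hElaw hEind hρ (h := fun i => G ((i + 1) / a n))
    (fun _ => hG0 _) (fun _ => hG1 _) K ⌈A * a n⌉₊ (hl n) d]
  have hMm := measurable_M hE K
  have hfac : ∀ n (ω : Ω) (i : ℕ), 0 ≤ 1 - G ((i + 1) / a n) *
      meanEmpty ρ (a n ^ (ρ + 2) * Real.exp (-(ρ * (M E K ω + d)))) i ∧
      1 - G ((i + 1) / a n) *
      meanEmpty ρ (a n ^ (ρ + 2) * Real.exp (-(ρ * (M E K ω + d)))) i ≤ 1 := fun n ω i =>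
    factor_mem (hG0 _) (hG1 _) (meanEmpty_nonneg _ _ _)
      (meanEmpty_le_one hρ (mul_nonneg (hl n) (Real.exp_pos _).le) i)
  refine tendsto_integral_of_dominated_convergence (fun _ => 1) (fun n => ?_)
    (integrable_const _) (fun n => ae_of_all _ fun ω => ?_) (ae_of_all _ fun ω => ?_)
  · refine (Finset.measurable_prod _ fun i _ => ?_).aestronglyMeasurable
    exact ((measurable_meanEmpty ρ i).comp (by fun_prop)).const_mul _ |>.const_sub 1
  · rw [Real.norm_of_nonneg (Finset.prod_nonneg fun i _ => (hfac n ω i).1)]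
    exact Finset.prod_le_one (fun i _ => (hfac n ω i).1) fun i _ => (hfac n ω i).2
  · exact (tendsto_prod_meanEmpty hρ hG hG0 hG1 hA hGA hK (Real.exp_pos _)).comp ha

lemma measurableSet_oscEvent (hE : ∀ i, Measurable (E i)) (δ : ℝ) (K : ℕ) :
    MeasurableSet (oscEvent E δ K) :=
  MeasurableSet.biUnion (Set.to_countable _) fun i _ => measurableSet_lt measurable_const
    (((measurable_M hE i).sub (measurable_M hE K)).abs)

/-- A convergent trajectory is Cauchy, so it leaves the oscillation events for all large K. -/
lemma tendsto_measure_oscEvent (hE : ∀ i, Measurable (E i)) {m : Ω → ℝ}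
    (hM : ∀ᵐ ω ∂P, Tendsto (fun n => M E n ω) atTop (𝓝 (m ω))) {δ : ℝ} (hδ : 0 < δ) :
    Tendsto (fun K => P.real (oscEvent E δ K)) atTop (𝓝 0) := by
  have h : Tendsto (fun K => P (oscEvent E δ K)) atTop (𝓝 (P ∅)) := by
    refine tendsto_measure_of_ae_tendsto_indicator_of_isFiniteMeasure atTop MeasurableSet.empty
      (measurableSet_oscEvent hE δ) ?_
    filter_upwards [hM] with ω hω
    obtain ⟨N, hN⟩ := Metric.cauchySeq_iff.1 hω.cauchySeq δ hδ
    filter_upwards [eventually_ge_atTop N] with K hK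
    simp only [oscEvent, Set.mem_iUnion, Set.mem_empty_iff_false, iff_false, not_exists]
    intro i hi hlt
    exact absurd (hN i (hK.trans hi) K hK) (not_lt.2 (le_of_lt hlt))
  have h2 := (ENNReal.tendsto_toReal (measure_ne_top P ∅)).comp h
  simpa [Measure.real, Function.comp_def] using h2

end Yule

/-! ### Convergence of the Laplace functionals -/

/-- A factor e^{ρδ} on the number of balls amounts to a shift of the split times by -δ, so the
errors of de-Poissonization and of freezing add up. -/
lemma indepProd_shift (ρ : ℝ) (h : ℕ → ℝ) (K N : ℕ) (l z δ : ℝ) (e : ℕ → ℝ) :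
    indepProd ρ h K N (Real.exp (ρ * δ) * l) z e = indepProd ρ h K N l (z - δ) e := by
  have : Real.exp (ρ * δ) * l * Real.exp (-(ρ * z)) = l * Real.exp (-(ρ * (z - δ))) := by
    rw [mul_comm _ l, mul_assoc, ← Real.exp_add]
    ring_nf
  simp only [indepProd, this]

lemma tendsto_poisson_tail {κ : ℝ} (hκ : 0 < κ) (hκ1 : κ ≠ 1) :
    Tendsto (fun n : ℕ => Real.exp (-(n * (κ - 1 - Real.log κ)))) atTop (𝓝 0) := by
  have h : 0 < κ - 1 - Real.log κ := sub_pos.2 (Real.log_lt_sub_one_of_pos hκ hκ1)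
  exact Real.tendsto_exp_neg_atTop_nhds_zero.comp
    (tendsto_natCast_atTop_atTop.atTop_mul_const h)

/-- A bound for the expected number of empty bins among the first `K` bins. -/
def firstBins {Ω : Type*} (ρ : ℝ) (E : ℕ → Ω → ℝ) (K : ℕ) (l : ℝ) (ω : Ω) : ℝ :=
  ∑ i ∈ Finset.range K, Real.exp (-(l * (Real.exp (-(ρ * splitTime E i ω)) -
          Real.exp (-(ρ * splitTime E (i + 1) ω)))))

lemma norm_firstBins_le {Ω : Type*} {E : ℕ → Ω → ℝ} {ρ : ℝ} (hρ : 0 < ρ) (K : ℕ) {l : ℝ} (hl : 0 ≤ l) {ω : Ω}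
    (hω : ∀ i, 0 < E i ω) : ‖firstBins ρ E K l ω‖ ≤ K := by
  rw [firstBins, Real.norm_of_nonneg (Finset.sum_nonneg fun _ _ => (Real.exp_pos _).le)]
  refine (Finset.sum_le_card_nsmul _ _ 1 fun i _ => ?_).trans_eq (by simp)
  rw [Real.exp_le_one_iff, neg_nonpos]
  refine mul_nonneg hl (sub_nonneg.2 (Real.exp_le_exp.2 (neg_le_neg ?_)))
  exact mul_le_mul_of_nonneg_left (splitTime_lt hω i).le hρ.le

section

variable {Ω : Type*} [MeasurableSpace Ω] {P : Measure Ω} [IsProbabilityMeasure P]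
  {E B : ℕ → Ω → ℝ} {ρ : ℝ} {h : ℕ → ℝ}

lemma integrable_of_ae_mem {f : Ω → ℝ} (hf : Measurable f) (h : ∀ᵐ ω ∂P, 0 ≤ f ω ∧ f ω ≤ 1) :
    Integrable f P :=
  Integrable.of_bound hf.aestronglyMeasurable 1
    (h.mono fun ω hω => by rw [Real.norm_of_nonneg hω.1]; exact hω.2)

lemma measurable_indepProd (hE : ∀ i, Measurable (E i)) (K N : ℕ) (l d : ℝ) :
    Measurable fun ω => indepProd ρ h K N l (M E K ω + d) fun i => E i ω := by
  have := measurable_M hE K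
  unfold indepProd
  fun_prop

lemma integral_emptyProd_eq (hρ : 0 < ρ) (hE : ∀ i, Measurable (E i))
    (hB : ∀ j, Measurable (B j)) (hBlaw : ∀ j, HasLaw (B j) (expMeasure ρ) P)
    (hBind : iIndepFun B P) (hEB : IndepFun (fun ω i => E i ω) (fun ω j => B j ω) P)
    (h0 : ∀ i, 0 ≤ h i) (h1 : ∀ i, h i ≤ 1) (N n : ℕ) :
    ∫ ω, emptyProd h N (fun i => splitTime E i ω) (fun j => B j ω) n ∂P =
      ∫ ω, ∫ b, emptyProd h N (fun i => splitTime E i ω) b n ∂expSeqMeasure ρ ∂P := by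
  have := isProbabilityMeasure_expSeqMeasure hρ
  let φ : (ℕ → ℝ) → ℕ → ℝ := fun e i => ∑ j ∈ Finset.range i, e j / ((j : ℝ) + 1)
  have hφ : Measurable φ := by fun_prop
  have hT : Measurable fun ω i => splitTime E i ω :=
    measurable_pi_iff.2 fun i => measurable_splitTime hE i
  have hX : HasLaw (fun ω j => B j ω) (expSeqMeasure ρ) P :=
    hBind.hasLaw_infinitePi hBlaw (measurable_pi_iff.2 hB).aemeasurable
  have hind : IndepFun (fun ω i => splitTime E i ω) (fun ω j => B j ω) P :=
    hEB.comp hφ measurable_id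
  exact integral_comp_of_indepFun hT.aemeasurable hX hind (measurable_emptyProd h N n)
    fun p => abs_emptyProd_le N h0 h1 p.1 p.2 n

/-- Of the shift -2δ, one half comes from freezing M at time K and the other from taking κ = e^{ρδ}
in the Poisson comparison. On the oscillation event the product is only bounded by 1. The reverse
bound `le_integral_emptyProd` uses κ = e^{-ρδ} and pays for the first K bins. -/
lemma integral_emptyProd_le (hρ : 0 < ρ) (hE : ∀ i, Measurable (E i))
    (hElaw : ∀ i, HasLaw (E i) (expMeasure 1) P)
    (hB : ∀ j, Measurable (B j)) (hBlaw : ∀ j, HasLaw (B j) (expMeasure ρ) P)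
    (hBind : iIndepFun B P) (hEB : IndepFun (fun ω i => E i ω) (fun ω j => B j ω) P)
    (h0 : ∀ i, 0 ≤ h i) (h1 : ∀ i, h i ≤ 1) {K N : ℕ} (hK : 1 ≤ K) (hKN : K ≤ N) {δ : ℝ}
    (hδ : 0 < δ) (n : ℕ) :
    ∫ ω, emptyProd h N (fun i => splitTime E i ω) (fun j => B j ω) n ∂P ≤
      ∫ ω, indepProd ρ h K N n (M E K ω + -(2 * δ)) (fun i => E i ω) ∂P +
        P.real (oscEvent E δ K) +
        Real.exp (-(n * (Real.exp (ρ * δ) - 1 - Real.log (Real.exp (ρ * δ))))) := by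
  have := isProbabilityMeasure_expSeqMeasure hρ
  have hκ1 : 1 < Real.exp (ρ * δ) := Real.one_lt_exp_iff.2 (by positivity)
  have hpos := ae_forall_pos hElaw
  rw [integral_emptyProd_eq hρ hE hB hBlaw hBind hEB h0 h1]
  have hT : Measurable fun ω i => splitTime E i ω :=
    measurable_pi_iff.2 fun i => measurable_splitTime hE i
  have hm1 : Measurable fun ω =>
      ∫ b, emptyProd h N (fun i => splitTime E i ω) b n ∂expSeqMeasure ρ :=
    ((measurable_emptyProd h N n).stronglyMeasurable.integral_prod_right'
      (ν := expSeqMeasure ρ)).measurable.comp hT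
  have hi1 : Integrable (fun ω =>
      ∫ b, emptyProd h N (fun i => splitTime E i ω) b n ∂expSeqMeasure ρ) P := by
    refine Integrable.of_bound hm1.aestronglyMeasurable 1 (ae_of_all _ fun ω => ?_)
    refine (norm_integral_le_of_norm_le_const (ae_of_all _ fun b =>
      abs_emptyProd_le N h0 h1 _ b n)).trans_eq (by simp)
  have hi2 : Integrable (fun ω => indepProd ρ h K N n (M E K ω + -(2 * δ)) fun i => E i ω) P :=
    integrable_of_ae_mem (measurable_indepProd hE K N _ _)
      (hpos.mono fun ω hω => indepProd_mem hρ h0 h1 K N (Nat.cast_nonneg n) _ hω)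
  have hosc := measurableSet_oscEvent hE δ K
  have hi3 : Integrable ((oscEvent E δ K).indicator fun _ => (1 : ℝ)) P :=
    (integrable_const _).indicator hosc
  have hi23 : Integrable (fun ω => indepProd ρ h K N n (M E K ω + -(2 * δ)) (fun i => E i ω) +
      (oscEvent E δ K).indicator (fun _ => (1 : ℝ)) ω) P := hi2.add hi3
  refine (integral_mono_ae hi1 (hi23.add (integrable_const
    (Real.exp (-(n * (Real.exp (ρ * δ) - 1 - Real.log (Real.exp (ρ * δ)))))))) ?_).trans_eq ?_
  · filter_upwards [hpos] with ω hω
    have hl : 0 ≤ Real.exp (ρ * δ) * n := by positivity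
    refine (integral_le_poissonProd N h0 h1 hρ (by simp [splitTime]) (splitTime_mono hω) hκ1
      n).trans (add_le_add_left ?_ _)
    have hind := indepProd_mem hρ h0 h1 K N (Nat.cast_nonneg n) (M E K ω + -(2 * δ)) hω
    beta_reduce
    by_cases hω' : ω ∈ oscEvent E δ K
    · rw [Set.indicator_of_mem hω']
      linarith [(poissonProd_mem hρ h0 h1 N (splitTime_mono hω) hl).2]
    · rw [Set.indicator_of_notMem hω', add_zero]
      refine (poissonProd_le_indepProd hρ h0 h1 hK hKN hl hω hω').trans_eq ?_
      rw [indepProd_shift]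
      congr 1
      ring
  · simp only [Pi.add_apply]
    rw [integral_add hi23 (integrable_const _), integral_add hi2 hi3,
      integral_indicator_const _ hosc]
    simp

lemma measurable_firstBins (hE : ∀ i, Measurable (E i)) (K : ℕ) (l : ℝ) :
    Measurable (firstBins ρ E K l) := by
  have := measurable_splitTime hE
  unfold firstBins
  fun_prop

/-- Each of the K bins has positive length almost surely, so its emptiness probability decays
exponentially in n for fixed split times. -/
lemma tendsto_integral_firstBins (hρ : 0 < ρ) (hE : ∀ i, Measurable (E i))
    (hElaw : ∀ i, HasLaw (E i) (expMeasure 1) P) (K : ℕ) {κ : ℝ} (hκ : 0 < κ) :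
    Tendsto (fun n : ℕ => ∫ ω, firstBins ρ E K (κ * n) ω ∂P) atTop (𝓝 0) := by
  have hpos := ae_forall_pos hElaw
  rw [← integral_zero Ω ℝ (μ := P)]
  refine tendsto_integral_of_dominated_convergence (fun _ => (K : ℝ))
    (fun n => (measurable_firstBins hE K _).aestronglyMeasurable) (integrable_const _)
    (fun n => hpos.mono fun ω hω => norm_firstBins_le hρ K (by positivity) hω) ?_
  filter_upwards [hpos] with ω hω
  have h : ∀ i ∈ Finset.range K, Tendsto (fun n : ℕ => Real.exp (-(κ * n *
      (Real.exp (-(ρ * splitTime E i ω)) - Real.exp (-(ρ * splitTime E (i + 1) ω)))))) atTop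
      (𝓝 0) := by
    intro i _
    have hlt : 0 < Real.exp (-(ρ * splitTime E i ω)) - Real.exp (-(ρ * splitTime E (i + 1) ω)) :=
      sub_pos.2 (Real.exp_lt_exp.2 (neg_lt_neg (mul_lt_mul_of_pos_left (splitTime_lt hω i) hρ)))
    exact Real.tendsto_exp_neg_atTop_nhds_zero.comp
      ((tendsto_natCast_atTop_atTop.const_mul_atTop hκ).atTop_mul_const hlt)
  simpa [firstBins] using tendsto_finsetSum _ h

lemma le_integral_emptyProd (hρ : 0 < ρ) (hE : ∀ i, Measurable (E i))
    (hElaw : ∀ i, HasLaw (E i) (expMeasure 1) P)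
    (hB : ∀ j, Measurable (B j)) (hBlaw : ∀ j, HasLaw (B j) (expMeasure ρ) P)
    (hBind : iIndepFun B P) (hEB : IndepFun (fun ω i => E i ω) (fun ω j => B j ω) P)
    (h0 : ∀ i, 0 ≤ h i) (h1 : ∀ i, h i ≤ 1) {K N : ℕ} (hK : 1 ≤ K) (hKN : K ≤ N) {δ : ℝ}
    (hδ : 0 < δ) (n : ℕ) :
    ∫ ω, indepProd ρ h K N n (M E K ω + 2 * δ) (fun i => E i ω) ∂P ≤
      ∫ ω, emptyProd h N (fun i => splitTime E i ω) (fun j => B j ω) n ∂P +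
        Real.exp (-(n * (Real.exp (ρ * -δ) - 1 - Real.log (Real.exp (ρ * -δ))))) +
        ∫ ω, firstBins ρ E K (Real.exp (ρ * -δ) * n) ω ∂P + P.real (oscEvent E δ K) := by
  have := isProbabilityMeasure_expSeqMeasure hρ
  have hκ1 : Real.exp (ρ * -δ) < 1 := Real.exp_lt_one_iff.2 (by nlinarith)
  have hpos := ae_forall_pos hElaw
  rw [integral_emptyProd_eq hρ hE hB hBlaw hBind hEB h0 h1]
  have hT : Measurable fun ω i => splitTime E i ω :=
    measurable_pi_iff.2 fun i => measurable_splitTime hE i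
  have hm1 : Measurable fun ω =>
      ∫ b, emptyProd h N (fun i => splitTime E i ω) b n ∂expSeqMeasure ρ :=
    ((measurable_emptyProd h N n).stronglyMeasurable.integral_prod_right'
      (ν := expSeqMeasure ρ)).measurable.comp hT
  have hi1 : Integrable (fun ω =>
      ∫ b, emptyProd h N (fun i => splitTime E i ω) b n ∂expSeqMeasure ρ) P := by
    refine Integrable.of_bound hm1.aestronglyMeasurable 1 (ae_of_all _ fun ω => ?_)
    refine (norm_integral_le_of_norm_le_const (ae_of_all _ fun b =>
      abs_emptyProd_le N h0 h1 _ b n)).trans_eq (by simp)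
  have hi2 : Integrable (fun ω => indepProd ρ h K N n (M E K ω + 2 * δ) fun i => E i ω) P :=
    integrable_of_ae_mem (measurable_indepProd hE K N _ _)
      (hpos.mono fun ω hω => indepProd_mem hρ h0 h1 K N (Nat.cast_nonneg n) _ hω)
  have hosc := measurableSet_oscEvent hE δ K
  have hi3 : Integrable ((oscEvent E δ K).indicator fun _ => (1 : ℝ)) P :=
    (integrable_const _).indicator hosc
  have hi4 : Integrable (firstBins ρ E K (Real.exp (ρ * -δ) * n)) P :=
    Integrable.of_bound (measurable_firstBins hE K _).aestronglyMeasurable K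
      (hpos.mono fun ω hω => norm_firstBins_le hρ K (by positivity) hω)
  set c := Real.exp (-(n * (Real.exp (ρ * -δ) - 1 - Real.log (Real.exp (ρ * -δ))))) with hc
  have hi5 : Integrable (fun ω =>
      ∫ b, emptyProd h N (fun i => splitTime E i ω) b n ∂expSeqMeasure ρ + c) P :=
    hi1.add (integrable_const _)
  have hi6 : Integrable (fun ω =>
      ∫ b, emptyProd h N (fun i => splitTime E i ω) b n ∂expSeqMeasure ρ + c +
        firstBins ρ E K (Real.exp (ρ * -δ) * n) ω) P := hi5.add hi4
  refine (integral_mono_ae hi2 (hi6.add hi3) ?_).trans_eq ?_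
  · filter_upwards [hpos] with ω hω
    have hl : 0 ≤ Real.exp (ρ * -δ) * n := by positivity
    have hp := poissonProd_le_integral N h0 h1 hρ (t := fun i => splitTime E i ω)
      (by simp [splitTime]) (splitTime_mono hω) (Real.exp_pos _) hκ1 n
    have hind := indepProd_mem hρ h0 h1 K N (Nat.cast_nonneg n) (M E K ω + 2 * δ) hω
    have hp0 := (poissonProd_mem hρ h0 h1 N (splitTime_mono hω) hl).1
    have hf0 : 0 ≤ firstBins ρ E K (Real.exp (ρ * -δ) * n) ω :=
      Finset.sum_nonneg fun _ _ => (Real.exp_pos _).le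
    by_cases hω' : ω ∈ oscEvent E δ K
    · simp only [Pi.add_apply, Set.indicator_of_mem hω']
      linarith
    · simp only [Pi.add_apply, Set.indicator_of_notMem hω', add_zero]
      have h2 := indepProd_le_poissonProd hρ h0 h1 hK hKN hl hω hω'
      rw [indepProd_shift] at h2
      have h3 : M E K ω + δ - -δ = M E K ω + 2 * δ := by ring
      rw [h3] at h2
      exact h2.trans (add_le_add_left hp _)
  · simp only [Pi.add_apply]
    rw [integral_add hi6 hi3, integral_add hi5 hi4, integral_add hi1 (integrable_const _),
      integral_indicator_const _ hosc]
    simp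

lemma tendsto_integral_condLaplace (hρ : 0 < ρ) {I : ℝ} (hI : 0 ≤ I) {ι : Type*} {F : Filter ι}
    [F.IsCountablyGenerated] {m : ι → Ω → ℝ} {m' : Ω → ℝ} (hm : ∀ i, AEMeasurable (m i) P)
    (hlim : ∀ᵐ ω ∂P, Tendsto (fun i => m i ω) F (𝓝 (m' ω))) :
    Tendsto (fun i => ∫ ω, condLaplace ρ I (m i ω) ∂P) F (𝓝 (∫ ω, condLaplace ρ I (m' ω) ∂P)) :=
  tendsto_integral_filter_of_dominated_convergence (fun _ => 1)
    (Eventually.of_forall fun i =>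
      ((continuous_condLaplace hρ I).measurable.comp_aemeasurable (hm i)).aestronglyMeasurable)
    (Eventually.of_forall fun _ => ae_of_all _ fun _ => abs_condLaplace_le hρ hI _)
    (integrable_const _)
    (hlim.mono fun _ hω => ((continuous_condLaplace hρ I).tendsto _).comp hω)

theorem tendsto_integral_emptyProd (hρ : 0 < ρ) (hE : ∀ i, Measurable (E i))
    (hElaw : ∀ i, HasLaw (E i) (expMeasure 1) P) (hEind : iIndepFun E P)
    (hB : ∀ j, Measurable (B j)) (hBlaw : ∀ j, HasLaw (B j) (expMeasure ρ) P)
    (hBind : iIndepFun B P) (hEB : IndepFun (fun ω i => E i ω) (fun ω j => B j ω) P)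
    {G : ℝ → ℝ} (hG : Continuous G) (hG0 : ∀ x, 0 ≤ G x) (hG1 : ∀ x, G x ≤ 1) {A : ℝ}
    (hA : 0 < A) (hGA : ∀ x, A ≤ x → G x = 0) :
    Tendsto (fun n : ℕ => ∫ ω, emptyProd (fun i => G ((i + 1) / (n : ℝ) ^ (1 / (ρ + 2))))
        ⌈A * (n : ℝ) ^ (1 / (ρ + 2))⌉₊ (fun i => splitTime E i ω) (fun j => B j ω) n ∂P) atTop
      (𝓝 (∫ ω, condLaplace ρ (∫ x in Set.Ici (0 : ℝ), G x * x ^ (ρ + 1)) (Minf E ω) ∂P)) := by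
  set I := ∫ x in Set.Ici (0 : ℝ), G x * x ^ (ρ + 1) with hIdef
  have hI : 0 ≤ I := setIntegral_nonneg measurableSet_Ici fun x hx =>
    mul_nonneg (hG0 x) (Real.rpow_nonneg hx _)
  have hρ2 : 0 < ρ + 2 := by linarith
  set a : ℕ → ℝ := fun n => (n : ℝ) ^ (1 / (ρ + 2)) with ha
  have ha0 : ∀ n, 0 ≤ a n := fun n => Real.rpow_nonneg (Nat.cast_nonneg n) _
  have hapow : ∀ n, a n ^ (ρ + 2) = n := fun n => by
    rw [ha, ← Real.rpow_mul (Nat.cast_nonneg n), one_div_mul_cancel hρ2.ne', Real.rpow_one]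
  have halim : Tendsto a atTop atTop :=
    (tendsto_rpow_atTop (by positivity)).comp tendsto_natCast_atTop_atTop
  have hM := ae_tendsto_M hE hElaw hEind
  have hMm := measurable_M hE
  have hMinf : AEMeasurable (Minf E) P :=
    aemeasurable_of_tendsto_metrizable_ae atTop (fun n => (hMm n).aemeasurable) hM
  rw [Metric.tendsto_atTop]
  intro ε hε
  -- choice of the width `δ`
  have hd : Tendsto (fun d : ℝ => ∫ ω, condLaplace ρ I (Minf E ω + d) ∂P) (𝓝 0)
      (𝓝 (∫ ω, condLaplace ρ I (Minf E ω) ∂P)) :=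
    tendsto_integral_condLaplace hρ hI (fun d => hMinf.add_const d)
      (ae_of_all _ fun ω => by simpa using (tendsto_id (x := 𝓝 (0 : ℝ))).const_add (Minf E ω))
  -- The lower bound adds six errors, each given ε/6: the shift 2δ, the replacement of M_∞ by M_K,
  -- the oscillation event, the limit in n, the Poisson tail and the first K bins.
  obtain ⟨r, hr, hr'⟩ := Metric.eventually_nhds_iff.1 (Metric.tendsto_nhds.1 hd (ε / 6)
    (by positivity))
  set δ := r / 4 with hδ
  have hδ0 : 0 < δ := by positivity
  have hd1 := hr' (y := 2 * δ) (by rw [dist_zero_right, Real.norm_of_nonneg (by positivity)]; linarith)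
  have hd2 := hr' (y := -(2 * δ)) (by
    rw [dist_zero_right, norm_neg, Real.norm_of_nonneg (by positivity)]; linarith)
  -- choice of the time `K`
  have hKlim : ∀ d : ℝ, Tendsto (fun K => ∫ ω, condLaplace ρ I (M E K ω + d) ∂P) atTop
      (𝓝 (∫ ω, condLaplace ρ I (Minf E ω + d) ∂P)) := fun d =>
    tendsto_integral_condLaplace hρ hI (fun K => (hMm K).aemeasurable.add_const d)
      (hM.mono fun ω hω => hω.add_const d)
  obtain ⟨K, hK1, hK2, hK3, hK4⟩ := ((eventually_ge_atTop 1).and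
    ((Metric.tendsto_nhds.1 (hKlim (2 * δ)) (ε / 6) (by positivity)).and
    ((Metric.tendsto_nhds.1 (hKlim (-(2 * δ))) (ε / 6) (by positivity)).and
    ((tendsto_measure_oscEvent hE hM hδ0).eventually_lt_const
      (by positivity : 0 < ε / 6))))).exists
  -- large `n`
  have hn1 := Metric.tendsto_nhds.1 (tendsto_integral_indepProd hE hElaw hEind hρ hG hG0 hG1 hA hGA
    hK1 (2 * δ) ha0 halim) (ε / 6) (by positivity)
  have hn2 := Metric.tendsto_nhds.1 (tendsto_integral_indepProd hE hElaw hEind hρ hG hG0 hG1 hA hGA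
    hK1 (-(2 * δ)) ha0 halim) (ε / 6) (by positivity)
  have hn3 := (tendsto_poisson_tail (Real.exp_pos (ρ * δ))
    (Real.one_lt_exp_iff.2 (by positivity)).ne').eventually_lt_const (by positivity : 0 < ε / 6)
  have hn4 := (tendsto_poisson_tail (Real.exp_pos (ρ * -δ))
    (Real.exp_lt_one_iff.2 (by nlinarith)).ne).eventually_lt_const (by positivity : 0 < ε / 6)
  have hn5 := (tendsto_integral_firstBins hρ hE hElaw K
    (Real.exp_pos (ρ * -δ))).eventually_lt_const (by positivity : 0 < ε / 6)
  have hn6 : ∀ᶠ n in atTop, K ≤ ⌈A * a n⌉₊ := by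
    filter_upwards [(halim.const_mul_atTop hA).eventually_ge_atTop (K : ℝ)] with n hn
    exact_mod_cast hn.trans (Nat.le_ceil _)
  obtain ⟨n₀, hn₀⟩ := eventually_atTop.1
    (hn1.and (hn2.and (hn3.and (hn4.and (hn5.and hn6)))))
  refine ⟨n₀, fun n hn => ?_⟩
  obtain ⟨b1, b2, b3, b4, b5, b6⟩ := hn₀ n hn
  have hup := integral_emptyProd_le hρ hE hElaw hB hBlaw hBind hEB
    (h := fun i => G ((i + 1) / a n)) (fun _ => hG0 _) (fun _ => hG1 _) hK1 b6 hδ0 n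
  have hlow := le_integral_emptyProd hρ hE hElaw hB hBlaw hBind hEB
    (h := fun i => G ((i + 1) / a n)) (fun _ => hG0 _) (fun _ => hG1 _) hK1 b6 hδ0 n
  rw [hapow, Real.dist_eq] at b1 b2
  rw [Real.dist_eq] at hd1 hd2 hK2 hK3 ⊢
  have := abs_lt.1 b1
  have := abs_lt.1 b2
  have := abs_lt.1 hd1
  have := abs_lt.1 hd2
  have := abs_lt.1 hK2
  have := abs_lt.1 hK3
  exact abs_lt.2 ⟨by linarith, by linarith⟩

end

/-! ### The point process of empty bins -/

section

variable {Ω : Type*} {E B : ℕ → Ω → ℝ}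

lemma integral_emptyBins {ρ : ℝ} {n : ℕ} (hn : n ≠ 0) (ω : Ω)
    (g : C_c(ℝ≥0, ℝ≥0)) {A : ℝ≥0} (hA : ∀ x, A ≤ x → g x = 0) :
    (emptyBins ρ E B n ω).integral g =
      ∑ i ∈ Finset.range ⌈(A : ℝ) * (n : ℝ) ^ (1 / (ρ + 2))⌉₊,
        emptyInd (fun i => splitTime E i ω) (fun j => B j ω) n i *
          (g (((i : ℝ) + 1) / (n : ℝ) ^ (1 / (ρ + 2))).toNNReal : ℝ) := by
  classical
  have ha : 0 < (n : ℝ) ^ (1 / (ρ + 2)) :=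
    Real.rpow_pos_of_pos (by exact_mod_cast Nat.pos_of_ne_zero hn) _
  have hx : ∀ i : ℕ, ((i : ℝ≥0) + 1) / (n : ℝ≥0) ^ (1 / (ρ + 2)) =
      (((i : ℝ) + 1) / (n : ℝ) ^ (1 / (ρ + 2))).toNNReal := by
    intro i
    apply NNReal.eq
    rw [Real.coe_toNNReal _ (by positivity)]
    push_cast
    rfl
  have h := integral_toLocFin_sum_dirac
    (fun i : {i : ℕ // BinEmpty E B n ω i} => ((i.1 : ℝ≥0) + 1) / (n : ℝ≥0) ^ (1 / (ρ + 2)))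
    (isLocallyFiniteMeasure_emptyBinsMeasure ρ E B hn ω) g
  refine h.trans ?_
  simp_rw [hx]
  refine (tsum_subtype {i | BinEmpty E B n ω i}
    fun i => (g (((i : ℝ) + 1) / (n : ℝ) ^ (1 / (ρ + 2))).toNNReal : ℝ)).trans ?_
  rw [tsum_eq_sum (s := Finset.range ⌈(A : ℝ) * (n : ℝ) ^ (1 / (ρ + 2))⌉₊)]
  · refine Finset.sum_congr rfl fun i _ => ?_
    rw [Set.indicator_apply, emptyInd, ite_mul, one_mul, zero_mul]
    exact if_congr Iff.rfl rfl rfl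
  · intro i hi
    have hi' : (A : ℝ) * (n : ℝ) ^ (1 / (ρ + 2)) ≤ i := by
      simpa [Nat.ceil_le] using hi
    have h0 : g (((i : ℝ) + 1) / (n : ℝ) ^ (1 / (ρ + 2))).toNNReal = 0 :=
      hA _ (NNReal.le_toNNReal_of_coe_le ((le_div_iff₀ ha).2 (by linarith)))
    rw [Set.indicator_apply, h0, NNReal.coe_zero, ite_self]

/-- Emptiness is a 0-1 variable, so e^{-g·1} = 1 - (1 - e^{-g})·1 factor by factor: the Laplace
functional is the mean of an `emptyProd` with h = 1 - e^{-g}. -/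
lemma exp_neg_integral_emptyBins {ρ : ℝ} {n : ℕ} (hn : n ≠ 0) (ω : Ω)
    (g : C_c(ℝ≥0, ℝ≥0)) {A : ℝ≥0} (hA : ∀ x, A ≤ x → g x = 0) :
    Real.exp (-(emptyBins ρ E B n ω).integral g) =
      emptyProd (fun i => 1 - Real.exp
          (-(g (((i : ℝ) + 1) / (n : ℝ) ^ (1 / (ρ + 2))).toNNReal : ℝ)))
        ⌈(A : ℝ) * (n : ℝ) ^ (1 / (ρ + 2))⌉₊ (fun i => splitTime E i ω) (fun j => B j ω) n := by
  rw [integral_emptyBins hn ω g hA, ← Finset.sum_neg_distrib, Real.exp_sum, emptyProd]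
  refine Finset.prod_congr rfl fun i _ => ?_
  rw [emptyInd]
  split_ifs <;> simp

end

lemma measurable_emptyBins {Ω : Type*} [MeasurableSpace Ω] {E B : ℕ → Ω → ℝ}
    (hE : ∀ i, Measurable (E i)) (hB : ∀ j, Measurable (B j)) (ρ : ℝ) (n : ℕ) :
    Measurable (emptyBins ρ E B n) := by
  rcases eq_or_ne n 0 with rfl | hn
  -- For n = 0 the local finiteness behind `integral_emptyBins` is not available, but every bin is
  -- empty and the process is constant in ω.
  · have h : ∀ ω ω', emptyBins ρ E B 0 ω = emptyBins ρ E B 0 ω' := by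
      intro ω ω'
      have : BinEmpty E B 0 ω = BinEmpty E B 0 ω' := by
        ext i
        simp [BinEmpty]
      unfold emptyBins emptyBinsMeasure
      rw [this]
    exact measurable_const' h
  · refine measurable_of_integral fun g => ?_
    obtain ⟨A, -, hA⟩ := exists_forall_ge_eq_zero g
    simp_rw [integral_emptyBins hn _ g hA]
    refine Finset.measurable_sum _ fun i _ => ?_
    have hme : Measurable fun ω =>
        emptyInd (fun i => splitTime E i ω) (fun j => B j ω) n i :=
      (measurable_emptyInd n i).comp (f := fun ω => ((fun i => splitTime E i ω), fun j => B j ω))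
        ((measurable_pi_iff.2 fun i => measurable_splitTime hE i).prodMk (measurable_pi_iff.2 hB))
    exact hme.mul_const _

end
end YuleBins

/-! ### The limit theorem for the empty bins -/

open YuleBins in
theorem mainTheorem1
    {Ω : Type*} [MeasurableSpace Ω] (P : Measure Ω) [IsProbabilityMeasure P]
    (ρ : ℝ) (hρ : 0 < ρ)
    (E B : ℕ → Ω → ℝ)
    (hE : ∀ i, Measurable (E i)) (hB : ∀ j, Measurable (B j))
    (hElaw : ∀ i, HasLaw (E i) (expMeasure 1) P) (hEind : iIndepFun E P)
    (hBlaw : ∀ j, HasLaw (B j) (expMeasure ρ) P) (hBind : iIndepFun B P)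
    (hEB : IndepFun (fun ω i => E i ω) (fun ω j => B j ω) P) :
    (∀ᵐ ω ∂P, Tendsto (fun n => YuleBins.M E n ω) atTop (𝓝 (YuleBins.Minf E ω))) ∧
    ∃ Q : ProbabilityMeasure YuleBins.LocFinMeasure,
      (∀ᵐ μ ∂(Q : Measure YuleBins.LocFinMeasure), μ.IsPointMeasure) ∧
      TendstoInDistribution (YuleBins.emptyBins ρ E B) atTop id (fun _ => P)
        (Q : Measure YuleBins.LocFinMeasure) ∧
      (∀ g : C_c(ℝ≥0, ℝ≥0),
        ∫ μ, Real.exp (-μ.integral g) ∂(Q : Measure YuleBins.LocFinMeasure) =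
          ∫ ω, Real.exp (-(YuleBins.Winf E ω ^ (-ρ) / ρ) *
            ∫ x in Set.Ici (0 : ℝ),
              (1 - Real.exp (-(g x.toNNReal : ℝ))) * x ^ (ρ + 1)) ∂P) ∧
      (∀ {Ω' : Type*} [MeasurableSpace Ω'] (P' : Measure Ω') [IsProbabilityMeasure P']
        (W : Ω' → ℝ) (τ : ℕ → Ω' → ℝ),
        Measurable W → IdentDistrib W (YuleBins.Winf E) P' P →
        YuleBins.IsPoissonPoints (1 / (ρ * (ρ + 2))) τ P' →
        IndepFun W (fun ω' i => τ i ω') P' →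
        (∀ᵐ ω' ∂P',
          IsLocallyFiniteMeasure (YuleBins.scaledPoints ρ (W ω') (fun i => τ i ω'))) ∧
        HasLaw (fun ω' => YuleBins.toLocFin
            (YuleBins.scaledPoints ρ (W ω') (fun i => τ i ω')))
          (Q : Measure YuleBins.LocFinMeasure) P') := by
  have hM := ae_tendsto_M hE hElaw hEind
  have hMinf : AEMeasurable (Minf E) P :=
    aemeasurable_of_tendsto_metrizable_ae atTop (fun n => (measurable_M hE n).aemeasurable) hM
  have hW : AEMeasurable (Winf E) P := hMinf.neg.exp
  have hL : ∀ᵐ w ∂P.map (Winf E), 0 < w :=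
    (ae_map_iff hW measurableSet_Ioi).2 (ae_of_all _ fun ω => Real.exp_pos _)
  have := Measure.isProbabilityMeasure_map hW
  -- The limit is taken to be the law of the rescaled Poisson points, with W distributed as W_∞. Its
  -- representation and its Laplace functional are then already known, and only the convergence
  -- remains.
  let Q : ProbabilityMeasure LocFinMeasure :=
    ⟨limitLaw ρ (P.map (Winf E)), isProbabilityMeasure_limitLaw hρ hL⟩
  have hLap : ∀ g : C_c(ℝ≥0, ℝ≥0),
      ∫ μ, Real.exp (-μ.integral g) ∂(Q : Measure LocFinMeasure) =
        ∫ ω, Real.exp (-(Winf E ω ^ (-ρ) / ρ) * ∫ x in Set.Ici (0 : ℝ),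
          (1 - Real.exp (-(g x.toNNReal : ℝ))) * x ^ (ρ + 1)) ∂P := fun g =>
    (integral_laplace_limitLaw hρ hL g).trans
      (integral_map hW (by fun_prop : Measurable _).aestronglyMeasurable)
  have hmeas := fun n => (measurable_emptyBins hE hB ρ n).aemeasurable (μ := P)
  refine ⟨hM, Q, ae_isPointMeasure_limitLaw hρ hL, ⟨hmeas, aemeasurable_id, ?_⟩, hLap, ?_⟩
  · have hid : (⟨(Q : Measure LocFinMeasure).map id,
        Measure.isProbabilityMeasure_map aemeasurable_id⟩ : ProbabilityMeasure LocFinMeasure) = Q :=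
      Subtype.ext Measure.map_id
    rw [hid]
    refine tendsto_of_tendsto_laplace fun g => ?_
    have hg : Measurable fun μ : LocFinMeasure => Real.exp (-μ.integral g) :=
      (LocFinMeasure.measurable_integral g).neg.exp
    obtain ⟨A, hA0, hA⟩ := exists_forall_ge_eq_zero g
    -- This is the function h of the occupancy products, extended to the real line by its value at
    -- 0; it takes values in [0, 1] and vanishes from A on.
    set G : ℝ → ℝ := fun x => 1 - Real.exp (-(g x.toNNReal : ℝ)) with hG
    have hGc : Continuous G := by fun_prop
    have key := tendsto_integral_emptyProd hρ hE hElaw hEind hB hBlaw hBind hEB hGc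
      (fun x => sub_nonneg.2 (Real.exp_le_one_iff.2 (neg_nonpos.2 (NNReal.coe_nonneg _))))
      (fun x => sub_le_self _ (Real.exp_pos _).le) (A := A) (by exact_mod_cast hA0)
      (fun x hx => by simp [hG, hA _ (NNReal.le_toNNReal_of_coe_le hx)])
    have hlim : ∫ ω, condLaplace ρ (∫ x in Set.Ici (0 : ℝ), G x * x ^ (ρ + 1)) (Minf E ω) ∂P =
        ∫ μ, Real.exp (-μ.integral g) ∂(Q : Measure LocFinMeasure) := by
      rw [hLap]
      congr 1
      ext1 ω
      rw [condLaplace, Winf, ← Real.exp_mul, neg_mul_neg, Real.exp_neg (ρ * _), mul_comm ρ (Minf E ω)]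
      congr 1
      field_simp
      rfl
    rw [← hlim]
    refine key.congr' ?_
    filter_upwards [eventually_ne_atTop 0] with n hn
    refine Eq.trans ?_ (integral_map (hmeas n) hg.aestronglyMeasurable).symm
    simp only [exp_neg_integral_emptyBins hn _ g hA, hG]
  · intro Ω' _ P' _ W τ _ hWid hτ hind
    exact hasLaw_scaledPoints hρ hL ⟨hWid.aemeasurable_fst, hWid.map_eq⟩ hτ hind
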